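/- Let $H$ be a complex Hilbert space, let $D$ be a (possibly unbounded) self-adjoint operator on $H$, and let $F_X$ be a linear operator on $H$ that is of first order relative to $D$, that is, $\operatorname{dom} D\subseteq\operatorname{dom} F_X$ and there is a constant $a$ with $\|F_Xx\|\le a(\|x\|+\|Dx\|)$ for all $x\in\operatorname{dom}D$. (The model case: $M$ is a closed spin manifold with a group action, $H=L^2(M;S)$ is the space of $L^2$-spinors, $D$ is the closure of the Dirac operator, and $F_X$ is a first order differential operator with smooth coefficients depending on a Lie algebra element $X$, which is fixed here, acting on the first Sobolev space $\operatorname{dom}D$.) Put $H_X=D^2+F_X$ with domain $\operatorname{dom}D^2=\{x\in\operatorname{dom}D: Dx\in\operatorname{dom}D\}$. Then $-D^2$ and $-H_X$ generate strongly continuous semigroups $(e^{-sD^2})_{s\ge0}$ and $(e^{-sH_X})_{s\ge 0}$ of bounded operators on $H$, and for all $0<u\le1$ and $t>0$ $$\|e^{-utH_X}\|_{u^{-1}}\le 2e^{t/2}\Bigl\{1+\bigl[\|(1+D^2)^{-1/2}F_X\|^2e^{-1}\pi ut\bigr]^{1/2}\Bigr\}\,e^{\|(1+D^2)^{-1/2}F_X\|^2e^{-1}\pi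 ut}\,\bigl(\operatorname{tr}e^{-tD^2/2}\bigr)^u .$$ Here $\|A\|_p=(\operatorname{tr}|A|^p)^{1/p}\in[0,\infty]$ is the Schatten $p$-norm, and $\|(1+D^2)^{-1/2}F_X\|\in[0,\infty]$ is the operator norm of $(1+D^2)^{-1/2}F_X$ on $\operatorname{dom}F_X$; in particular, if this norm and $\operatorname{tr}e^{-tD^2/2}$ are finite, then $e^{-utH_X}$ belongs to the Schatten ideal $L^{1/u}$. -/

import Mathlib

open scoped ENNReal Topology InnerProductSpace

noncomputable section

namespace HeatSchatten

variable {H : Type*} [NormedAddCommGroup H] [InnerProductSpace ℂ H]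

/-! ### Unbounded operators -/

/-- The square `D²` of an unbounded operator, with its natural domain
`dom D² = {x ∈ dom D | D x ∈ dom D}`. -/
def sq (D : H →ₗ.[ℂ] H) : H →ₗ.[ℂ] H :=
  D.comp (D.domRestrict ((D.domain.comap D.toFun).map D.domain.subtype)) (by
    rintro ⟨x, ⟨y, hy, rfl⟩, hx⟩
    exact hy)

/-- `F` is an operator of order at most one relative to `D`: it is defined on `dom D`, and it is
bounded from `dom D` with the graph norm to `H`.  When `D` is the closure of a Dirac operator on a
closed manifold, `dom D` with the graph norm is the first Sobolev space, and every first order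
differential operator with smooth coefficients has this property. -/
structure IsFirstOrder (D F : H →ₗ.[ℂ] H) : Prop where
  domain_le : D.domain ≤ F.domain
  bounded : ∃ a : ℝ, ∀ x : D.domain,
    ‖F ⟨x, domain_le x.2⟩‖ ≤ a * (‖(x : H)‖ + ‖D x‖)

/-- The operator norm, in `[0, ∞]`, of an operator defined on a subspace of `H`. -/
def opENorm (A : H →ₗ.[ℂ] H) : ℝ≥0∞ :=
  ⨆ (x : A.domain) (_ : ‖(x : H)‖ ≤ 1), ‖A x‖ₑ

/-- `T` is the strongly continuous semigroup `s ↦ e^{-sA}`, `s ≥ 0`: a strongly continuous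
one-parameter semigroup of bounded operators whose infinitesimal generator is exactly `-A`
(including its domain). -/
structure IsExpNeg (A : H →ₗ.[ℂ] H) (T : ℝ → H →L[ℂ] H) : Prop where
  zero : T 0 = 1
  add : ∀ s r : ℝ, 0 ≤ s → 0 ≤ r → T (s + r) = T s * T r
  continuousOn : ∀ x : H, ContinuousOn (fun s => T s x) (Set.Ici 0)
  generator : ∀ x y : H, (x, y) ∈ A.graph ↔
    Filter.Tendsto (fun s : ℝ => (s : ℂ)⁻¹ • (x - T s x)) (𝓝[>] 0) (𝓝 y)

/-- `-A` generates a strongly continuous semigroup. -/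
def GeneratesExpNeg (A : H →ₗ.[ℂ] H) : Prop := ∃ T, IsExpNeg A T

open Classical in
/-- The operator `e^{-sA}`, `s ≥ 0`, whenever `-A` generates a strongly continuous semigroup
(which is then unique on `[0, ∞)`). -/
def expNeg (A : H →ₗ.[ℂ] H) (s : ℝ) : H →L[ℂ] H :=
  if h : GeneratesExpNeg A then h.choose s else 0

/-- `R` is the bounded two-sided inverse of `1 + D² : dom D² → H`. -/
def IsInvOneAddSq (D : H →ₗ.[ℂ] H) (R : H →L[ℂ] H) : Prop :=
  (∀ x : (sq D).domain, R (x + sq D x) = x) ∧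
    ∀ y : H, ∃ x : (sq D).domain, (x : H) = R y ∧ (x : H) + sq D x = y

open Classical in
/-- The bounded operator `(1 + D²)⁻¹`; it exists when `D` is self-adjoint, see
`exists_isInvOneAddSq`. -/
def invOneAddSq (D : H →ₗ.[ℂ] H) : H →L[ℂ] H :=
  if h : ∃ R, IsInvOneAddSq D R then h.choose else 0

theorem mem_sq_domain {D : H →ₗ.[ℂ] H} {x : H} :
    x ∈ (sq D).domain ↔ ∃ h : x ∈ D.domain, D ⟨x, h⟩ ∈ D.domain := by
  constructor
  · rintro ⟨⟨y, hy, rfl⟩, -⟩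
    exact ⟨y.2, hy⟩
  · rintro ⟨h, h'⟩
    exact ⟨⟨⟨x, h⟩, h', rfl⟩, h⟩

theorem sq_apply {D : H →ₗ.[ℂ] H} (x : (sq D).domain) (h : (x : H) ∈ D.domain)
    (h' : D ⟨x, h⟩ ∈ D.domain) : sq D x = D ⟨D ⟨x, h⟩, h'⟩ := rfl

variable [CompleteSpace H]

theorem exists_isInvOneAddSq {D : H →ₗ.[ℂ] H} (hD : IsSelfAdjoint D) :
    ∃ R, IsInvOneAddSq D R := by
  have hdense := hD.dense_domain
  have hadj : D.adjoint = D := hD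
  have hfa : ∀ a b : D.domain, ⟪D a, (b : H)⟫_ℂ = ⟪(a : H), D b⟫_ℂ := by
    have key := LinearPMap.adjoint_isFormalAdjoint hdense
    rw [hadj] at key
    exact fun a b => key a b
  -- a self-adjointness criterion for membership in the domain
  have hmem : ∀ b w : H, (∀ z : D.domain, ⟪w, (z : H)⟫_ℂ = ⟪b, D z⟫_ℂ) →
      ∃ h : b ∈ D.domain, D ⟨b, h⟩ = w := by
    intro b w hw
    have h1 : b ∈ D.adjoint.domain := LinearPMap.mem_adjoint_domain_of_exists b ⟨w, hw⟩
    have h2 : D.adjoint ⟨b, h1⟩ = w := LinearPMap.adjoint_apply_eq hdense _ hw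
    have h3 : ∀ A : H →ₗ.[ℂ] H, A = D → ∀ h : b ∈ A.domain, A ⟨b, h⟩ = w →
        ∃ h : b ∈ D.domain, D ⟨b, h⟩ = w := by
      rintro A rfl h h'
      exact ⟨h, h'⟩
    exact h3 _ hadj h1 h2
  -- the graph as a closed subspace of the Hilbert space `H ⊕ H`
  let e : WithLp 2 (H × H) ≃L[ℂ] H × H := WithLp.prodContinuousLinearEquiv 2 ℂ H H
  let G : Submodule ℂ (WithLp 2 (H × H)) := D.graph.comap (e : WithLp 2 (H × H) →ₗ[ℂ] H × H)
  have hGc : IsClosed (G : Set (WithLp 2 (H × H))) := hD.isClosed.preimage e.continuous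
  have : CompleteSpace G := hGc.completeSpace_coe
  let R : H →L[ℂ] H := (ContinuousLinearMap.fst ℂ H H) ∘L (e : WithLp 2 (H × H) →L[ℂ] H × H) ∘L
    G.starProjection ∘L (e.symm : H × H →L[ℂ] WithLp 2 (H × H)) ∘L ContinuousLinearMap.inl ℂ H H
  have hR : ∀ y : H, ∃ x : (sq D).domain, (x : H) = R y ∧ (x : H) + sq D x = y := by
    intro y
    set v : WithLp 2 (H × H) := e.symm (y, 0) with hv
    set p := G.starProjection v with hp
    have hpG : e p ∈ D.graph := G.starProjection_apply_mem v
    obtain ⟨x, hx1, hx2⟩ := (LinearPMap.mem_graph_iff D).1 hpG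
    have horth : ∀ z : D.domain, ⟪y - (x : H), (z : H)⟫_ℂ = ⟪D x, D z⟫_ℂ := by
      intro z
      have hz : e.symm ((z : H), D z) ∈ G := by
        change e (e.symm ((z : H), D z)) ∈ D.graph
        rw [e.apply_symm_apply]
        exact D.mem_graph z
      have h0 := G.starProjection_inner_eq_zero v _ hz
      rw [WithLp.prod_inner_apply] at h0
      have h1 : (v - p).fst = y - x := by
        change y - (e p).1 = _
        rw [hx1]
      have h2 : (v - p).snd = - D x := by
        change 0 - (e p).2 = _
        rw [hx2, zero_sub]
      have h3 : ⟪y - (x : H), (z : H)⟫_ℂ + ⟪- D x, D z⟫_ℂ = 0 := by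
        rw [← h1, ← h2]
        exact h0
      rw [inner_neg_left] at h3
      exact add_neg_eq_zero.1 h3
    obtain ⟨h, h'⟩ := hmem (D x) (y - x) horth
    refine ⟨⟨x, mem_sq_domain.2 ⟨x.2, h⟩⟩, hx1, ?_⟩
    change (x : H) + D ⟨D x, h⟩ = y
    rw [h']
    abel
  have hinj : ∀ x : (sq D).domain, (x : H) + sq D x = 0 → (x : H) = 0 := by
    intro x hx
    obtain ⟨h, h'⟩ := mem_sq_domain.1 x.2
    have h1 : ⟪(x : H), (x : H)⟫_ℂ + ⟪D ⟨x, h⟩, D ⟨x, h⟩⟫_ℂ = 0 := by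
      have := hfa ⟨x, h⟩ ⟨D ⟨x, h⟩, h'⟩
      rw [this, ← inner_add_right]
      rw [sq_apply x h h'] at hx
      rw [hx, inner_zero_right]
    rw [inner_self_eq_norm_sq_to_K, inner_self_eq_norm_sq_to_K] at h1
    have h2 : ‖(x : H)‖ ^ 2 + ‖D ⟨x, h⟩‖ ^ 2 = 0 := by
      have h3 := congrArg Complex.re h1
      rw [Complex.add_re] at h3
      simpa [← Complex.ofReal_pow] using h3
    have : ‖(x : H)‖ = 0 := by nlinarith [sq_nonneg ‖(x : H)‖, sq_nonneg ‖D ⟨x, h⟩‖]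
    exact norm_eq_zero.1 this
  refine ⟨R, fun x => ?_, hR⟩
  obtain ⟨x', hx', hx''⟩ := hR (x + sq D x)
  have := hinj (x' - x) (by
    rw [LinearPMap.map_sub, Submodule.coe_sub, sub_add_sub_comm, hx'', sub_self])
  rw [← hx']
  exact sub_eq_zero.1 this

/-- The bounded operator `(1 + D²)^{-1/2}`, the positive square root of `(1 + D²)⁻¹`. -/
def invSqrtOneAddSq (D : H →ₗ.[ℂ] H) : H →L[ℂ] H := CFC.sqrt (invOneAddSq D)

/-! ### Trace and Schatten norms -/

/-- The trace, in `[0, ∞]`, of a positive bounded operator: the sum of its diagonal matrix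
coefficients in a Hilbert basis of `H` (it does not depend on the basis). -/
def trace (A : H →L[ℂ] H) : ℝ≥0∞ :=
  ∑' i : (exists_hilbertBasis ℂ H).choose, ENNReal.ofReal (RCLike.re ⟪(i : H), A i⟫_ℂ)

/-- The Schatten norm `‖A‖_p = (tr |A|^p)^{1/p}`, with value `∞` exactly outside the Schatten
ideal `L^p`. -/
def schattenNorm (p : ℝ) (A : H →L[ℂ] H) : ℝ≥0∞ :=
  trace (CFC.abs A ^ p) ^ p⁻¹

end HeatSchatten

end

open scoped ENNReal Topology InnerProductSpace

noncomputable section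

namespace HeatSchatten

open Filter Set MeasureTheory

/-! ### Strongly continuous semigroups: continuity, growth and uniqueness -/

section Semigroup

variable {H : Type*} [NormedAddCommGroup H] [InnerProductSpace ℂ H]

/-! Write `P = (1 + D²)⁻¹` and `R = P^{1/2}`. Since `D R` is a contraction, `B = F R` is bounded,
and the perturbed semigroup is the Dyson series with terms `T₀(t) = e^{-tD²}` and `T_{n+1}(t) = -∫₀ᵗ
T_n(t-s) B R⁻¹ e^{-sD²} ds`. By functional calculus `‖R⁻¹ e^{-sD²}‖ ≤ e^s (2es)^{-1/2}`, which is
integrable at `0`. So the kernel has norm at most `1/2` in `L¹` with weight `e^{-ωs}` for large `ω`: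
the series converges geometrically, and uniqueness for the Volterra equation gives the semigroup law
(`dyson_add`). The generator is exactly `-(D² + F)`: it extends this operator, `1 + μ + D² + F` is
onto for large `μ`, and the generator has no real eigenvalue above the growth rate
(`isExpNeg_sq_add`).

The estimate is in terms of `R F`, not `F R`. If `R F` is bounded, it induces a bounded `C` with `C
R = R B`, and this relation moves `R⁻¹` to the left of the perturbation: `T_n B = K_n R` and
`T_{n+1} = -K_n * e^{-sD²}` (a convolution), where `K_n` are the Dyson terms of the kernel `e^{-sD²}
R⁻¹ C`. Half of the heat in this kernel is `e^{-sD²/2} = ρ^{s/t}` with `ρ = e^{-tD²/2}`; by Hölder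
it raises the reciprocal Schatten exponent by `s/t` at the cost `(tr ρ)^{s/t}`. The other half
bounds `R⁻¹` by `e^{s/2} (es)^{-1/2}`. Over times of total length `τ = ut` the gains add up to `u`
and the costs multiply to `(tr ρ)^u`. What remains are convolutions of `s^{-1/2}`, that is, beta
integrals, and the `n`-th term is of size `xⁿ / Γ(n/2 + 1)` with `x² = ‖R F‖² e⁻¹ π u t`. Comparing
with factorials, the sum is at most `(1 + 2x) e^{x²}`.

Schatten norms are handled by duality (`SchattenBound`): such bounds pass through integrals and
series, Hölder's inequality follows from the three lines theorem (`SchattenBound.mul_diagonal`), and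
only at the end is the norm defined by the trace recovered (`SchattenBound.schattenNorm_le`). -/

theorem hasDerivWithinAt_zero_of_tendsto {f : ℝ → H} {s : ℝ}
    (h : Tendsto (fun r : ℝ => (r : ℂ)⁻¹ • (f (s + r) - f s)) (𝓝[>] 0) (𝓝 0)) :
    HasDerivWithinAt f 0 (Ici s) s := by
  rw [← hasDerivWithinAt_Ioi_iff_Ici, hasDerivWithinAt_iff_tendsto_slope' self_notMem_Ioi]
  have h1 : Tendsto (fun y : ℝ => y - s) (𝓝[>] s) (𝓝[>] 0) := by
    refine tendsto_nhdsWithin_of_tendsto_nhds_of_eventually_within _ ?_ ?_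
    · have : Tendsto (fun y : ℝ => y - s) (𝓝 s) (𝓝 (s - s)) :=
        (by fun_prop : Continuous fun y : ℝ => y - s).tendsto s
      rw [sub_self] at this
      exact this.mono_left nhdsWithin_le_nhds
    · filter_upwards [self_mem_nhdsWithin] with y hy
      exact sub_pos.2 (mem_Ioi.1 hy)
  refine (h.comp h1).congr fun y => ?_
  simp only [Function.comp_apply, add_sub_cancel, slope_def_module]
  rw [← Complex.ofReal_inv, Complex.coe_smul]

theorem IsExpNeg.exists_bound [CompleteSpace H] {A : H →ₗ.[ℂ] H} {T : ℝ → H →L[ℂ] H}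
    (h : IsExpNeg A T) (b : ℝ) : ∃ M, ∀ s ∈ Icc 0 b, ‖T s‖ ≤ M := by
  obtain ⟨M, hM⟩ := banach_steinhaus (g := fun s : Icc (0 : ℝ) b => T s) (fun x => by
    obtain ⟨C, hC⟩ := isCompact_Icc.exists_bound_of_continuousOn
      ((h.continuousOn x).mono (fun s hs => hs.1))
    exact ⟨C, fun s => hC s s.2⟩)
  exact ⟨M, fun s hs => hM ⟨s, hs⟩⟩

/-- A locally bounded one-parameter semigroup that is strongly continuous at `0` is strongly
continuous. -/
theorem continuousOn_of_tendsto {T : ℝ → H →L[ℂ] H} (h0 : T 0 = 1)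
    (hadd : ∀ s r : ℝ, 0 ≤ s → 0 ≤ r → T (s + r) = T s * T r)
    (hb : ∀ b, ∃ M, ∀ s ∈ Icc 0 b, ‖T s‖ ≤ M) (x : H)
    (hx : Tendsto (fun s => T s x) (𝓝[>] 0) (𝓝 x)) :
    ContinuousOn (fun s => T s x) (Ici 0) := by
  have hx' : Tendsto (fun s => T s x) (𝓝[≥] 0) (𝓝 x) := by
    rw [← Ioi_insert, nhdsWithin_insert]
    refine Tendsto.sup ?_ hx
    rw [tendsto_pure_left]
    intro U hU
    rw [h0]
    exact mem_of_mem_nhds hU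
  intro r hr
  obtain ⟨M, hM⟩ := hb (r + 1)
  have hr0 : (0 : ℝ) ≤ r := hr
  have habs : Tendsto (fun s : ℝ => |s - r|) (𝓝[≥] r ⊔ 𝓝[≤] r) (𝓝[≥] 0) := by
    rw [nhdsGE_sup_nhdsLE]
    refine tendsto_nhdsWithin_of_tendsto_nhds_of_eventually_within _ ?_
      (Eventually.of_forall fun s => mem_Ici.2 (abs_nonneg _))
    have : Tendsto (fun y : ℝ => |y - r|) (𝓝 r) (𝓝 |r - r|) :=
      (by fun_prop : Continuous fun y : ℝ => |y - r|).tendsto r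
    simpa using this
  rw [nhdsGE_sup_nhdsLE] at habs
  rw [ContinuousWithinAt, tendsto_iff_norm_sub_tendsto_zero]
  have hlim : Tendsto (fun s : ℝ => M * ‖T |s - r| x - x‖) (𝓝[Ici 0] r) (𝓝 0) := by
    have := (tendsto_iff_norm_sub_tendsto_zero.1 (hx'.comp habs)).const_mul M
    rw [mul_zero] at this
    exact this.mono_left nhdsWithin_le_nhds
  refine squeeze_zero' (Eventually.of_forall fun s => norm_nonneg _) ?_ hlim
  have hlt : ∀ᶠ s in 𝓝[Ici 0] r, s < r + 1 :=
    nhdsWithin_le_nhds (Iio_mem_nhds (by linarith))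
  filter_upwards [hlt, self_mem_nhdsWithin] with s hs1 hs0
  have hs0 : 0 ≤ s := hs0
  -- The operator at the smaller of the two times factors out and is bounded by `M`.
  rcases le_total r s with h | h
  · have h1 : T s = T r * T (s - r) := by
      rw [← hadd r (s - r) hr0 (by linarith), add_sub_cancel]
    rw [abs_of_nonneg (by linarith), h1, mul_apply_eq_comp, ← map_sub]
    exact (T r).le_of_opNorm_le (hM r ⟨hr0, by linarith⟩) _
  · have h1 : T r = T s * T (r - s) := by
      rw [← hadd s (r - s) hs0 (by linarith), add_sub_cancel]
    rw [abs_of_nonpos (by linarith), h1, mul_apply_eq_comp, ← map_sub, neg_sub,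
      ← norm_neg, ← map_neg, neg_sub]
    exact (T s).le_of_opNorm_le (hM s ⟨hs0, by linarith⟩) _

/-- The generator of a semigroup of exponential growth rate `ω` has no real eigenvalue
above `ω`. -/
theorem eq_zero_of_tendsto_generator {T : ℝ → H →L[ℂ] H} (h0 : T 0 = 1)
    (hadd : ∀ s r : ℝ, 0 ≤ s → 0 ≤ r → T (s + r) = T s * T r)
    {M ω l : ℝ} (hb : ∀ s, 0 ≤ s → ‖T s‖ ≤ M * Real.exp (ω * s)) (hl : ω < l) {x : H}
    (hc : ContinuousOn (fun s => T s x) (Ici 0))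
    (hx : Tendsto (fun s : ℝ => (s : ℂ)⁻¹ • (x - T s x)) (𝓝[>] 0) (𝓝 (-(l : ℂ) • x))) :
    x = 0 := by
  -- By `hx`, `x` is an eigenvector of the generator with eigenvalue `l`, so `e^{-ls} T s x` is
  -- constant; the growth bound makes it decay.
  set φ : ℝ → H := fun s => (Real.exp (-(l * s)) : ℂ) • T s x with hφ
  have hφc : ContinuousOn φ (Ici 0) := by
    refine ContinuousOn.smul ?_ hc
    fun_prop
  have hscal : Tendsto (fun h : ℝ => (h : ℂ)⁻¹ * ((Real.exp (-(l * h)) : ℂ) - 1)) (𝓝[>] 0)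
      (𝓝 (-(l : ℂ))) := by
    have h1 : HasDerivAt (fun h : ℝ => Real.exp (-(l * h))) (-l) 0 := by
      have h2 : HasDerivAt (fun h : ℝ => -(l * h)) (-l) 0 := by
        simpa [neg_mul] using (hasDerivAt_id (0 : ℝ)).const_mul (-l)
      simpa using h2.exp
    have h3 := (hasDerivAt_iff_tendsto_slope_zero.1 h1).mono_left (nhdsGT_le_nhdsNE (0 : ℝ))
    have h4 := (Complex.continuous_ofReal.tendsto _).comp h3
    rw [Complex.ofReal_neg] at h4
    refine h4.congr fun h => ?_
    simp
  have hlim : Tendsto (fun h : ℝ => (h : ℂ)⁻¹ • ((Real.exp (-(l * h)) : ℂ) • T h x - x))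
      (𝓝[>] 0) (𝓝 0) := by
    have he : Tendsto (fun h : ℝ => (Real.exp (-(l * h)) : ℂ)) (𝓝[>] 0) (𝓝 1) := by
      have : Continuous (fun h : ℝ => (Real.exp (-(l * h)) : ℂ)) := by fun_prop
      have h1 := this.tendsto 0
      simp only [mul_zero, neg_zero, Real.exp_zero, Complex.ofReal_one] at h1
      exact h1.mono_left nhdsWithin_le_nhds
    have h5 := (hscal.smul_const x).sub (he.smul hx)
    rw [one_smul, sub_self] at h5
    refine h5.congr fun h => ?_
    module
  have hder : ∀ s, 0 ≤ s → HasDerivWithinAt φ 0 (Ici s) s := by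
    intro s hs
    apply hasDerivWithinAt_zero_of_tendsto
    have h6 := (((Real.exp (-(l * s)) : ℂ) • T s).continuous.tendsto 0).comp hlim
    rw [map_zero] at h6
    refine h6.congr' ?_
    filter_upwards [self_mem_nhdsWithin] with h hh
    have hh : 0 < h := hh
    simp only [Function.comp_apply, hφ, map_smul, map_sub, smul_apply]
    rw [hadd s h hs hh.le, mul_add, neg_add, Real.exp_add, Complex.ofReal_mul,
      mul_apply_eq_comp]
    module
  have hconst : ∀ s, 0 ≤ s → φ s = x := by
    intro s hs
    have := constant_of_has_deriv_right_zero (a := 0) (b := s)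
      (hφc.mono Icc_subset_Ici_self) (fun r hr => hder r hr.1) s (right_mem_Icc.2 hs)
    rw [this]
    simp [hφ, h0]
  have hbound : ∀ s, 0 ≤ s → ‖x‖ ≤ M * Real.exp (-((l - ω) * s)) * ‖x‖ := by
    intro s hs
    calc ‖x‖ = ‖φ s‖ := by rw [hconst s hs]
      _ = Real.exp (-(l * s)) * ‖T s x‖ := by
        rw [hφ, norm_smul, Complex.norm_real, Real.norm_of_nonneg (Real.exp_pos _).le]
      _ ≤ Real.exp (-(l * s)) * (M * Real.exp (ω * s) * ‖x‖) := by
        gcongr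
        exact (T s).le_of_opNorm_le (hb s hs) x
      _ = M * Real.exp (-((l - ω) * s)) * ‖x‖ := by
        rw [show -((l - ω) * s) = -(l * s) + ω * s by ring, Real.exp_add]; ring
  have hto : Tendsto (fun s : ℝ => M * Real.exp (-((l - ω) * s)) * ‖x‖) atTop (𝓝 0) := by
    have h7 : Tendsto (fun s : ℝ => (l - ω) * s) atTop atTop :=
      tendsto_id.const_mul_atTop (sub_pos.2 hl)
    have h8 := (Real.tendsto_exp_neg_atTop_nhds_zero.comp h7).const_mul M |>.mul_const ‖x‖
    simpa using h8
  have := ge_of_tendsto hto (eventually_atTop.2 ⟨0, hbound⟩)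
  exact norm_eq_zero.1 (le_antisymm this (norm_nonneg _))

theorem IsExpNeg.apply_mem_graph {A : H →ₗ.[ℂ] H} {T : ℝ → H →L[ℂ] H} (h : IsExpNeg A T)
    {x y : H} (hx : (x, y) ∈ A.graph) {s : ℝ} (hs : 0 ≤ s) : (T s x, T s y) ∈ A.graph := by
  rw [h.generator] at hx ⊢
  refine (((T s).continuous.tendsto y).comp hx).congr' ?_
  filter_upwards [self_mem_nhdsWithin] with r hr
  have hr : 0 < r := hr
  simp only [Function.comp_apply, map_smul, map_sub, ← mul_apply_eq_comp]
  rw [← h.add s r hs hr.le, ← h.add r s hr.le hs, add_comm]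

/-- A strongly continuous semigroup is determined by its generator. -/
theorem IsExpNeg.unique [CompleteSpace H] {A : H →ₗ.[ℂ] H} {T T' : ℝ → H →L[ℂ] H}
    (hT : IsExpNeg A T)
    (hT' : IsExpNeg A T') (hd : Dense (A.domain : Set H)) {t : ℝ} (ht : 0 ≤ t) : T t = T' t := by
  obtain ⟨M, hM⟩ := hT.exists_bound t
  refine ContinuousLinearMap.coeFn_injective
    ((T t).continuous.ext_on hd (T' t).continuous fun x hx => ?_)
  -- This path runs from `T t x` to `T' t x`. It is constant, because `T' s x` stays in the domain
  -- of the common generator and the two contributions to the derivative cancel.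
  set φ : ℝ → H := fun s => T (t - s) (T' s x) with hφ
  have hbd : ∀ s ∈ Icc 0 t, ‖T (t - s)‖ ≤ M := fun s hs =>
    hM _ ⟨by linarith [hs.2], by linarith [hs.1]⟩
  have hcont : ContinuousOn φ (Icc 0 t) := by
    intro s hs
    rw [ContinuousWithinAt, tendsto_iff_norm_sub_tendsto_zero]
    have h1 : Tendsto (fun r => M * ‖T' r x - T' s x‖) (𝓝[Icc 0 t] s) (𝓝 0) := by
      have := (tendsto_iff_norm_sub_tendsto_zero.1
        (((hT'.continuousOn x).mono Icc_subset_Ici_self) s hs)).const_mul M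
      rwa [mul_zero] at this
    have h2 : Tendsto (fun r => ‖T (t - r) (T' s x) - T (t - s) (T' s x)‖) (𝓝[Icc 0 t] s)
        (𝓝 0) := by
      rw [← tendsto_iff_norm_sub_tendsto_zero]
      have h3 : ContinuousWithinAt (fun r => T r (T' s x)) (Icc 0 t) (t - s) :=
        ((hT.continuousOn (T' s x)).mono Icc_subset_Ici_self) _
          ⟨by linarith [hs.2], by linarith [hs.1]⟩
      refine Tendsto.comp h3 ?_
      refine tendsto_nhdsWithin_of_tendsto_nhds_of_eventually_within _ ?_ ?_
      · exact ((by fun_prop : Continuous fun y : ℝ => t - y).tendsto s).mono_left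
          nhdsWithin_le_nhds
      · filter_upwards [self_mem_nhdsWithin] with r hr
        exact ⟨by linarith [hr.2], by linarith [hr.1]⟩
    have h4 := h1.add h2
    rw [add_zero] at h4
    refine squeeze_zero' (Eventually.of_forall fun r => norm_nonneg _) ?_ h4
    filter_upwards [self_mem_nhdsWithin] with r hr
    have : φ r - φ s = T (t - r) (T' r x - T' s x)
        + (T (t - r) (T' s x) - T (t - s) (T' s x)) := by
      rw [map_sub]; abel
    rw [this]
    refine (norm_add_le _ _).trans (add_le_add_left ?_ _)
    exact (T (t - r)).le_of_opNorm_le (hbd r hr) _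
  have hder : ∀ s ∈ Ico 0 t, HasDerivWithinAt φ 0 (Ici s) s := by
    intro s hs
    apply hasDerivWithinAt_zero_of_tendsto
    have hy := hT'.apply_mem_graph (LinearPMap.mem_graph A ⟨x, hx⟩) hs.1
    have h1 := ((hT.generator _ _).1 hy).sub ((hT'.generator _ _).1 hy)
    rw [sub_self] at h1
    have h2 := (tendsto_zero_iff_norm_tendsto_zero.1 h1).const_mul M
    rw [mul_zero] at h2
    refine squeeze_zero_norm' ?_ h2
    have hlt : ∀ᶠ r in 𝓝[>] (0 : ℝ), r < t - s :=
      nhdsWithin_le_nhds (Iio_mem_nhds (by linarith [hs.2]))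
    filter_upwards [self_mem_nhdsWithin, hlt] with r hr hr'
    have hr : 0 < r := hr
    have h3 : (r : ℂ)⁻¹ • (φ (s + r) - φ s) = T (t - (s + r))
        ((r : ℂ)⁻¹ • (T' s x - T r (T' s x)) - (r : ℂ)⁻¹ • (T' s x - T' r (T' s x))) := by
      have e1 : T (t - s) = T (t - (s + r)) * T r := by
        rw [← hT.add _ _ (by linarith) hr.le]; congr 1; ring
      have e2 : T' (s + r) = T' r * T' s := by
        rw [← hT'.add _ _ hr.le hs.1, add_comm]
      rw [← smul_sub, map_smul, sub_sub_sub_cancel_left, map_sub]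
      simp only [hφ, e1, e2, mul_apply_eq_comp]
    rw [h3]
    exact (T (t - (s + r))).le_of_opNorm_le (hbd _ ⟨by linarith [hs.1], by linarith⟩) _
  have := constant_of_has_deriv_right_zero hcont hder t (right_mem_Icc.2 ht)
  simp only [hφ, sub_self, sub_zero, hT.zero, hT'.zero] at this
  exact this.symm

theorem IsExpNeg.expNeg_eq [CompleteSpace H] {A : H →ₗ.[ℂ] H} {T : ℝ → H →L[ℂ] H}
    (hT : IsExpNeg A T) (hd : Dense (A.domain : Set H)) {t : ℝ} (ht : 0 ≤ t) :
    expNeg A t = T t := by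
  have h : GeneratesExpNeg A := ⟨T, hT⟩
  rw [expNeg, dif_pos h]
  exact h.choose_spec.unique hT hd ht

end Semigroup

end HeatSchatten

end

open scoped ENNReal Topology InnerProductSpace

noncomputable section

namespace HeatSchatten

open Filter Set MeasureTheory

/-! ### The scalar functions behind the functional calculus -/

section ScalarHeat

/-- The function `x ↦ exp (-s (x⁻¹ - 1))` on `(0, ∞)`, extended by `0`: applied to `(1 + D²)⁻¹`
it gives `exp (-s D²)`. -/
def heat (s x : ℝ) : ℝ := Real.exp s * expNegInvGlue (x / s)

/-- The function `x ↦ x^{-1/2} exp (-s (x⁻¹ - 1))` on `(0, ∞)`, extended by `0`. -/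
def rootHeat (s x : ℝ) : ℝ :=
  √x * (Real.exp s * s⁻¹ * ((x / s)⁻¹ * expNegInvGlue (x / s)))

theorem heat_of_nonpos {s x : ℝ} (hs : 0 < s) (hx : x ≤ 0) : heat s x = 0 := by
  rw [heat, expNegInvGlue.zero_of_nonpos (div_nonpos_of_nonpos_of_nonneg hx hs.le), mul_zero]

theorem heat_of_pos {s x : ℝ} (hs : 0 < s) (hx : 0 < x) :
    heat s x = Real.exp (-(s * (x⁻¹ - 1))) := by
  have : ¬ x / s ≤ 0 := not_le.2 (div_pos hx hs)
  rw [heat, expNegInvGlue, if_neg this, ← Real.exp_add]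
  congr 1
  field_simp
  ring

theorem rootHeat_eq {s x : ℝ} (hs : 0 < s) : rootHeat s x = √x * x⁻¹ * heat s x := by
  rw [rootHeat, heat]
  field_simp

theorem sqrt_mul_rootHeat {s x : ℝ} (hs : 0 < s) (hx : 0 ≤ x) :
    √x * rootHeat s x = heat s x := by
  rw [rootHeat_eq hs]
  rcases hx.eq_or_lt with rfl | hx
  · rw [heat_of_nonpos hs le_rfl]; simp
  · rw [← mul_assoc, ← mul_assoc, Real.mul_self_sqrt hx.le, mul_inv_cancel₀ hx.ne', one_mul]

theorem heat_add {s r x : ℝ} (hs : 0 < s) (hr : 0 < r) :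
    heat (s + r) x = heat s x * heat r x := by
  rcases le_or_gt x 0 with hx | hx
  · rw [heat_of_nonpos hs hx, heat_of_nonpos (add_pos hs hr) hx, zero_mul]
  · rw [heat_of_pos hs hx, heat_of_pos hr hx, heat_of_pos (add_pos hs hr) hx, ← Real.exp_add]
    congr 1
    ring

theorem rootHeat_add {s r x : ℝ} (hs : 0 < s) (hr : 0 < r) :
    rootHeat (s + r) x = rootHeat s x * heat r x := by
  rw [rootHeat_eq hs, rootHeat_eq (add_pos hs hr), heat_add hs hr, mul_assoc, mul_assoc, mul_assoc]

/-- Joint continuity in both variables makes the heat operators norm continuous in `s > 0`. The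
point `x = 0`, which belongs to the spectrum of `(1 + D²)⁻¹` when `D` is unbounded, is covered by
the smooth gluing function. -/
theorem continuousOn_heat : ContinuousOn (Function.uncurry heat) (Ioi 0 ×ˢ univ) := by
  have h : Continuous expNegInvGlue := (expNegInvGlue.contDiff (n := 0)).continuous
  have h1 : ContinuousOn (fun p : ℝ × ℝ => p.2 / p.1) (Ioi 0 ×ˢ univ) :=
    continuousOn_snd.div continuousOn_fst fun p hp => (mem_Ioi.1 hp.1).ne'
  exact (Real.continuous_exp.comp continuous_fst).continuousOn.mul (h.comp_continuousOn h1)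

theorem continuousOn_rootHeat : ContinuousOn (Function.uncurry rootHeat) (Ioi 0 ×ˢ univ) := by
  have h : Continuous fun x : ℝ => x⁻¹ * expNegInvGlue x := by
    simpa using expNegInvGlue.continuous_polynomial_eval_inv_mul Polynomial.X
  have h1 : ContinuousOn (fun p : ℝ × ℝ => p.2 / p.1) (Ioi 0 ×ˢ univ) :=
    continuousOn_snd.div continuousOn_fst fun p hp => (mem_Ioi.1 hp.1).ne'
  have h2 : ContinuousOn (fun p : ℝ × ℝ => p.1⁻¹) (Ioi 0 ×ˢ univ) :=
    continuousOn_fst.inv₀ fun p hp => (mem_Ioi.1 hp.1).ne'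
  exact (Real.continuous_sqrt.comp continuous_snd).continuousOn.mul
    (((Real.continuous_exp.comp continuous_fst).continuousOn.mul h2).mul (h.comp_continuousOn h1))

theorem continuous_heat {s : ℝ} (hs : 0 < s) : Continuous (heat s) :=
  continuousOn_heat.comp_continuous (f := fun x => (s, x)) (by fun_prop) fun _ => ⟨hs, mem_univ _⟩

theorem continuous_rootHeat {s : ℝ} (hs : 0 < s) : Continuous (rootHeat s) :=
  continuousOn_rootHeat.comp_continuous (f := fun x => (s, x)) (by fun_prop)
    fun _ => ⟨hs, mem_univ _⟩

theorem heat_nonneg (s x : ℝ) : 0 ≤ heat s x :=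
  mul_nonneg (Real.exp_pos _).le (expNegInvGlue.nonneg _)

theorem heat_le_one {s x : ℝ} (hs : 0 < s) (hx : x ≤ 1) : heat s x ≤ 1 := by
  rcases le_or_gt x 0 with h | h
  · rw [heat_of_nonpos hs h]; exact zero_le_one
  · rw [heat_of_pos hs h, Real.exp_le_one_iff, neg_nonpos]
    exact mul_nonneg hs.le (sub_nonneg.2 ((one_le_inv₀ h).2 hx))

theorem rootHeat_nonneg {s x : ℝ} (hs : 0 < s) (hx : 0 ≤ x) : 0 ≤ rootHeat s x := by
  rw [rootHeat_eq hs]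
  exact mul_nonneg (mul_nonneg (Real.sqrt_nonneg _) (inv_nonneg.2 hx)) (heat_nonneg _ _)

/-- After squaring this is `y ≤ e^{y-1}` at `y = 2s/x`, with equality for `x = 2s`. -/
theorem rootHeat_le {s x : ℝ} (hs : 0 < s) (hx : 0 ≤ x) :
    rootHeat s x ≤ Real.exp s * (√(2 * Real.exp 1 * s))⁻¹ := by
  rcases hx.eq_or_lt with rfl | hx
  · rw [rootHeat, Real.sqrt_zero, zero_mul]
    positivity
  rw [← abs_of_nonneg (rootHeat_nonneg hs hx.le), ← Real.sqrt_sq_eq_abs, ← Real.sqrt_inv]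
  rw [show Real.exp s = √(Real.exp s ^ 2) from (Real.sqrt_sq (Real.exp_pos _).le).symm,
    ← Real.sqrt_mul (sq_nonneg _)]
  apply Real.sqrt_le_sqrt
  rw [rootHeat_eq hs, heat_of_pos hs hx, mul_pow, mul_pow, Real.sq_sqrt hx.le, ← Real.exp_nat_mul,
    ← Real.exp_nat_mul]
  have h1 : 2 * s * x⁻¹ ≤ Real.exp (2 * s * x⁻¹ - 1) := by
    have := Real.add_one_le_exp (2 * s * x⁻¹ - 1)
    linarith
  have h2 : Real.exp (((2 : ℕ) : ℝ) * -(s * (x⁻¹ - 1)))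
      = Real.exp (((2 : ℕ) : ℝ) * s) * (Real.exp (2 * s * x⁻¹ - 1) * Real.exp 1)⁻¹ := by
    rw [← Real.exp_add, ← Real.exp_neg, ← Real.exp_add]
    congr 1
    push_cast
    ring
  rw [h2]
  have h3 : x * x⁻¹ ^ 2 = x⁻¹ := by field_simp
  rw [h3, mul_left_comm]
  refine mul_le_mul_of_nonneg_left ?_ (Real.exp_pos _).le
  have h4 : 0 < Real.exp (2 * s * x⁻¹ - 1) := Real.exp_pos _
  have h5 : 0 < Real.exp 1 := Real.exp_pos _
  rw [mul_inv, ← mul_assoc, ← div_eq_mul_inv, ← div_eq_mul_inv, div_le_iff₀ h5,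
    div_le_iff₀ h4]
  have h6 : (2 * Real.exp 1 * s)⁻¹ * Real.exp 1 = (2 * s)⁻¹ := by field_simp
  rw [h6]
  calc x⁻¹ = (2 * s)⁻¹ * (2 * s * x⁻¹) := by field_simp
    _ ≤ _ := by gcongr

end ScalarHeat

/-! ### Heat operators by functional calculus -/

section HeatOp

/-- Compactness of the spectrum turns joint continuity into uniform convergence on the spectrum. -/
theorem continuousOn_cfc_of_uncurry {A : Type*} [CStarAlgebra A] {a : A} {F : ℝ → ℝ → ℝ}
    {s : Set ℝ} (hF : ContinuousOn (Function.uncurry F) (s ×ˢ univ)) :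
    ContinuousOn (fun t => cfc (F t) a) s := by
  intro q hq
  refine continuousWithinAt_cfc_fun ?_ ?_
  · intro u hu
    obtain ⟨v, hv, hv'⟩ := (ContinuousFunctionalCalculus.isCompact_spectrum (R := ℝ)
      a).mem_uniformity_of_prod
      (hF.mono (prod_mono_right (subset_univ _))) hq (symm_le_uniformity hu)
    filter_upwards [hv] with p hp x hx
    exact hv' p hp x hx
  · filter_upwards [self_mem_nhdsWithin] with p hp
    exact (hF.comp_continuous (f := fun x => (p, x)) (by fun_prop)
      fun _ => ⟨hp, mem_univ _⟩).continuousOn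

variable {H : Type*} [NormedAddCommGroup H] [InnerProductSpace ℂ H] [CompleteSpace H]

/-- `heatOp (1 + D²)⁻¹ s` is `e^{-sD²}`. -/
def heatOp (P : H →L[ℂ] H) (s : ℝ) : H →L[ℂ] H := if s ≤ 0 then 1 else cfc (heat s) P

/-- `rootHeatOp (1 + D²)⁻¹ s` is `(1 + D²)^{1/2} e^{-sD²}`. -/
def rootHeatOp (P : H →L[ℂ] H) (s : ℝ) : H →L[ℂ] H := cfc (rootHeat s) P

variable {P : H →L[ℂ] H}

theorem spectrum_subset_Icc (h0 : 0 ≤ P) (h1 : P ≤ 1) : spectrum ℝ P ⊆ Icc 0 1 := by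
  intro x hx
  refine ⟨spectrum_nonneg_of_nonneg h0 hx, ?_⟩
  have : P ≤ algebraMap ℝ (H →L[ℂ] H) 1 := by rwa [map_one]
  exact (le_algebraMap_iff_spectrum_le (IsSelfAdjoint.of_nonneg h0)).1 this x hx

theorem heatOp_zero : heatOp P 0 = 1 := if_pos le_rfl

theorem heatOp_of_pos {s : ℝ} (hs : 0 < s) : heatOp P s = cfc (heat s) P := if_neg (not_le.2 hs)

theorem heatOp_add {s r : ℝ} (hs : 0 ≤ s) (hr : 0 ≤ r) :
    heatOp P (s + r) = heatOp P s * heatOp P r := by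
  rcases hs.eq_or_lt with rfl | hs
  · rw [heatOp_zero, zero_add, one_mul]
  rcases hr.eq_or_lt with rfl | hr
  · rw [heatOp_zero, add_zero, mul_one]
  rw [heatOp_of_pos hs, heatOp_of_pos hr, heatOp_of_pos (add_pos hs hr),
    ← cfc_mul _ _ P (continuous_heat hs).continuousOn (continuous_heat hr).continuousOn]
  exact cfc_congr fun x _ => heat_add hs hr

theorem rootHeatOp_add {s r : ℝ} (hs : 0 < s) (hr : 0 ≤ r) :
    rootHeatOp P (s + r) = rootHeatOp P s * heatOp P r := by
  rcases hr.eq_or_lt with rfl | hr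
  · rw [heatOp_zero, add_zero, mul_one]
  rw [heatOp_of_pos hr, rootHeatOp, rootHeatOp,
    ← cfc_mul _ _ P (continuous_rootHeat hs).continuousOn (continuous_heat hr).continuousOn]
  exact cfc_congr fun x _ => rootHeat_add hs hr

theorem sqrt_eq_cfc_real (h0 : 0 ≤ P) : CFC.sqrt P = cfc Real.sqrt P := by
  rw [CFC.sqrt_eq_real_sqrt P h0, cfcₙ_eq_cfc]

theorem sqrt_mul_rootHeatOp (h0 : 0 ≤ P) {s : ℝ} (hs : 0 < s) :
    CFC.sqrt P * rootHeatOp P s = heatOp P s := by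
  rw [sqrt_eq_cfc_real h0, rootHeatOp, heatOp_of_pos hs,
    ← cfc_mul _ _ P Real.continuous_sqrt.continuousOn (continuous_rootHeat hs).continuousOn]
  exact cfc_congr fun x hx => sqrt_mul_rootHeat hs (spectrum_nonneg_of_nonneg h0 hx)

theorem rootHeatOp_mul_sqrt (h0 : 0 ≤ P) {s : ℝ} (hs : 0 < s) :
    rootHeatOp P s * CFC.sqrt P = heatOp P s := by
  rw [← sqrt_mul_rootHeatOp h0 hs, sqrt_eq_cfc_real h0, rootHeatOp]
  exact cfc_commute_cfc _ _ _

theorem heatOp_commute (s : ℝ) : Commute (heatOp P s) P := by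
  rw [heatOp]
  split_ifs
  · exact Commute.one_left _
  · exact (Commute.refl P).cfc_real (heat s)

theorem norm_heatOp_le (h0 : 0 ≤ P) (h1 : P ≤ 1) (s : ℝ) : ‖heatOp P s‖ ≤ 1 := by
  rw [heatOp]
  split_ifs with h
  · exact ContinuousLinearMap.norm_id_le
  · refine norm_cfc_le zero_le_one fun x hx => ?_
    rw [Real.norm_of_nonneg (heat_nonneg _ _)]
    exact heat_le_one (not_le.1 h) (spectrum_subset_Icc h0 h1 hx).2

theorem heatOp_nonneg (s : ℝ) : 0 ≤ heatOp P s := by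
  rw [heatOp]
  split_ifs with h
  · exact zero_le_one
  · exact cfc_nonneg fun x _ => heat_nonneg _ _

theorem norm_rootHeatOp_le (h0 : 0 ≤ P) {s : ℝ} (hs : 0 < s) :
    ‖rootHeatOp P s‖ ≤ Real.exp s * (√(2 * Real.exp 1 * s))⁻¹ := by
  refine norm_cfc_le (by positivity) fun x hx => ?_
  have hx0 := spectrum_nonneg_of_nonneg h0 hx
  rw [Real.norm_of_nonneg (rootHeat_nonneg hs hx0)]
  exact rootHeat_le hs hx0

theorem continuousOn_heatOp : ContinuousOn (heatOp P) (Ioi 0) :=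
  (continuousOn_cfc_of_uncurry continuousOn_heat).congr fun _ hs => heatOp_of_pos hs

theorem continuousOn_rootHeatOp : ContinuousOn (rootHeatOp P) (Ioi 0) :=
  continuousOn_cfc_of_uncurry continuousOn_rootHeat

end HeatOp

end HeatSchatten

end

open scoped ENNReal Topology InnerProductSpace

noncomputable section

namespace HeatSchatten

open Filter Set MeasureTheory

/-! ### The resolvent of `D²` and the semigroup that `-D²` generates -/

section Unperturbed

variable {H : Type*} [NormedAddCommGroup H] [InnerProductSpace ℂ H]

/-- A uniformly bounded family of operators that converges strongly on a dense set converges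
strongly everywhere. -/
theorem tendsto_apply_of_dense {ι : Type*} {l : Filter ι} {S : ι → H →L[ℂ] H} {L : H →L[ℂ] H}
    {C : ℝ} (hS : ∀ᶠ i in l, ‖S i‖ ≤ C) {E : Set H} (hE : Dense E)
    (h : ∀ x ∈ E, Tendsto (fun i => S i x) l (𝓝 (L x))) (x : H) :
    Tendsto (fun i => S i x) l (𝓝 (L x)) := by
  rw [Metric.tendsto_nhds]
  intro ε hε
  set K : ℝ := |C| + ‖L‖ + 1 with hK
  have hK0 : 0 < K := by positivity
  obtain ⟨d, hd, hxd⟩ := hE.exists_dist_lt x (show 0 < ε / (2 * K) by positivity)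
  filter_upwards [hS, Metric.tendsto_nhds.1 (h d hd) (ε / 2) (by positivity)] with i hi hi'
  rw [dist_eq_norm] at hxd hi' ⊢
  have h1 : S i x - L x = (S i - L) (x - d) + (S i d - L d) := by
    simp only [sub_apply, map_sub]; abel
  have h2 : ‖S i - L‖ ≤ K := by
    refine (norm_sub_le _ _).trans ?_
    have := le_abs_self C
    linarith
  calc ‖S i x - L x‖ ≤ ‖(S i - L) (x - d)‖ + ‖S i d - L d‖ := by
        rw [h1]; exact norm_add_le _ _
    _ ≤ K * ‖x - d‖ + ‖S i d - L d‖ := by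
        gcongr; exact (S i - L).le_of_opNorm_le h2 _
    _ < K * (ε / (2 * K)) + ε / 2 := by gcongr
    _ = ε := by field_simp; ring

variable [CompleteSpace H] {D : H →ₗ.[ℂ] H}

theorem invOneAddSq_spec (hD : IsSelfAdjoint D) : IsInvOneAddSq D (invOneAddSq D) := by
  rw [invOneAddSq, dif_pos (exists_isInvOneAddSq hD)]
  exact (exists_isInvOneAddSq hD).choose_spec

theorem inner_apply_eq (hD : IsSelfAdjoint D) (a b : D.domain) :
    ⟪D a, (b : H)⟫_ℂ = ⟪(a : H), D b⟫_ℂ := by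
  have key := LinearPMap.adjoint_isFormalAdjoint hD.dense_domain
  rw [show D.adjoint = D from hD] at key
  exact key a b

theorem mem_sq_graph_iff (hD : IsSelfAdjoint D) {x y : H} :
    (x, y) ∈ (sq D).graph ↔ invOneAddSq D (x + y) = x := by
  have h := invOneAddSq_spec hD
  constructor
  · intro hxy
    obtain ⟨z, rfl, rfl⟩ := (LinearPMap.mem_graph_iff _).1 hxy
    exact h.1 z
  · intro hxy
    obtain ⟨z, hz, hz'⟩ := h.2 (x + y)
    rw [hxy] at hz
    refine (LinearPMap.mem_graph_iff _).2 ⟨z, hz, ?_⟩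
    rw [hz] at hz'
    exact add_left_cancel hz'

/-- The values of `(1 + D²)⁻¹`, in terms of `D`. -/
theorem exists_invOneAddSq_apply (hD : IsSelfAdjoint D) (y : H) :
    ∃ x z : D.domain, (x : H) = invOneAddSq D y ∧ D x = z ∧ (x : H) + D z = y := by
  obtain ⟨x, hx, hx'⟩ := (invOneAddSq_spec hD).2 y
  obtain ⟨h, h'⟩ := mem_sq_domain.1 x.2
  exact ⟨⟨x, h⟩, ⟨D ⟨x, h⟩, h'⟩, hx, rfl, by rw [← hx', sq_apply x h h']⟩

/-- Pairs `x = (1 + D²)⁻¹ y` with `y = x + D²x`. It yields both the positivity of `(1 + D²)⁻¹` and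
the bound on `D (1 + D²)^{-1/2}`. -/
theorem inner_invOneAddSq (hD : IsSelfAdjoint D) (y : H) :
    ∃ x : D.domain, (x : H) = invOneAddSq D y ∧
      ⟪invOneAddSq D y, y⟫_ℂ = ((‖(x : H)‖ ^ 2 + ‖D x‖ ^ 2 : ℝ) : ℂ) := by
  obtain ⟨x, z, hx, hz, hxz⟩ := exists_invOneAddSq_apply hD y
  refine ⟨x, hx, ?_⟩
  have h1 : ⟪(x : H), y⟫_ℂ = ⟪(x : H), (x : H)⟫_ℂ + ⟪D x, D x⟫_ℂ := by
    conv_lhs => rw [← hxz]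
    rw [inner_add_right, ← inner_apply_eq hD, ← hz]
  rw [← hx, h1, inner_self_eq_norm_sq_to_K, inner_self_eq_norm_sq_to_K]
  push_cast
  rfl

theorem invOneAddSq_nonneg (hD : IsSelfAdjoint D) : 0 ≤ invOneAddSq D := by
  rw [ContinuousLinearMap.nonneg_iff_isPositive, ContinuousLinearMap.isPositive_iff_complex]
  intro y
  obtain ⟨x, -, hx⟩ := inner_invOneAddSq hD y
  rw [hx]
  rw [RCLike.re_to_complex, Complex.ofReal_re]
  refine ⟨rfl, ?_⟩
  positivity

theorem invOneAddSq_le_one (hD : IsSelfAdjoint D) : invOneAddSq D ≤ 1 := by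
  rw [ContinuousLinearMap.le_def, ContinuousLinearMap.isPositive_iff_complex]
  intro y
  obtain ⟨x, z, hx, hz, hxz⟩ := exists_invOneAddSq_apply hD y
  have h1 : ⟪y - (x : H), y⟫_ℂ = ((‖D x‖ ^ 2 + ‖D z‖ ^ 2 : ℝ) : ℂ) := by
    have e1 : y - (x : H) = D z := by rw [← hxz]; abel
    rw [e1]
    conv_lhs => rw [← hxz]
    rw [inner_add_right, inner_apply_eq hD, ← hz, inner_self_eq_norm_sq_to_K,
      inner_self_eq_norm_sq_to_K]
    push_cast
    rfl
  rw [sub_apply, one_apply_eq_self, ← hx, h1]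
  rw [RCLike.re_to_complex, Complex.ofReal_re]
  refine ⟨rfl, ?_⟩
  positivity

/-- The operator is self-adjoint and injective. -/
theorem dense_range_invOneAddSq (hD : IsSelfAdjoint D) : DenseRange (invOneAddSq D) := by
  have hs : IsSelfAdjoint (invOneAddSq D) := IsSelfAdjoint.of_nonneg (invOneAddSq_nonneg hD)
  have hk : (invOneAddSq D).range ᗮ = ⊥ := by
    rw [ContinuousLinearMap.orthogonal_range, hs.adjoint_eq, Submodule.eq_bot_iff]
    intro y hy
    have hy : invOneAddSq D y = 0 := hy
    obtain ⟨x, z, hx, hz, hxz⟩ := exists_invOneAddSq_apply hD y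
    have hx0 : x = 0 := Subtype.ext (hx.trans hy)
    have hz0 : z = 0 := Subtype.ext (by rw [← hz, hx0, LinearPMap.map_zero]; rfl)
    rw [← hxz, hx0, hz0, LinearPMap.map_zero, Submodule.coe_zero, add_zero]
  have := Submodule.topologicalClosure_eq_top_iff.2 hk
  rw [DenseRange, ← LinearMap.coe_coe, ← LinearMap.coe_range]
  exact Submodule.dense_iff_topologicalClosure_eq_top.2 this

theorem dense_sq_domain (hD : IsSelfAdjoint D) : Dense ((sq D).domain : Set H) := by
  refine (dense_range_invOneAddSq hD).mono ?_
  rintro _ ⟨y, rfl⟩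
  obtain ⟨x, hx, -⟩ := (invOneAddSq_spec hD).2 y
  rw [← hx]
  exact x.2

/-- Here `v = x⁻¹ - 1` is the value of `D²`; the bounds follow from `1 - a ≤ e^{-a} ≤ 1 - a + a²`
for `a = sv`, with `xv = 1 - x ≤ 1`. For operators they say that on the range of `P` the semigroup
tends to the identity at rate `s`, that its difference quotients composed with `P` have norm at most
`1`, and that these converge at rate `s` after one more factor `P`. -/
theorem heat_mul_self_bounds {s x : ℝ} (hs : 0 < s) (hx : x ∈ Icc (0 : ℝ) 1) :
    0 ≤ x - heat s x * x ∧ x - heat s x * x ≤ s ∧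
      |(s⁻¹ * (x - heat s x * x) - (1 - x)) * x| ≤ s := by
  rcases hx.1.eq_or_lt with rfl | hx0
  · simp [hs.le]
  rw [heat_of_pos hs hx0]
  set v := x⁻¹ - 1 with hv
  have hv0 : 0 ≤ v := sub_nonneg.2 ((one_le_inv₀ hx0).2 hx.2)
  have hxv : x * v = 1 - x := by rw [hv]; field_simp
  have ha : 0 ≤ s * v := by positivity
  have h1 : 1 - s * v ≤ Real.exp (-(s * v)) := by
    have := Real.add_one_le_exp (-(s * v)); linarith
  have h2 : Real.exp (-(s * v)) ≤ 1 - s * v + (s * v) ^ 2 := by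
    rw [Real.exp_neg]
    have h3 : (Real.exp (s * v))⁻¹ ≤ (1 + s * v)⁻¹ := by
      apply inv_anti₀ (by linarith)
      have := Real.add_one_le_exp (s * v); linarith
    refine h3.trans ?_
    rw [inv_le_iff_one_le_mul₀ (by linarith)]
    nlinarith [pow_nonneg ha 3, pow_nonneg ha 2]
  have h3 : Real.exp (-(s * v)) ≤ 1 := Real.exp_le_one_iff.2 (by linarith)
  refine ⟨by nlinarith, ?_, ?_⟩
  · calc x - Real.exp (-(s * v)) * x ≤ x - (1 - s * v) * x := by gcongr
      _ = s * (1 - x) := by rw [← hxv]; ring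
      _ ≤ s := by nlinarith [hx.1]
  · have e : (s⁻¹ * (x - Real.exp (-(s * v)) * x) - (1 - x)) * x
        = - (s⁻¹ * x ^ 2 * (Real.exp (-(s * v)) - (1 - s * v))) := by
      rw [← hxv]; field_simp; ring
    rw [e, abs_neg, abs_of_nonneg (mul_nonneg (by positivity) (by linarith))]
    calc s⁻¹ * x ^ 2 * (Real.exp (-(s * v)) - (1 - s * v)) ≤ s⁻¹ * x ^ 2 * ((s * v) ^ 2) := by
          gcongr; linarith
      _ = s * (x * v) ^ 2 := by field_simp
      _ ≤ s * 1 := by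
          rw [hxv]
          have := hx.1
          have := hx.2
          gcongr
          nlinarith
      _ = s := mul_one s

variable {P : H →L[ℂ] H}

theorem sub_heatOp_mul_eq (h0 : 0 ≤ P) {s : ℝ} (hs : 0 < s) :
    P - heatOp P s * P = cfc (fun x => x - heat s x * x) P := by
  have hsa : IsSelfAdjoint P := IsSelfAdjoint.of_nonneg h0
  have hc := (continuous_heat hs).continuousOn (s := spectrum ℝ P)
  rw [cfc_sub (fun x => x) (fun x => heat s x * x) P continuousOn_id (hc.mul continuousOn_id),
    cfc_mul (heat s) (fun x => x) P hc continuousOn_id, cfc_id' ℝ P, heatOp_of_pos hs]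

theorem norm_sub_heatOp_mul_le (h0 : 0 ≤ P) (h1 : P ≤ 1) {s : ℝ} (hs : 0 < s) :
    ‖P - heatOp P s * P‖ ≤ s := by
  rw [sub_heatOp_mul_eq h0 hs]
  refine norm_cfc_le hs.le fun x hx => ?_
  have := heat_mul_self_bounds hs (spectrum_subset_Icc h0 h1 hx)
  rw [Real.norm_of_nonneg this.1]
  exact this.2.1

theorem norm_sub_heatOp_mul_mul_le (h0 : 0 ≤ P) (h1 : P ≤ 1) {s : ℝ} (hs : 0 < s) :
    ‖(s⁻¹ • (P - heatOp P s * P) - (1 - P)) * P‖ ≤ s := by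
  have hsa : IsSelfAdjoint P := IsSelfAdjoint.of_nonneg h0
  have hc := (continuous_heat hs).continuousOn (s := spectrum ℝ P)
  have e : (s⁻¹ • (P - heatOp P s * P) - (1 - P)) * P
      = cfc (fun x => (s⁻¹ * (x - heat s x * x) - (1 - x)) * x) P := by
    have c1 : ContinuousOn (fun x => x - heat s x * x) (spectrum ℝ P) := by fun_prop
    rw [cfc_mul (fun x => s⁻¹ * (x - heat s x * x) - (1 - x)) (fun x => x) P
        (by fun_prop) (by fun_prop),
      cfc_sub (fun x => s⁻¹ * (x - heat s x * x)) (fun x => 1 - x) P (by fun_prop) (by fun_prop),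
      cfc_const_mul s⁻¹ (fun x => x - heat s x * x) P c1, ← sub_heatOp_mul_eq h0 hs,
      cfc_sub (fun _ => (1 : ℝ)) (fun x => x) P (by fun_prop) (by fun_prop), cfc_const_one ℝ P,
      cfc_id' ℝ P]
  rw [e]
  refine norm_cfc_le hs.le fun x hx => ?_
  exact (heat_mul_self_bounds hs (spectrum_subset_Icc h0 h1 hx)).2.2

theorem tendsto_heatOp_apply (h0 : 0 ≤ P) (h1 : P ≤ 1) (hd : DenseRange P) (x : H) :
    Tendsto (fun s => heatOp P s x) (𝓝[>] 0) (𝓝 x) := by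
  refine tendsto_apply_of_dense (L := 1) (C := 1)
    (Eventually.of_forall fun s => norm_heatOp_le h0 h1 s) hd ?_ x
  rintro _ ⟨y, rfl⟩
  rw [one_apply_eq_self, tendsto_iff_norm_sub_tendsto_zero]
  have hl : Tendsto (fun s : ℝ => s * ‖y‖) (𝓝[>] 0) (𝓝 0) := by
    have : Continuous fun s : ℝ => s * ‖y‖ := by fun_prop
    simpa using (this.tendsto 0).mono_left nhdsWithin_le_nhds
  refine squeeze_zero' (Eventually.of_forall fun s => norm_nonneg _) ?_ hl
  filter_upwards [self_mem_nhdsWithin] with s hs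
  rw [norm_sub_rev]
  exact (P - heatOp P s * P).le_of_opNorm_le (norm_sub_heatOp_mul_le h0 h1 hs) y

theorem tendsto_generator_heatOp (h0 : 0 ≤ P) (h1 : P ≤ 1) (hd : DenseRange P) (y : H) :
    Tendsto (fun s : ℝ => (s : ℂ)⁻¹ • (P y - heatOp P s (P y))) (𝓝[>] 0) (𝓝 (y - P y)) := by
  have key := tendsto_apply_of_dense (l := 𝓝[>] (0 : ℝ)) (L := 1 - P) (C := 1)
    (S := fun s : ℝ => s⁻¹ • (P - heatOp P s * P)) ?_ hd ?_ y
  · refine key.congr fun s => ?_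
    rw [← Complex.ofReal_inv, Complex.coe_smul]
    rfl
  · filter_upwards [self_mem_nhdsWithin] with s hs
    have hs : 0 < s := hs
    rw [norm_smul, Real.norm_of_nonneg (inv_nonneg.2 hs.le), inv_mul_le_iff₀ hs, mul_one]
    exact norm_sub_heatOp_mul_le h0 h1 hs
  · rintro _ ⟨z, rfl⟩
    rw [tendsto_iff_norm_sub_tendsto_zero]
    have hl : Tendsto (fun s : ℝ => s * ‖z‖) (𝓝[>] 0) (𝓝 0) := by
      have : Continuous fun s : ℝ => s * ‖z‖ := by fun_prop
      simpa using (this.tendsto 0).mono_left nhdsWithin_le_nhds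
    refine squeeze_zero' (Eventually.of_forall fun s => norm_nonneg _) ?_ hl
    filter_upwards [self_mem_nhdsWithin] with s hs
    exact ContinuousLinearMap.le_of_opNorm_le _ (norm_sub_heatOp_mul_mul_le h0 h1 hs) z

theorem isExpNeg_sq (hD : IsSelfAdjoint D) : IsExpNeg (sq D) (heatOp (invOneAddSq D)) := by
  set P := invOneAddSq D with hP
  have h0 : 0 ≤ P := invOneAddSq_nonneg hD
  have h1 : P ≤ 1 := invOneAddSq_le_one hD
  have hd : DenseRange P := dense_range_invOneAddSq hD
  refine ⟨heatOp_zero, fun s r => heatOp_add, fun x => ?_, fun x y => ?_⟩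
  · exact continuousOn_of_tendsto heatOp_zero (fun s r => heatOp_add)
      (fun b => ⟨1, fun s _ => norm_heatOp_le h0 h1 s⟩) x (tendsto_heatOp_apply h0 h1 hd x)
  · rw [mem_sq_graph_iff hD, ← hP]
    constructor
    · intro h
      have := tendsto_generator_heatOp h0 h1 hd (x + y)
      rwa [h, add_sub_cancel_left] at this
    · intro h
      -- `P` commutes with the semigroup, so it maps the quotients at `x` to those at `P x`, whose
      -- limit `x - P x` is known.
      have h2 := (P.continuous.tendsto y).comp h
      have h3 := tendsto_nhds_unique (h2.congr fun s => ?_) (tendsto_generator_heatOp h0 h1 hd x)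
      · rw [map_add, h3]; abel
      · simp only [Function.comp_apply, map_smul, map_sub]
        rw [← mul_apply_eq_comp P, ← (heatOp_commute s).eq, mul_apply_eq_comp]

end Unperturbed

end HeatSchatten

end

open scoped ENNReal Topology InnerProductSpace

noncomputable section

namespace HeatSchatten

open Filter Set MeasureTheory

/-! ### Volterra equations and Dyson series in a normed algebra -/

section Volterra

set_option linter.unusedSectionVars false

/-- Strong measurability of a function on the half-line `(0, ∞)`. -/
def MeasPos {E : Type*} [TopologicalSpace E] [Zero E] (f : ℝ → E) : Prop :=
  StronglyMeasurable ((Ioi (0 : ℝ)).indicator f)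

theorem measPos_of_continuousOn {E : Type*} [TopologicalSpace E]
    [TopologicalSpace.PseudoMetrizableSpace E] [Zero E]
    {f : ℝ → E} (hf : ContinuousOn f (Ioi 0)) : MeasPos f := by
  have h1 : StronglyMeasurable ((Ioi (0 : ℝ)).domRestrict f) :=
    (continuousOn_iff_continuous_domRestrict.1 hf).stronglyMeasurable
  have h2 := (MeasurableEmbedding.subtype_coe (measurableSet_Ioi (a := (0 : ℝ)))).stronglyMeasurable_extend
    h1 (stronglyMeasurable_const (b := (0 : E)))
  rw [MeasPos]
  convert h2 using 1
  ext x
  by_cases hx : x ∈ Ioi (0 : ℝ)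
  · rw [indicator_of_mem hx]
    exact ((Subtype.coe_injective (p := (· ∈ Ioi (0 : ℝ)))).extend_apply
      ((Ioi (0 : ℝ)).domRestrict f) _ ⟨x, hx⟩).symm
  · rw [indicator_of_notMem hx, Function.extend_apply']
    rintro ⟨y, rfl⟩
    exact hx y.2

variable {A : Type*} [NormedRing A] [NormedAlgebra ℝ A]

/-- Convolution on the half-line. -/
def volterra (f g : ℝ → A) (t : ℝ) : A := ∫ s in Ioo 0 t, f (t - s) * g s

/-- Writes the integrand as a product of functions on the whole line, so that measurability of the
convolution in `t` comes from that of parameter integrals. -/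
theorem indicator_mul_indicator_eq (f g : ℝ → A) (t s : ℝ) :
    (Ioi (0 : ℝ)).indicator f (t - s) * (Ioi (0 : ℝ)).indicator g s
      = (Ioo 0 t).indicator (fun s => f (t - s) * g s) s := by
  by_cases h1 : 0 < s <;> by_cases h2 : s < t <;> simp [indicator, h1, h2]

theorem MeasPos.volterra {f g : ℝ → A} (hf : MeasPos f) (hg : MeasPos g) :
    MeasPos (volterra f g) := by
  have h1 : StronglyMeasurable fun p : ℝ × ℝ =>
      (Ioi (0 : ℝ)).indicator f (p.1 - p.2) * (Ioi (0 : ℝ)).indicator g p.2 :=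
    (hf.comp_measurable (measurable_fst.sub measurable_snd)).mul (hg.comp_measurable measurable_snd)
  have h2 := h1.integral_prod_right' (ν := volume)
  refine StronglyMeasurable.indicator ?_ measurableSet_Ioi
  convert h2 using 1
  ext t
  simp only [indicator_mul_indicator_eq, HeatSchatten.volterra]
  rw [integral_indicator measurableSet_Ioo]

theorem MeasPos.neg {f : ℝ → A} (hf : MeasPos f) : MeasPos (-f) := by
  rw [MeasPos, show (Ioi (0 : ℝ)).indicator (-f) = -(Ioi (0 : ℝ)).indicator f from
    indicator_neg _ _]
  exact StronglyMeasurable.neg hf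

theorem MeasPos.aestronglyMeasurable_mul {f g : ℝ → A} (hf : MeasPos f) (hg : MeasPos g) (t : ℝ) :
    AEStronglyMeasurable (fun s => f (t - s) * g s) (volume.restrict (Ioo 0 t)) := by
  have h1 : StronglyMeasurable fun s : ℝ =>
      (Ioi (0 : ℝ)).indicator f (t - s) * (Ioi (0 : ℝ)).indicator g s :=
    (hf.comp_measurable (measurable_const.sub measurable_id)).mul hg
  simp only [indicator_mul_indicator_eq] at h1
  rw [← aestronglyMeasurable_indicator_iff measurableSet_Ioo]
  exact h1.aestronglyMeasurable

theorem MeasPos.integrableOn_mul {f g : ℝ → A} (hf : MeasPos f) (hg : MeasPos g) {t : ℝ}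
    {b : ℝ → ℝ} (hb : IntegrableOn b (Ioo 0 t)) (h : ∀ s ∈ Ioo 0 t, ‖f (t - s) * g s‖ ≤ b s) :
    IntegrableOn (fun s => f (t - s) * g s) (Ioo 0 t) :=
  hb.mono' (hf.aestronglyMeasurable_mul hg t) ((ae_restrict_iff' measurableSet_Ioo).2
    (Eventually.of_forall h))

/-- A function `q` on `(0, ∞)` that is small in `L¹` with weight `e^{-ωs}`. -/
structure IsVolterraKernel (q : ℝ → A) (ω : ℝ) : Prop where
  meas : MeasPos q
  integrable : IntegrableOn (fun s => Real.exp (-(ω * s)) * ‖q s‖) (Ioi 0)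
  small : ∫ s in Ioi 0, Real.exp (-(ω * s)) * ‖q s‖ ≤ 1 / 2

variable {q : ℝ → A} {ω : ℝ}

theorem IsVolterraKernel.integrableOn (hq : IsVolterraKernel q ω) (C t : ℝ) :
    IntegrableOn (fun s => C * Real.exp (ω * (t - s)) * ‖q s‖) (Ioo 0 t) := by
  have := (hq.integrable.mono_set (fun s hs => hs.1 : Ioo 0 t ⊆ Ioi 0)).const_mul (C * Real.exp (ω * t))
  refine this.congr (Eventually.of_forall fun s => ?_)
  simp only
  rw [show ω * (t - s) = ω * t + -(ω * s) by ring, Real.exp_add]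
  ring

theorem IsVolterraKernel.setIntegral_eq (C t : ℝ) :
    ∫ s in Ioo 0 t, C * Real.exp (ω * (t - s)) * ‖q s‖ =
      C * Real.exp (ω * t) * ∫ s in Ioo 0 t, Real.exp (-(ω * s)) * ‖q s‖ := by
  rw [← integral_const_mul]
  refine integral_congr_ae (Eventually.of_forall fun s => ?_)
  simp only
  rw [show ω * (t - s) = ω * t + -(ω * s) by ring, Real.exp_add]
  ring

theorem norm_mul_le_of_bound {f : ℝ → A} {C t : ℝ}
    (hf : ∀ s, 0 < s → ‖f s‖ ≤ C * Real.exp (ω * s)) :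
    ∀ s ∈ Ioo 0 t, ‖f (t - s) * q s‖ ≤ C * Real.exp (ω * (t - s)) * ‖q s‖ := fun _ hs =>
  (norm_mul_le _ _).trans
    (mul_le_mul_of_nonneg_right (hf _ (sub_pos.2 hs.2)) (norm_nonneg _))

theorem IsVolterraKernel.norm_volterra_le (hq : IsVolterraKernel q ω) {f : ℝ → A} {C : ℝ}
    (hf : ∀ s, 0 < s → ‖f s‖ ≤ C * Real.exp (ω * s)) (t : ℝ) :
    ‖volterra f q t‖ ≤ C * Real.exp (ω * t) * ∫ s in Ioo 0 t, Real.exp (-(ω * s)) * ‖q s‖ := by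
  rw [← setIntegral_eq]
  refine norm_integral_le_of_norm_le (hq.integrableOn C t) ?_
  rw [ae_restrict_iff' measurableSet_Ioo]
  exact Eventually.of_forall (norm_mul_le_of_bound hf)

theorem IsVolterraKernel.setIntegral_le (hq : IsVolterraKernel q ω) (t : ℝ) :
    ∫ s in Ioo 0 t, Real.exp (-(ω * s)) * ‖q s‖ ≤ 1 / 2 :=
  (setIntegral_mono_set hq.integrable (Eventually.of_forall fun _ =>
    mul_nonneg (Real.exp_pos _).le (norm_nonneg _))
    (LE.le.eventuallyLE (fun _ hs => hs.1 : Ioo 0 t ⊆ Ioi 0))).trans hq.small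

theorem nonneg_of_bound {f : ℝ → A} {C : ℝ}
    (hf : ∀ s, 0 < s → ‖f s‖ ≤ C * Real.exp (ω * s)) : 0 ≤ C :=
  nonneg_of_mul_nonneg_left ((norm_nonneg _).trans (hf 1 one_pos)) (Real.exp_pos _)

theorem IsVolterraKernel.norm_volterra_le_half (hq : IsVolterraKernel q ω) {f : ℝ → A} {C : ℝ}
    (hf : ∀ s, 0 < s → ‖f s‖ ≤ C * Real.exp (ω * s)) (t : ℝ) :
    ‖volterra f q t‖ ≤ C * (1 / 2) * Real.exp (ω * t) := by
  have hC := nonneg_of_bound hf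
  calc _ ≤ _ := hq.norm_volterra_le hf t
    _ ≤ C * Real.exp (ω * t) * (1 / 2) := by gcongr; exact hq.setIntegral_le t
    _ = _ := by ring

/-- Each substitution of the equation into itself halves the constant in the exponential bound. -/
theorem IsVolterraKernel.eq_zero (hq : IsVolterraKernel q ω) {f : ℝ → A} {C : ℝ}
    (hf : ∀ s, 0 < s → ‖f s‖ ≤ C * Real.exp (ω * s))
    (h : ∀ t, 0 < t → f t = -volterra f q t) {t : ℝ} (ht : 0 < t) : f t = 0 := by
  have key : ∀ n : ℕ, ∀ s, 0 < s → ‖f s‖ ≤ C * (1 / 2) ^ n * Real.exp (ω * s) := by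
    intro n
    induction n with
    | zero => simpa using hf
    | succ n ih =>
      intro s hs
      rw [h s hs, norm_neg, pow_succ, ← mul_assoc]
      exact hq.norm_volterra_le_half ih s
  have hl : Tendsto (fun n : ℕ => C * (1 / 2) ^ n * Real.exp (ω * t)) atTop (𝓝 0) := by
    have := ((tendsto_pow_atTop_nhds_zero_of_lt_one (r := (1 / 2 : ℝ)) (by norm_num)
      (by norm_num)).const_mul C).mul_const (Real.exp (ω * t))
    simpa using this
  exact norm_le_zero_iff.1 (ge_of_tendsto' hl fun n => key n t ht)

/-- The terms of the Dyson series with unperturbed semigroup `T` and kernel `q`. -/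
def dysonTerm (T q : ℝ → A) : ℕ → ℝ → A
  | 0 => T
  | n + 1 => -volterra (dysonTerm T q n) q

/-- The sum of the Dyson series. -/
def dyson (T q : ℝ → A) (t : ℝ) : A := ∑' n, dysonTerm T q n t

variable {T : ℝ → A}

theorem measPos_dysonTerm (hT : MeasPos T) (hq : MeasPos q) (n : ℕ) :
    MeasPos (dysonTerm T q n) := by
  induction n with
  | zero => exact hT
  | succ n ih => exact (ih.volterra hq).neg

theorem norm_dysonTerm_le (hq : IsVolterraKernel q ω) (hω : 0 ≤ ω) (hT : ∀ t, ‖T t‖ ≤ 1) (n : ℕ)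
    {t : ℝ} (ht : 0 ≤ t) : ‖dysonTerm T q n t‖ ≤ (1 / 2) ^ n * Real.exp (ω * t) := by
  induction n generalizing t with
  | zero =>
    rw [pow_zero, one_mul]
    exact (hT t).trans (Real.one_le_exp (by positivity))
  | succ n ih =>
    rw [dysonTerm, Pi.neg_apply, norm_neg, pow_succ]
    exact hq.norm_volterra_le_half (fun s hs => ih hs.le) t

theorem summable_dysonTerm_bound (c : ℝ) : Summable fun n : ℕ => (1 / 2 : ℝ) ^ n * c :=
  summable_geometric_two.mul_right c

variable [CompleteSpace A]

theorem hasSum_dyson (hq : IsVolterraKernel q ω) (hω : 0 ≤ ω) (hT : ∀ t, ‖T t‖ ≤ 1)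
    {t : ℝ} (ht : 0 ≤ t) : HasSum (fun n => dysonTerm T q n t) (dyson T q t) :=
  (Summable.of_norm_bounded (summable_dysonTerm_bound _)
    fun n => norm_dysonTerm_le hq hω hT n ht).hasSum

theorem norm_dyson_le (hq : IsVolterraKernel q ω) (hω : 0 ≤ ω) (hT : ∀ t, ‖T t‖ ≤ 1)
    {t : ℝ} (ht : 0 ≤ t) : ‖dyson T q t‖ ≤ 2 * Real.exp (ω * t) :=
  tsum_of_norm_bounded (hasSum_geometric_two.mul_right _)
    fun n => norm_dysonTerm_le hq hω hT n ht

theorem measPos_dyson (hT : MeasPos T) (hq : IsVolterraKernel q ω) (hω : 0 ≤ ω)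
    (hT1 : ∀ t, ‖T t‖ ≤ 1) : MeasPos (dyson T q) := by
  refine stronglyMeasurable_of_tendsto (u := atTop)
    (f := fun N : ℕ => ∑ n ∈ Finset.range N, (Ioi (0 : ℝ)).indicator (dysonTerm T q n))
    (fun N => Finset.stronglyMeasurable_sum _ fun n _ => measPos_dysonTerm hT hq.meas n) ?_
  rw [tendsto_pi_nhds]
  intro t
  by_cases ht : t ∈ Ioi (0 : ℝ)
  · simp only [Finset.sum_apply, indicator_of_mem ht]
    exact (hasSum_dyson hq hω hT1 (mem_Ioi.1 ht).le).tendsto_sum_nat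
  · simp only [Finset.sum_apply, indicator_of_notMem ht, Finset.sum_const_zero]
    exact tendsto_const_nhds

/-- The Dyson series solves the Volterra equation. -/
theorem dyson_eq (hTm : MeasPos T) (hq : IsVolterraKernel q ω) (hω : 0 ≤ ω)
    (hT : ∀ t, ‖T t‖ ≤ 1) {t : ℝ} (ht : 0 ≤ t) :
    dyson T q t = T t - volterra (dyson T q) q t := by
  have h1 : HasSum (fun n => volterra (dysonTerm T q n) q t) (volterra (dyson T q) q t) := by
    refine hasSum_integral_of_dominated_convergence
      (fun n s => (1 / 2 : ℝ) ^ n * (Real.exp (ω * (t - s)) * ‖q s‖))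
      (fun n => (measPos_dysonTerm hTm hq.meas n).aestronglyMeasurable_mul hq.meas t) (fun n => ?_)
      (Eventually.of_forall fun s => summable_dysonTerm_bound _) ?_ ?_
    · rw [ae_restrict_iff' measurableSet_Ioo]
      refine Eventually.of_forall fun s hs => ?_
      rw [← mul_assoc]
      exact norm_mul_le_of_bound (fun r hr => norm_dysonTerm_le hq hω hT n hr.le) s hs
    · simp only [tsum_mul_right, tsum_geometric_two, ← mul_assoc]
      exact hq.integrableOn 2 t
    · rw [ae_restrict_iff' measurableSet_Ioo]
      exact Eventually.of_forall fun s hs =>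
        (hasSum_dyson hq hω hT (sub_nonneg.2 hs.2.le)).mul_right _
  have h2 : HasSum (fun n => dysonTerm T q (n + 1) t) (-volterra (dyson T q) q t) := h1.neg
  have h3 := (hasSum_nat_add_iff (f := fun n => dysonTerm T q n t) 1).1 h2
  rw [Finset.sum_range_one] at h3
  rw [(hasSum_dyson hq hω hT ht).unique h3, neg_add_eq_sub]
  rfl

theorem dyson_zero (hTm : MeasPos T) (hq : IsVolterraKernel q ω) (hω : 0 ≤ ω)
    (hT : ∀ t, ‖T t‖ ≤ 1) (hT0 : T 0 = 1) : dyson T q 0 = 1 := by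
  rw [dyson_eq hTm hq hω hT le_rfl, hT0, volterra, Ioo_self, Measure.restrict_empty,
    integral_zero_measure, sub_zero]

theorem tendsto_setIntegral_Ioo_zero {f : ℝ → ℝ} (hf : IntegrableOn f (Ioi 0)) :
    Tendsto (fun t => ∫ s in Ioo 0 t, f s) (𝓝[>] 0) (𝓝 0) := by
  have h : Tendsto (fun t : ℝ => (volume.restrict (Ioi (0 : ℝ))) (Ioo 0 t)) (𝓝[>] 0) (𝓝 0) := by
    have h1 : Tendsto (fun t : ℝ => ENNReal.ofReal t) (𝓝[>] 0) (𝓝 0) := by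
      have := (ENNReal.continuous_ofReal.tendsto 0).mono_left (nhdsWithin_le_nhds (s := Ioi 0))
      rwa [ENNReal.ofReal_zero] at this
    refine h1.congr fun t => ?_
    rw [Measure.restrict_apply measurableSet_Ioo, inter_eq_left.2 Ioo_subset_Ioi_self,
      Real.volume_Ioo, sub_zero]
  refine (Integrable.tendsto_setIntegral_nhds_zero hf h).congr fun t => ?_
  rw [Measure.restrict_restrict measurableSet_Ioo, inter_eq_left.2 Ioo_subset_Ioi_self]

/-- The correction is controlled by the integral of an integrable function over a shrinking
interval. -/
theorem tendsto_dyson_sub (hTm : MeasPos T) (hq : IsVolterraKernel q ω) (hω : 0 ≤ ω)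
    (hT : ∀ t, ‖T t‖ ≤ 1) : Tendsto (fun t => dyson T q t - T t) (𝓝[>] 0) (𝓝 0) := by
  have h1 : Tendsto (fun t => 2 * Real.exp (ω * t) *
      ∫ s in Ioo 0 t, Real.exp (-(ω * s)) * ‖q s‖) (𝓝[>] 0) (𝓝 0) := by
    have h2 : Tendsto (fun t => 2 * Real.exp (ω * t)) (𝓝[>] 0) (𝓝 2) := by
      have : Continuous fun t => 2 * Real.exp (ω * t) := by fun_prop
      have h := (this.tendsto 0).mono_left (nhdsWithin_le_nhds (s := Ioi 0))
      simpa using h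
    simpa using h2.mul (tendsto_setIntegral_Ioo_zero hq.integrable)
  refine squeeze_zero_norm' ?_ h1
  filter_upwards [self_mem_nhdsWithin] with t ht
  rw [dyson_eq hTm hq hω hT (mem_Ioi.1 ht).le, sub_sub_cancel_left, norm_neg]
  exact hq.norm_volterra_le (fun s hs => norm_dyson_le hq hω hT hs.le) t

/-- The integral over `(0, r + t)` is split at `t` and its second part translated. -/
theorem volterra_add {f : ℝ → A} (hq : IsVolterraKernel q ω) (hf : MeasPos f) {C : ℝ}
    (hfb : ∀ s, 0 < s → ‖f s‖ ≤ C * Real.exp (ω * s)) {r t : ℝ} (hr : 0 ≤ r) (ht : 0 ≤ t) :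
    volterra f q (r + t) = volterra (fun s => f (r + s)) q t + volterra f (fun s => q (s + t)) r := by
  have hint := hf.integrableOn_mul hq.meas (hq.integrableOn C (r + t)) (norm_mul_le_of_bound hfb)
  have hii : IntervalIntegrable (fun s => f (r + t - s) * q s) volume 0 (r + t) := by
    rw [intervalIntegrable_iff_integrableOn_Ioo_of_le (add_nonneg hr ht)]
    exact hint
  have hsub : ∀ a b, 0 ≤ a → a ≤ b → b ≤ r + t →
      IntervalIntegrable (fun s => f (r + t - s) * q s) volume a b := fun a b ha hab hb =>
    hii.mono_set (by
      rw [uIcc_of_le hab, uIcc_of_le (ha.trans (hab.trans hb))]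
      exact Icc_subset_Icc ha hb)
  have hconv : ∀ (g h : ℝ → A) (a : ℝ), 0 ≤ a →
      volterra g h a = ∫ s in (0 : ℝ)..a, g (a - s) * h s := fun g h a ha => by
    rw [volterra, intervalIntegral.integral_of_le ha, integral_Ioc_eq_integral_Ioo]
  rw [hconv _ _ _ (add_nonneg hr ht), hconv _ _ _ ht, hconv _ _ _ hr,
    ← intervalIntegral.integral_add_adjacent_intervals (hsub 0 t le_rfl ht (by linarith))
      (hsub t (r + t) ht (by linarith) le_rfl)]
  congr 1
  · simp only [add_sub_assoc]
  · have := intervalIntegral.integral_comp_add_right (a := 0) (b := r)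
      (fun s => f (r + t - s) * q s) t
    rw [zero_add] at this
    rw [← this]
    simp only [add_sub_add_right_eq_sub]

/-- For fixed `r`, the defect `S(r + t) - S(r) S(t)` solves the homogeneous Volterra equation, hence
vanishes. By `hqT`, the part of the convolution over `(t, r + t)` is a right multiple of `T t`. -/
theorem dyson_add (hTm : MeasPos T) (hq : IsVolterraKernel q ω) (hω : 0 ≤ ω)
    (hT : ∀ t, ‖T t‖ ≤ 1) (hT0 : T 0 = 1)
    (hTadd : ∀ s r : ℝ, 0 ≤ s → 0 ≤ r → T (s + r) = T s * T r)
    (hqT : ∀ s r : ℝ, 0 < s → 0 ≤ r → q (s + r) = q s * T r) {r t : ℝ} (hr : 0 ≤ r) (ht : 0 ≤ t) :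
    dyson T q (r + t) = dyson T q r * dyson T q t := by
  rcases ht.eq_or_lt with rfl | ht
  · rw [add_zero, dyson_zero hTm hq hω hT hT0, mul_one]
  set S := dyson T q with hS
  have hSm : MeasPos S := measPos_dyson hTm hq hω hT
  have hSb : ∀ s, 0 < s → ‖S s‖ ≤ 2 * Real.exp (ω * s) := fun s hs => norm_dyson_le hq hω hT hs.le
  have hrb : ∀ s, 0 < s → ‖S (r + s)‖ ≤ 2 * Real.exp (ω * r) * Real.exp (ω * s) := fun s hs => by
    have := hSb (r + s) (by linarith)
    rwa [mul_add, Real.exp_add, ← mul_assoc] at this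
  have hrb' : ∀ s, 0 < s → ‖S r * S s‖ ≤ ‖S r‖ * 2 * Real.exp (ω * s) := fun s hs => by
    rw [mul_assoc]
    exact (norm_mul_le _ _).trans (mul_le_mul_of_nonneg_left (hSb s hs) (norm_nonneg _))
  have hint' : ∀ t, IntegrableOn (fun s => S (t - s) * q s) (Ioo 0 t) := fun t =>
    hSm.integrableOn_mul hq.meas (hq.integrableOn _ t) (norm_mul_le_of_bound hSb)
  have hint : ∀ t, IntegrableOn (fun s => S (r + (t - s)) * q s) (Ioo 0 t) := fun t => by
    refine Integrable.mono' (hq.integrableOn _ t) ?_ ((ae_restrict_iff' measurableSet_Ioo).2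
      (Eventually.of_forall (norm_mul_le_of_bound (f := fun s => S (r + s)) hrb)))
    have := (hSm.aestronglyMeasurable_mul hq.meas (r + t)).mono_measure
      (Measure.restrict_mono (Ioo_subset_Ioo_right (by linarith : t ≤ r + t)) le_rfl)
    simpa only [add_sub_assoc] using this
  refine sub_eq_zero.1 (hq.eq_zero (f := fun t => S (r + t) - S r * S t)
    (C := 2 * Real.exp (ω * r) + ‖S r‖ * 2) (fun s hs => ?_) (fun t ht => ?_) ht)
  · refine (norm_sub_le _ _).trans ?_
    rw [add_mul]
    exact add_le_add (hrb s hs) (hrb' s hs)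
  · have e1 : volterra S (fun s => q (s + t)) r = volterra S q r * T t := by
      rw [volterra, volterra, ← integral_mul_const_of_integrable (hint' r)]
      refine setIntegral_congr_fun measurableSet_Ioo fun s hs => ?_
      rw [hqT s t hs.1 ht.le, mul_assoc]
    have e2 : volterra (fun s => S r * S s) q t = S r * volterra S q t := by
      rw [volterra, volterra, ← integral_const_mul_of_integrable (hint' t)]
      simp only [mul_assoc]
    have hint'' : IntegrableOn (fun s => S r * S (t - s) * q s) (Ioo 0 t) :=
      ((hint' t).const_mul (S r)).congr (Eventually.of_forall fun s => (mul_assoc _ _ _).symm)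
    have e3 : volterra (fun t => S (r + t) - S r * S t) q t =
        volterra (fun t => S (r + t)) q t - volterra (fun t => S r * S t) q t := by
      refine Eq.trans ?_ (integral_sub (hint t) hint'')
      simp only [volterra, sub_mul]
    have e4 : S (r + t) = S r * T t - volterra (fun s => S (r + s)) q t := by
      rw [hS, dyson_eq hTm hq hω hT (add_nonneg hr ht.le), ← hS, volterra_add hq hSm hSb hr ht.le,
        e1, hTadd r t hr ht.le]
      conv_rhs => rw [hS, dyson_eq hTm hq hω hT hr, ← hS]
      rw [sub_mul]
      abel
    rw [e3, e2, e4]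
    conv_lhs => rw [hS, dyson_eq hTm hq hω hT ht.le, ← hS]
    rw [mul_sub]
    abel

end Volterra

end HeatSchatten

end

open scoped ENNReal Topology InnerProductSpace

noncomputable section

namespace HeatSchatten

open Filter Set MeasureTheory

/-! ### Generation of the perturbed semigroup -/

section Perturbation

variable {H : Type*} [NormedAddCommGroup H] [InnerProductSpace ℂ H] [CompleteSpace H]
  {D F : H →ₗ.[ℂ] H}

theorem sqrt_mul_sqrt_apply {P : H →L[ℂ] H} (h0 : 0 ≤ P) (x : H) :
    CFC.sqrt P (CFC.sqrt P x) = P x := by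
  rw [← mul_apply_eq_comp, CFC.sqrt_mul_sqrt_self P h0]

theorem norm_sqrt_apply_sq {P : H →L[ℂ] H} (h0 : 0 ≤ P) (x : H) :
    ⟪P x, x⟫_ℂ = ((‖CFC.sqrt P x‖ ^ 2 : ℝ) : ℂ) := by
  have hs : IsSelfAdjoint (CFC.sqrt P) := IsSelfAdjoint.of_nonneg (CFC.sqrt_nonneg P)
  rw [← sqrt_mul_sqrt_apply h0 x, ← ContinuousLinearMap.adjoint_inner_right, hs.adjoint_eq,
    inner_self_eq_norm_sq_to_K]
  push_cast
  rfl

theorem denseRange_sqrt {P : H →L[ℂ] H} (h0 : 0 ≤ P) (hd : DenseRange P) :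
    DenseRange (CFC.sqrt P : H →L[ℂ] H) := by
  refine Dense.mono ?_ hd
  rintro _ ⟨y, rfl⟩
  exact ⟨CFC.sqrt P y, sqrt_mul_sqrt_apply h0 y⟩

/-- `(1 + D²)^{-1/2}` maps into the domain of `D`, and `D (1 + D²)^{-1/2}` is a contraction. -/
theorem invSqrtOneAddSq_mem_domain (hD : IsSelfAdjoint D) (x : H) :
    ∃ h : invSqrtOneAddSq D x ∈ D.domain, ‖D ⟨invSqrtOneAddSq D x, h⟩‖ ≤ ‖x‖ := by
  set P := invOneAddSq D with hP
  have h0 : 0 ≤ P := invOneAddSq_nonneg hD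
  have hmem : ∀ y, P y ∈ D.domain := fun y => by
    obtain ⟨z, -, hz, -⟩ := exists_invOneAddSq_apply hD y
    exact hz ▸ z.2
  let f : H →ₗ[ℂ] H := D.toFun ∘ₗ (P : H →ₗ[ℂ] H).codRestrict D.domain hmem
  let e : H →ₗ[ℂ] H := (CFC.sqrt P : H →L[ℂ] H)
  -- From `‖D P y‖² ≤ ⟨P y, y⟩ = ‖√P y‖²`: the map `√P y ↦ D P y` is a contraction on a dense
  -- subspace. Its extension equals `D √P` because the graph of `D` is closed.
  have hf : ∀ y, ‖f y‖ ≤ 1 * ‖e y‖ := by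
    intro y
    obtain ⟨z, hz, hz'⟩ := inner_invOneAddSq hD y
    rw [← hP] at hz hz'
    rw [norm_sqrt_apply_sq h0, Complex.ofReal_inj] at hz'
    have h1 : f y = D z := by
      change D ⟨P y, hmem y⟩ = D z
      congr 1
      exact Subtype.ext hz.symm
    rw [h1, one_mul]
    refine (sq_le_sq₀ (norm_nonneg _) (norm_nonneg _)).1 ?_
    change ‖D z‖ ^ 2 ≤ ‖CFC.sqrt P y‖ ^ 2
    rw [hz']
    nlinarith [sq_nonneg ‖(z : H)‖]
  have hd : DenseRange e := denseRange_sqrt h0 (dense_range_invOneAddSq hD)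
  set E : H →L[ℂ] H := f.extendOfNorm e with hE
  have hEe : ∀ y, E (e y) = f y := f.extendOfNorm_eq hd ⟨1, hf⟩
  have hcl : IsClosed {x : H | (CFC.sqrt P x, E x) ∈ D.graph} :=
    IsClosed.preimage (f := fun x => (CFC.sqrt P x, E x)) (by fun_prop) hD.isClosed
  have hall : ∀ x, (CFC.sqrt P x, E x) ∈ D.graph := by
    intro x
    refine hd.induction_on (p := fun x => (CFC.sqrt P x, E x) ∈ D.graph) x hcl fun y => ?_
    rw [hEe]
    have : CFC.sqrt P (e y) = P y := sqrt_mul_sqrt_apply h0 y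
    rw [this]
    exact D.mem_graph ⟨P y, hmem y⟩
  obtain ⟨z, hz, hz'⟩ := (LinearPMap.mem_graph_iff D).1 (hall x)
  have hz : (z : H) = invSqrtOneAddSq D x := hz
  refine ⟨hz ▸ z.2, ?_⟩
  have h2 : D ⟨invSqrtOneAddSq D x, hz ▸ z.2⟩ = E x := by
    rw [← show D z = E x from hz']
    congr 1
    exact Subtype.ext hz.symm
  rw [h2]
  have := f.norm_extendOfNorm_apply_le hd 1 hf x
  rwa [one_mul] at this

/-- `F (1 + D²)^{-1/2}` is a bounded operator when `F` is of order at most one. -/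
theorem IsFirstOrder.exists_bounded (hF : IsFirstOrder D F) (hD : IsSelfAdjoint D) :
    ∃ B : H →L[ℂ] H, ∀ x, ∃ h : invSqrtOneAddSq D x ∈ F.domain,
      F ⟨invSqrtOneAddSq D x, h⟩ = B x := by
  obtain ⟨a, ha⟩ := hF.bounded
  have hm := invSqrtOneAddSq_mem_domain hD
  have hmem : ∀ x, invSqrtOneAddSq D x ∈ F.domain := fun x => hF.domain_le (hm x).1
  let f : H →ₗ[ℂ] H := F.toFun ∘ₗ (invSqrtOneAddSq D : H →ₗ[ℂ] H).codRestrict F.domain hmem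
  refine ⟨f.mkContinuous (|a| * (‖invSqrtOneAddSq D‖ + 1)) fun x => ?_, fun x => ⟨hmem x, rfl⟩⟩
  obtain ⟨h, hx⟩ := hm x
  calc ‖f x‖ ≤ a * (‖invSqrtOneAddSq D x‖ + ‖D ⟨invSqrtOneAddSq D x, h⟩‖) := ha ⟨_, h⟩
    _ ≤ |a| * (‖invSqrtOneAddSq D x‖ + ‖D ⟨invSqrtOneAddSq D x, h⟩‖) := by
      gcongr; exact le_abs_self a
    _ ≤ |a| * (‖invSqrtOneAddSq D‖ * ‖x‖ + ‖x‖) := by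
      gcongr; exact (invSqrtOneAddSq D).le_opNorm x
    _ = _ := by ring

theorem norm_mul_rootHeatOp_le {P : H →L[ℂ] H} (h0 : 0 ≤ P) (B : H →L[ℂ] H) {s : ℝ} (hs : 0 < s) :
    ‖B * rootHeatOp P s‖ ≤ ‖B‖ * (√(2 * Real.exp 1))⁻¹ * (s ^ ((1 / 2 : ℝ) - 1) * Real.exp s) := by
  have h1 : (√(2 * Real.exp 1 * s))⁻¹ = (√(2 * Real.exp 1))⁻¹ * s ^ ((1 / 2 : ℝ) - 1) := by
    rw [Real.sqrt_mul (by positivity), mul_inv, Real.sqrt_eq_rpow s, ← Real.rpow_neg hs.le]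
    norm_num
  calc ‖B * rootHeatOp P s‖ ≤ ‖B‖ * (Real.exp s * (√(2 * Real.exp 1 * s))⁻¹) :=
        (norm_mul_le _ _).trans
          (mul_le_mul_of_nonneg_left (norm_rootHeatOp_le h0 hs) (norm_nonneg _))
    _ = _ := by rw [h1]; ring

theorem measPos_mul_rootHeatOp {P : H →L[ℂ] H} (B : H →L[ℂ] H) :
    MeasPos fun s => B * rootHeatOp P s :=
  measPos_of_continuousOn (continuousOn_const.mul continuousOn_rootHeatOp)

theorem exists_isVolterraKernel {P : H →L[ℂ] H} (h0 : 0 ≤ P) (B : H →L[ℂ] H) :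
    ∃ ω : ℝ, 0 ≤ ω ∧ IsVolterraKernel (fun s => B * rootHeatOp P s) ω := by
  set K : ℝ := ‖B‖ * (√(2 * Real.exp 1))⁻¹ with hK
  have hK0 : 0 ≤ K := by positivity
  have hG : 0 < Real.Gamma (1 / 2) := Real.Gamma_pos_of_pos (by norm_num)
  -- The weighted norm is at most `K Γ(1/2) r^{-1/2}`, and this `r` makes it at most `1/2`. The rate
  -- is `r + 1` because one unit absorbs the factor `e^s`.
  set r : ℝ := (2 * (K * Real.Gamma (1 / 2)) + 1) ^ 2 with hr
  have hr0 : 0 < r := by positivity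
  have hb : ∀ s ∈ Ioi (0 : ℝ), Real.exp (-((r + 1) * s)) * ‖B * rootHeatOp P s‖
      ≤ K * (s ^ ((1 / 2 : ℝ) - 1) * Real.exp (-(r * s))) := by
    intro s hs
    calc _ ≤ Real.exp (-((r + 1) * s)) * (K * (s ^ ((1 / 2 : ℝ) - 1) * Real.exp s)) :=
          mul_le_mul_of_nonneg_left (norm_mul_rootHeatOp_le h0 B hs) (Real.exp_pos _).le
      _ = _ := by
          rw [show -(r * s) = -((r + 1) * s) + s by ring, Real.exp_add]; ring
  have hint : IntegrableOn (fun s : ℝ => K * (s ^ ((1 / 2 : ℝ) - 1) * Real.exp (-(r * s))))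
      (Ioi 0) := by
    have := integrableOn_rpow_mul_exp_neg_mul_rpow (s := (1 / 2 : ℝ) - 1) (p := 1) (by norm_num)
      one_pos hr0
    simp only [Real.rpow_one, neg_mul] at this
    exact this.const_mul K
  have hmeas := measPos_mul_rootHeatOp (P := P) B
  refine ⟨r + 1, by positivity, hmeas, ?_, ?_⟩
  · refine hint.mono' ?_ ((ae_restrict_iff' measurableSet_Ioi).2 (Eventually.of_forall fun s hs => ?_))
    · have h1 : AEStronglyMeasurable (fun s => B * rootHeatOp P s) (volume.restrict (Ioi 0)) := by
        rw [← aestronglyMeasurable_indicator_iff measurableSet_Ioi]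
        exact StronglyMeasurable.aestronglyMeasurable hmeas
      exact AEStronglyMeasurable.mul (by fun_prop) h1.norm
    · rw [Real.norm_of_nonneg (by positivity)]
      exact hb s hs
  · calc _ ≤ ∫ s in Ioi 0, K * (s ^ ((1 / 2 : ℝ) - 1) * Real.exp (-(r * s))) := by
          refine integral_mono_of_nonneg (Eventually.of_forall fun s => ?_) hint
            ((ae_restrict_iff' measurableSet_Ioi).2 (Eventually.of_forall hb))
          simp only [Pi.zero_apply]
          positivity
      _ = K * ((1 / r) ^ (1 / 2 : ℝ) * Real.Gamma (1 / 2)) := by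
          rw [integral_const_mul, Real.integral_rpow_mul_exp_neg_mul_Ioi (by norm_num) hr0]
      _ ≤ 1 / 2 := by
          rw [← Real.sqrt_eq_rpow, Real.sqrt_div zero_le_one, Real.sqrt_one, hr,
            Real.sqrt_sq (by positivity)]
          have : 0 ≤ K * Real.Gamma (1 / 2) := by positivity
          rw [show K * (1 / (2 * (K * Real.Gamma (1 / 2)) + 1) * Real.Gamma (1 / 2))
            = (K * Real.Gamma (1 / 2)) / (2 * (K * Real.Gamma (1 / 2)) + 1) by ring,
            div_le_iff₀ (by positivity)]
          linarith

/-- Gives the derivative at `0` of a Volterra integral, whose integrand itself depends on the upper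
limit. -/
theorem tendsto_average {φ : ℝ → ℝ → H} {y : H}
    (h : ∀ ε > 0, ∃ δ > 0, ∀ t ∈ Ioo 0 δ, ∀ s ∈ Ioo 0 t, ‖φ t s - y‖ ≤ ε)
    (hint : ∀ t, IntegrableOn (φ t) (Ioo 0 t)) :
    Tendsto (fun t : ℝ => t⁻¹ • ∫ s in Ioo 0 t, φ t s) (𝓝[>] 0) (𝓝 y) := by
  rw [Metric.tendsto_nhds]
  intro ε hε
  obtain ⟨δ, hδ, hb⟩ := h (ε / 2) (by positivity)
  filter_upwards [Ioo_mem_nhdsGT hδ] with t ht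
  have ht0 : 0 < t := ht.1
  have hvol : volume.real (Ioo 0 t) = t := by
    rw [Real.volume_real_Ioo_of_le ht0.le, sub_zero]
  have hfin : volume (Ioo 0 t) < ⊤ := by rw [Real.volume_Ioo]; exact ENNReal.ofReal_lt_top
  have e : t⁻¹ • (∫ s in Ioo 0 t, φ t s) - y = t⁻¹ • ∫ s in Ioo 0 t, (φ t s - y) := by
    rw [integral_sub (hint t) (integrableOn_const hfin.ne), setIntegral_const, hvol, smul_sub,
      smul_smul, inv_mul_cancel₀ ht0.ne', one_smul]
  rw [dist_eq_norm, e, norm_smul, Real.norm_of_nonneg (inv_nonneg.2 ht0.le)]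
  have h1 := norm_setIntegral_le_of_norm_le_const hfin (hb t ht)
  rw [hvol] at h1
  calc _ ≤ t⁻¹ * (ε / 2 * t) := by gcongr
    _ = ε / 2 := by field_simp
    _ < ε := by linarith

/-- Parametrizing `dom D²` by `v = (1 + D²) x` leaves only bounded operators, since `F P v = F R (R
v) = B (R v)`. -/
theorem mem_sq_add_graph_iff (hD : IsSelfAdjoint D) {B : H →L[ℂ] H}
    (hB : ∀ x, ∃ h : invSqrtOneAddSq D x ∈ F.domain, F ⟨invSqrtOneAddSq D x, h⟩ = B x) {x y : H} :
    (x, y) ∈ (sq D + F).graph ↔ ∃ v, x = invOneAddSq D v ∧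
      y = v - invOneAddSq D v + B (invSqrtOneAddSq D v) := by
  have hP := invOneAddSq_nonneg hD
  have hRR : ∀ v, invSqrtOneAddSq D (invSqrtOneAddSq D v) = invOneAddSq D v :=
    sqrt_mul_sqrt_apply hP
  have hFv : ∀ (v z : H) (hz : z ∈ F.domain), z = invOneAddSq D v →
      F ⟨z, hz⟩ = B (invSqrtOneAddSq D v) := by
    rintro v z hz rfl
    obtain ⟨h, h'⟩ := hB (invSqrtOneAddSq D v)
    rw [← h']
    congr 1
    exact Subtype.ext (hRR v).symm
  constructor
  · intro h
    obtain ⟨z, rfl, rfl⟩ := (LinearPMap.mem_graph_iff _).1 h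
    have hz : (z : H) ∈ (sq D).domain ⊓ F.domain := z.2
    have h1 := (mem_sq_graph_iff hD).1 ((sq D).mem_graph ⟨z, hz.1⟩)
    refine ⟨z + sq D ⟨z, hz.1⟩, h1.symm, ?_⟩
    rw [h1, LinearPMap.add_apply, hFv _ z hz.2 h1.symm, add_sub_cancel_left]
  · rintro ⟨v, rfl, rfl⟩
    obtain ⟨h, -⟩ := hB (invSqrtOneAddSq D v)
    rw [hRR] at h
    have h1 : (invOneAddSq D v, v - invOneAddSq D v) ∈ (sq D).graph :=
      (mem_sq_graph_iff hD).2 (by rw [add_sub_cancel])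
    obtain ⟨z, hz, hz'⟩ := (LinearPMap.mem_graph_iff _).1 h1
    have hz : (z : H) = invOneAddSq D v := hz
    have hzF : (z : H) ∈ F.domain := hz ▸ h
    refine (LinearPMap.mem_graph_iff _).2 ⟨⟨z, z.2, hzF⟩, hz, ?_⟩
    rw [LinearPMap.add_apply, hFv v z hzF hz]
    congr 1

/-- For `x = P v` the left side is `(1 + μ + D² + F) x`. Putting `v = M u` with `M = (1 + μP)⁻¹`
turns the equation into `(1 + B √P M) u = g`, solved by a Neumann series because `√x / (1 + μx) ≤
μ^{-1/2}`. -/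
theorem exists_resolvent_eq {P : H →L[ℂ] H} (h0 : 0 ≤ P) (B : H →L[ℂ] H) {μ : ℝ} (hμ : 0 < μ)
    (hBμ : ‖B‖ < √μ) (g : H) :
    ∃ v, (μ : ℂ) • P v + v + B (CFC.sqrt P v) = g := by
  have hsa : IsSelfAdjoint P := IsSelfAdjoint.of_nonneg h0
  have hpos : ∀ x ∈ spectrum ℝ P, 0 < 1 + μ * x := fun x hx => by
    have := spectrum_nonneg_of_nonneg h0 hx
    positivity
  have hc : ContinuousOn (fun x : ℝ => (1 + μ * x)⁻¹) (spectrum ℝ P) :=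
    ContinuousOn.inv₀ (by fun_prop) fun x hx => (hpos x hx).ne'
  set M : H →L[ℂ] H := cfc (fun x : ℝ => (1 + μ * x)⁻¹) P with hM
  have hM1 : ∀ u, (μ : ℂ) • P (M u) + M u = u := by
    have h1 : (1 + μ • P) * M = 1 := by
      have h2 : (1 + μ • P) = cfc (fun x : ℝ => 1 + μ * x) P := by
        rw [cfc_add P (fun _ : ℝ => (1 : ℝ)) (fun x => μ * x) (by fun_prop) (by fun_prop),
          cfc_const_one ℝ P, cfc_const_mul_id μ P]
      rw [h2, hM, ← cfc_mul _ _ P (by fun_prop) hc, ← cfc_const_one ℝ P]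
      exact cfc_congr fun x hx => mul_inv_cancel₀ (hpos x hx).ne'
    intro u
    have h3 := congrArg (fun A : H →L[ℂ] H => A u) h1
    simp only [mul_apply_eq_comp, add_apply, one_apply_eq_self, smul_apply] at h3
    rw [add_comm, Complex.coe_smul]
    exact h3
  have hRM : ‖CFC.sqrt P * M‖ ≤ (√μ)⁻¹ := by
    rw [sqrt_eq_cfc_real h0, hM, ← cfc_mul _ _ P Real.continuous_sqrt.continuousOn hc]
    refine norm_cfc_le (by positivity) fun x hx => ?_
    have hx0 := spectrum_nonneg_of_nonneg h0 hx
    have hp := hpos x hx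
    rw [Real.norm_of_nonneg (by positivity), ← div_eq_mul_inv, div_le_iff₀ hp,
      ← div_eq_inv_mul, le_div_iff₀ (Real.sqrt_pos.2 hμ)]
    nlinarith [sq_nonneg (√x * √μ - 1), Real.sq_sqrt hx0, Real.sq_sqrt hμ.le,
      mul_pow √x √μ 2, Real.sqrt_nonneg x, Real.sqrt_nonneg μ,
      mul_nonneg (Real.sqrt_nonneg x) (Real.sqrt_nonneg μ)]
  have hlt : ‖-(B * (CFC.sqrt P * M))‖ < 1 := by
    rw [norm_neg]
    calc _ ≤ ‖B‖ * (√μ)⁻¹ := (norm_mul_le _ _).trans (by gcongr)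
      _ < 1 := by
        rw [← div_eq_mul_inv, div_lt_one (Real.sqrt_pos.2 hμ)]
        exact hBμ
  have hu := isUnit_one_sub_of_norm_lt_one hlt
  rw [sub_neg_eq_add] at hu
  obtain ⟨N, hN⟩ := hu.exists_right_inv
  refine ⟨M (N g), ?_⟩
  rw [hM1]
  have := congrArg (fun A : H →L[ℂ] H => A g) hN
  simpa only [mul_apply_eq_comp, add_apply, one_apply_eq_self] using this

/-- `-(D² + F)` generates a strongly continuous semigroup, given by the Dyson series. -/
theorem isExpNeg_sq_add (hD : IsSelfAdjoint D) {B : H →L[ℂ] H}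
    (hB : ∀ x, ∃ h : invSqrtOneAddSq D x ∈ F.domain, F ⟨invSqrtOneAddSq D x, h⟩ = B x) {ω : ℝ}
    (hω : 0 ≤ ω)
    (hq : IsVolterraKernel (fun s => B * rootHeatOp (invOneAddSq D) s) ω) :
    IsExpNeg (sq D + F)
      (dyson (heatOp (invOneAddSq D)) fun s => B * rootHeatOp (invOneAddSq D) s) := by
  set P := invOneAddSq D with hP
  set q : ℝ → H →L[ℂ] H := fun s => B * rootHeatOp P s with hqdef
  set S := dyson (heatOp P) q with hS
  have h0 : 0 ≤ P := invOneAddSq_nonneg hD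
  have h1 : P ≤ 1 := invOneAddSq_le_one hD
  have hd : DenseRange P := dense_range_invOneAddSq hD
  have hTm : MeasPos (heatOp P) := measPos_of_continuousOn continuousOn_heatOp
  have hT : ∀ t, ‖heatOp P t‖ ≤ 1 := norm_heatOp_le h0 h1
  have hSm : MeasPos S := measPos_dyson hTm hq hω hT
  have hSb : ∀ s, 0 ≤ s → ‖S s‖ ≤ 2 * Real.exp (ω * s) := fun s hs => norm_dyson_le hq hω hT hs
  have hS0 : S 0 = 1 := dyson_zero hTm hq hω hT heatOp_zero
  have hSadd : ∀ s r : ℝ, 0 ≤ s → 0 ≤ r → S (s + r) = S s * S r := fun s r hs hr =>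
    dyson_add hTm hq hω hT heatOp_zero (fun s r => heatOp_add)
      (fun s r hs hr => by rw [hqdef, mul_assoc, ← rootHeatOp_add hs hr]) hs hr
  have hSlim : ∀ x, Tendsto (fun s => S s x) (𝓝[>] 0) (𝓝 x) := by
    intro x
    have h2 := ((ContinuousLinearMap.apply ℂ H x).continuous.tendsto _).comp
      (tendsto_dyson_sub hTm hq hω hT)
    rw [map_zero] at h2
    have h3 := h2.add (tendsto_heatOp_apply h0 h1 hd x)
    rw [zero_add] at h3
    refine h3.congr fun t => ?_
    simp [hS]
  have hScont : ∀ x, ContinuousOn (fun s => S s x) (Ici 0) := fun x =>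
    continuousOn_of_tendsto hS0 hSadd (fun b => ⟨2 * Real.exp (ω * b), fun s hs =>
      (hSb s hs.1).trans (by
        have := hs.2
        gcongr)⟩) x (hSlim x)
  -- The generator extends `-(D² + F)`: on `P v` the kernel is `B e^{-sD²} √P v`, which converges as
  -- `s → 0`, so the averages of the Volterra integral converge to `B √P v`.
  have hforward : ∀ v, Tendsto (fun s : ℝ => (s : ℂ)⁻¹ • (P v - S s (P v))) (𝓝[>] 0)
      (𝓝 (v - P v + B (CFC.sqrt P v))) := by
    intro v
    set y := B (CFC.sqrt P v) with hy
    have hqx : ∀ s, 0 < s → q s (P v) = B (heatOp P s (CFC.sqrt P v)) := by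
      intro s hs
      rw [hqdef, mul_apply_eq_comp, ← sqrt_mul_sqrt_apply h0 v, ← mul_apply_eq_comp (rootHeatOp P s),
        rootHeatOp_mul_sqrt h0 hs]
    have hqlim : Tendsto (fun s => q s (P v)) (𝓝[>] 0) (𝓝 y) := by
      refine ((B.continuous.tendsto _).comp (tendsto_heatOp_apply h0 h1 hd (CFC.sqrt P v))).congr' ?_
      filter_upwards [self_mem_nhdsWithin] with s hs
      exact (hqx s hs).symm
    have hint : ∀ t, IntegrableOn (fun s => S (t - s) * q s) (Ioo 0 t) := fun t =>
      hSm.integrableOn_mul hq.meas (hq.integrableOn _ t)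
        (norm_mul_le_of_bound fun s hs => hSb s hs.le)
    have havg : Tendsto (fun t : ℝ => t⁻¹ • ∫ s in Ioo 0 t, (S (t - s) * q s) (P v)) (𝓝[>] 0)
        (𝓝 y) := by
      refine tendsto_average (fun ε hε => ?_) fun t =>
        (ContinuousLinearMap.apply ℂ H (P v)).integrable_comp (hint t)
      have hev1 := Metric.tendsto_nhds.1 hqlim (ε / (2 * (2 * Real.exp ω))) (by positivity)
      have hev2 := Metric.tendsto_nhds.1 (hSlim y) (ε / 2) (by positivity)
      obtain ⟨δ, hδ, hδ'⟩ := mem_nhdsGT_iff_exists_Ioo_subset.1 (hev1.and hev2)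
      refine ⟨min δ 1, lt_min hδ one_pos, fun t ht s hs => ?_⟩
      have hs0 := hs.1
      have hst := hs.2
      have htδ : t < δ := ht.2.trans_le (min_le_left _ _)
      have ht1 : t < 1 := ht.2.trans_le (min_le_right _ _)
      have a1 := (hδ' ⟨hs0, hst.trans htδ⟩).1
      have a2 := (hδ' (⟨sub_pos.2 hst, by linarith⟩ : t - s ∈ Ioo 0 δ)).2
      rw [dist_eq_norm] at a1 a2
      have e : (S (t - s) * q s) (P v) - y
          = S (t - s) (q s (P v) - y) + (S (t - s) y - y) := by
        rw [mul_apply_eq_comp, map_sub]; abel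
      have a3 : ‖S (t - s)‖ ≤ 2 * Real.exp ω := by
        refine (hSb _ (by linarith)).trans ?_
        gcongr
        nlinarith
      calc _ ≤ 2 * Real.exp ω * ‖q s (P v) - y‖ + ‖S (t - s) y - y‖ := by
            rw [e]
            exact (norm_add_le _ _).trans
              (add_le_add_left ((S (t - s)).le_of_opNorm_le a3 _) _)
        _ ≤ 2 * Real.exp ω * (ε / (2 * (2 * Real.exp ω))) + ε / 2 := by gcongr
        _ = ε := by field_simp; ring
    refine ((tendsto_generator_heatOp h0 h1 hd v).add havg).congr' ?_
    filter_upwards [self_mem_nhdsWithin] with t ht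
    have e1 : ∫ s in Ioo 0 t, (S (t - s) * q s) (P v) = volterra S q t (P v) :=
      ((ContinuousLinearMap.apply ℂ H (P v)).integral_comp_comm (hint t))
    have e2 : S t (P v) = heatOp P t (P v) - volterra S q t (P v) := by
      rw [hS, dyson_eq hTm hq hω hT (mem_Ioi.1 ht).le, sub_apply]
    rw [e1, e2, ← Complex.coe_smul, Complex.ofReal_inv, ← smul_add]
    congr 1
    abel
  refine ⟨hS0, hSadd, hScont, fun x y => ?_⟩
  rw [mem_sq_add_graph_iff hD hB]
  constructor
  · rintro ⟨v, rfl, rfl⟩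
    exact hforward v
  · intro hxy
    -- Large enough for `√μ > ‖B‖`, so that the resolvent equation is solvable, and for `1 + μ > ω`.
    -- The solution `P v` then differs from `x` by an element of the eigenspace of the generator for
    -- `1 + μ`, which is zero.
    set μ : ℝ := (‖B‖ + 1 + ω) ^ 2 with hμ
    have hμ0 : 0 < μ := by positivity
    have hsq : √μ = ‖B‖ + 1 + ω := Real.sqrt_sq (by positivity)
    have hωμ : ω < 1 + μ := by
      have : 0 ≤ ‖B‖ := norm_nonneg _
      nlinarith
    obtain ⟨v, hv⟩ := exists_resolvent_eq h0 B hμ0 (by rw [hsq]; linarith)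
      (((1 + μ : ℝ) : ℂ) • x + y)
    have hz := hxy.sub (hforward v)
    have hzero : x - P v = 0 := by
      refine eq_zero_of_tendsto_generator hS0 hSadd hSb hωμ (hScont _) ?_
      have e : y - (v - P v + B (CFC.sqrt P v)) = -((1 + μ : ℝ) : ℂ) • (x - P v) := by
        have hv' : B (CFC.sqrt P v) = ((1 + μ : ℝ) : ℂ) • x + y - (μ : ℂ) • P v - v := by
          rw [← hv]; abel
        rw [hv']
        push_cast
        module
      rw [e] at hz
      refine hz.congr fun s => ?_
      rw [← smul_sub, map_sub]
      congr 1
      abel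
    have hx : x = P v := sub_eq_zero.1 hzero
    refine ⟨v, hx, ?_⟩
    rw [hx] at hxy
    exact tendsto_nhds_unique hxy (hforward v)

end Perturbation

end HeatSchatten

end

open scoped ENNReal Topology InnerProductSpace

noncomputable section

namespace HeatSchatten

open Filter Set MeasureTheory

/-! ### Finite Bessel families -/

section Bessel

variable {H : Type*} [NormedAddCommGroup H] [InnerProductSpace ℂ H]

theorem norm_inner_self_eq_norm_sq (x : H) : ‖⟪x, x⟫_ℂ‖ = ‖x‖ ^ 2 := by
  rw [inner_self_eq_norm_sq_to_K, norm_pow, RCLike.norm_ofReal, abs_norm]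

/-- A finite family of vectors that satisfies Bessel's inequality. -/
def IsBessel {ι : Type*} (s : Finset ι) (e : ι → H) : Prop :=
  ∀ x, ∑ i ∈ s, ‖⟪e i, x⟫_ℂ‖ ^ 2 ≤ ‖x‖ ^ 2

theorem isBessel_of_orthonormal {ι : Type*} {e : ι → H} (he : Orthonormal ℂ e) (s : Finset ι) :
    IsBessel s e := fun x => he.sum_inner_products_le x

variable {ι κ : Type*} {s : Finset ι} {t : Finset κ} {e : ι → H}

theorem IsBessel.norm_le_one (he : IsBessel s e) {i : ι} (hi : i ∈ s) : ‖e i‖ ≤ 1 := by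
  have h1 := (Finset.single_le_sum (f := fun j => ‖⟪e j, e i⟫_ℂ‖ ^ 2)
    (fun j _ => sq_nonneg _) hi).trans (he (e i))
  simp only [norm_inner_self_eq_norm_sq] at h1
  by_contra! h
  nlinarith [sq_nonneg ‖e i‖, mul_self_nonneg (‖e i‖ - 1)]

theorem IsBessel.smul (he : IsBessel s e) {c : ι → ℂ} (hc : ∀ i, ‖c i‖ ≤ 1) :
    IsBessel s fun i => c i • e i := by
  refine fun x => (Finset.sum_le_sum fun i _ => ?_).trans (he x)
  rw [inner_smul_left, norm_mul, RCLike.norm_conj]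
  gcongr
  exact mul_le_of_le_one_left (norm_nonneg _) (hc i)

/-- Synthesis is the adjoint of analysis, hence also a contraction; concretely, Cauchy–Schwarz
applied to `⟨v, v⟩`. -/
theorem IsBessel.norm_sum_smul_sq_le (he : IsBessel s e) (c : ι → ℂ) :
    ‖∑ i ∈ s, c i • e i‖ ^ 2 ≤ ∑ i ∈ s, ‖c i‖ ^ 2 := by
  set v := ∑ i ∈ s, c i • e i with hv
  have h1 : ‖v‖ ^ 2 ≤ ∑ i ∈ s, ‖c i‖ * ‖⟪e i, v⟫_ℂ‖ := by
    have : ⟪v, v⟫_ℂ = ∑ i ∈ s, (starRingEnd ℂ) (c i) * ⟪e i, v⟫_ℂ := by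
      conv_lhs => enter [2]; rw [hv]
      rw [sum_inner]
      simp only [inner_smul_left]
    rw [← norm_inner_self_eq_norm_sq, this]
    refine (norm_sum_le _ _).trans (Finset.sum_le_sum fun i _ => ?_)
    rw [norm_mul, RCLike.norm_conj]
  have h2 := Finset.sum_mul_sq_le_sq_mul_sq s (fun i => ‖c i‖) fun i => ‖⟪e i, v⟫_ℂ‖
  have h3 : 0 ≤ ∑ i ∈ s, ‖c i‖ ^ 2 := Finset.sum_nonneg fun i _ => sq_nonneg _
  have h4 := he v
  rcases (sq_nonneg ‖v‖).eq_or_lt with h | h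
  · rw [← h]; exact h3
  have h5 : (‖v‖ ^ 2) ^ 2 ≤ (∑ i ∈ s, ‖c i‖ ^ 2) * ‖v‖ ^ 2 :=
    (pow_le_pow_left₀ h.le h1 2).trans (h2.trans (mul_le_mul_of_nonneg_left h4 h3))
  rw [pow_two (‖v‖ ^ 2)] at h5
  exact le_of_mul_le_mul_right h5 h

/-- The composition of three contractions between finite-dimensional spaces and `H`. -/
theorem IsBessel.comp (he : IsBessel s e) {f f' : κ → H} (hf : IsBessel t f)
    (hf' : IsBessel t f') : IsBessel s fun i => ∑ j ∈ t, ⟪f j, e i⟫_ℂ • f' j := by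
  intro x
  have h1 : ∀ i, ⟪∑ j ∈ t, ⟪f j, e i⟫_ℂ • f' j, x⟫_ℂ = ⟪e i, ∑ j ∈ t, ⟪f' j, x⟫_ℂ • f j⟫_ℂ := by
    intro i
    rw [sum_inner, inner_sum]
    refine Finset.sum_congr rfl fun j _ => ?_
    rw [inner_smul_left, inner_smul_right, inner_conj_symm, mul_comm]
  simp only [h1]
  exact (he _).trans ((hf.norm_sum_smul_sq_le _).trans (hf' x))

theorem IsBessel.map [CompleteSpace H] (he : IsBessel s e) {C : H →L[ℂ] H} (hC : ‖C‖ ≤ 1) :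
    IsBessel s fun i => C (e i) := by
  intro x
  simp only [← ContinuousLinearMap.adjoint_inner_right]
  refine (he _).trans ?_
  gcongr
  refine ((ContinuousLinearMap.adjoint C).le_of_opNorm_le ?_ x).trans_eq (one_mul _)
  rwa [LinearIsometryEquiv.norm_map]

end Bessel

/-! ### Schatten bounds by duality, and Hölder's inequality -/

section SchattenBound

variable {H : Type*} [NormedAddCommGroup H] [InnerProductSpace ℂ H]

/-- `SchattenBound b K X` expresses, by duality, that the Schatten norm of `X` with exponent `b⁻¹`
is at most `K`; for `b = 0` the Schatten norm is the operator norm. -/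
def SchattenBound (b K : ℝ) (X : H →L[ℂ] H) : Prop :=
  ∀ (m : ℕ) (e f : Fin m → H), IsBessel Finset.univ e → IsBessel Finset.univ f →
    ∀ w : Fin m → ℝ, (∀ i, 0 < w i) → ∑ i, w i ≤ 1 →
      ‖∑ i, ((w i ^ (1 - b) : ℝ) : ℂ) * ⟪f i, X (e i)⟫_ℂ‖ ≤ K

variable {b K : ℝ} {X : H →L[ℂ] H}

theorem SchattenBound.nonneg (h : SchattenBound b K X) : 0 ≤ K := by
  have := h 0 (fun _ => 0) (fun _ => 0) (fun x => by simp)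
    (fun x => by simp) (fun _ => 1) (fun _ => one_pos) (by simp)
  simpa using this

theorem SchattenBound.mono (h : SchattenBound b K X) {K' : ℝ} (hK : K ≤ K') :
    SchattenBound b K' X := fun m e f he hf w hw hw1 => (h m e f he hf w hw hw1).trans hK

theorem SchattenBound.neg (h : SchattenBound b K X) : SchattenBound b K (-X) := by
  intro m e f he hf w hw hw1
  simpa using h m e f he hf w hw hw1

theorem SchattenBound.finset {ι : Type*} (h : SchattenBound b K X) (s : Finset ι) {e f : ι → H}
    (he : IsBessel s e) (hf : IsBessel s f) {w : ι → ℝ} (hw : ∀ i ∈ s, 0 < w i)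
    (hw1 : ∑ i ∈ s, w i ≤ 1) :
    ‖∑ i ∈ s, ((w i ^ (1 - b) : ℝ) : ℂ) * ⟪f i, X (e i)⟫_ℂ‖ ≤ K := by
  have key : ∀ {M : Type _} [AddCommMonoid M] (g : ι → M),
      ∑ j : Fin s.card, g (s.equivFin.symm j) = ∑ i ∈ s, g i := fun g => by
    rw [Equiv.sum_comp s.equivFin.symm (fun i : s => g i), Finset.sum_coe_sort s g]
  have := h s.card (fun j => e (s.equivFin.symm j)) (fun j => f (s.equivFin.symm j))
    (fun x => (key fun i => ‖⟪e i, x⟫_ℂ‖ ^ 2).trans_le (he x))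
    (fun x => (key fun i => ‖⟪f i, x⟫_ℂ‖ ^ 2).trans_le (hf x))
    (fun j => w (s.equivFin.symm j)) (fun j => hw _ (s.equivFin.symm j).2)
    ((key w).trans_le hw1)
  rwa [key fun i => ((w i ^ (1 - b) : ℝ) : ℂ) * ⟪f i, X (e i)⟫_ℂ] at this

theorem SchattenBound.zero (b : ℝ) : SchattenBound b 0 (0 : H →L[ℂ] H) := by
  intro m e f he hf w hw hw1
  simp

theorem SchattenBound.one : SchattenBound 0 1 (1 : H →L[ℂ] H) := by
  intro m e f he hf w hw hw1
  refine (norm_sum_le _ _).trans ((Finset.sum_le_sum fun i _ => ?_).trans hw1)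
  rw [sub_zero, Real.rpow_one, norm_mul, Complex.norm_real, Real.norm_of_nonneg (hw i).le,
    one_apply_eq_self]
  refine mul_le_of_le_one_right (hw i).le ((norm_inner_le_norm _ _).trans ?_)
  exact mul_le_one₀ (hf.norm_le_one (Finset.mem_univ i)) (norm_nonneg _)
    (he.norm_le_one (Finset.mem_univ i))

theorem SchattenBound.smul (h : SchattenBound b K X) {c : ℝ} (hc : 0 ≤ c) :
    SchattenBound b (K * c) ((c : ℂ) • X) := by
  intro m e f he hf w hw hw1
  have := h m e f he hf w hw hw1
  simp only [smul_apply, inner_smul_right]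
  rw [show ∑ i, ((w i ^ (1 - b) : ℝ) : ℂ) * ((c : ℂ) * ⟪f i, X (e i)⟫_ℂ)
    = (c : ℂ) * ∑ i, ((w i ^ (1 - b) : ℝ) : ℂ) * ⟪f i, X (e i)⟫_ℂ by
      rw [Finset.mul_sum]; exact Finset.sum_congr rfl fun i _ => by ring]
  rw [norm_mul, Complex.norm_real, Real.norm_of_nonneg hc, mul_comm]
  gcongr

/-- For `c > 0` the contraction `c⁻¹ C` maps Bessel families to Bessel families. Orthonormal test
families would not be stable in this way. -/
theorem SchattenBound.mul_right [CompleteSpace H] (h : SchattenBound b K X) {C : H →L[ℂ] H}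
    {c : ℝ} (hC : ‖C‖ ≤ c) : SchattenBound b (K * c) (X * C) := by
  rcases ((norm_nonneg C).trans hC).eq_or_lt with rfl | hc
  · rw [norm_le_zero_iff.1 hC, mul_zero, mul_zero]
    exact SchattenBound.zero b
  have h1 : SchattenBound b K (X * ((c⁻¹ : ℝ) : ℂ) • C) := by
    intro m e f he hf w hw hw1
    refine h m (fun i => (((c⁻¹ : ℝ) : ℂ) • C) (e i)) f (he.map ?_) hf w hw hw1
    rw [norm_smul, Complex.norm_real, Real.norm_of_nonneg (inv_nonneg.2 hc.le),
      inv_mul_le_iff₀ hc, mul_one]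
    exact hC
  have h2 := h1.smul hc.le
  rw [mul_smul_comm, smul_smul, ← Complex.ofReal_mul, mul_inv_cancel₀ hc.ne', Complex.ofReal_one,
    one_smul] at h2
  exact h2

/-- The continuous linear functional that occurs in the definition of `SchattenBound`. -/
def pairing {m : ℕ} (b : ℝ) (e f : Fin m → H) (w : Fin m → ℝ) : (H →L[ℂ] H) →L[ℂ] ℂ :=
  ∑ i, ((w i ^ (1 - b) : ℝ) : ℂ) • (innerSL ℂ (f i)) ∘L (ContinuousLinearMap.apply ℂ H (e i))

theorem pairing_apply {m : ℕ} (e f : Fin m → H) (w : Fin m → ℝ) :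
    pairing b e f w X = ∑ i, ((w i ^ (1 - b) : ℝ) : ℂ) * ⟪f i, X (e i)⟫_ℂ := by
  simp [pairing, sum_apply]

/-- Each test pairing is continuous for the operator norm and passes under the integral, so no
integration in a Schatten ideal is needed. -/
theorem SchattenBound.integral [CompleteSpace H] {s : Set ℝ} (hs : MeasurableSet s)
    {G : ℝ → H →L[ℂ] H} {φ : ℝ → ℝ} (hG : IntegrableOn G s) (hφ : IntegrableOn φ s)
    (h : ∀ r ∈ s, SchattenBound b (φ r) (G r)) :
    SchattenBound b (∫ r in s, φ r) (∫ r in s, G r) := by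
  intro m e f he hf w hw hw1
  rw [← pairing_apply, ← (pairing b e f w).integral_comp_comm hG]
  refine norm_integral_le_of_norm_le hφ ((ae_restrict_iff' hs).2 (Eventually.of_forall fun r hr => ?_))
  rw [pairing_apply]
  exact h r hr m e f he hf w hw hw1

theorem SchattenBound.hasSum {G : ℕ → H →L[ℂ] H} {φ : ℕ → ℝ} {L : ℝ} (hG : HasSum G X)
    (hφ : HasSum φ L) (h : ∀ n, SchattenBound b (φ n) (G n)) : SchattenBound b L X := by
  intro m e f he hf w hw hw1
  rw [← pairing_apply, ← (hG.mapL (pairing b e f w)).tsum_eq]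
  refine tsum_of_norm_bounded hφ fun n => ?_
  rw [pairing_apply]
  exact h n m e f he hf w hw hw1

/-- The three lines theorem for a finite sum of exponentials. -/
theorem norm_sum_rpow_le {ι κ : Type*} (s : Finset ι) (t : Finset κ) {w : ι → ℝ} {μ : κ → ℝ}
    (hw : ∀ i, 0 < w i) (hμ : ∀ j, 0 < μ j) (c : ι → κ → ℂ) {l K K' a : ℝ} (hl : 0 < l)
    (ha : a ∈ Icc 0 l)
    (h0 : ∀ (θ : ι → ℂ) (τ : κ → ℂ), (∀ i, ‖θ i‖ = 1) → (∀ j, ‖τ j‖ = 1) →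
      ‖∑ i ∈ s, ∑ j ∈ t, ((w i ^ l : ℝ) : ℂ) * (θ i * τ j * c i j)‖ ≤ K)
    (h1 : ∀ (θ : ι → ℂ) (τ : κ → ℂ), (∀ i, ‖θ i‖ = 1) → (∀ j, ‖τ j‖ = 1) →
      ‖∑ i ∈ s, ∑ j ∈ t, ((μ j ^ l : ℝ) : ℂ) * (θ i * τ j * c i j)‖ ≤ K') :
    ‖∑ i ∈ s, ∑ j ∈ t, ((w i ^ (l - a) * μ j ^ a : ℝ) : ℂ) * c i j‖
      ≤ K ^ (1 - a / l) * K' ^ (a / l) := by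
  -- This is `∑ w_i^{l-z} μ_j^z c_{ij}`. On the two boundary lines the imaginary part of `z`
  -- contributes only unimodular factors, which are the `θ` and `τ` of `h0` and `h1`.
  set φ : ℂ → ℂ := fun z => ∑ i ∈ s, ∑ j ∈ t,
    Complex.exp ((Real.log (w i) : ℂ) * (l - z)) * Complex.exp ((Real.log (μ j) : ℂ) * z) * c i j
    with hφ
  have hcast : ∀ {x : ℝ}, 0 < x → ∀ r : ℝ, Complex.exp ((Real.log x : ℂ) * r) = ((x ^ r : ℝ) : ℂ) := by
    intro x hx r
    rw [← Complex.ofReal_mul, ← Complex.ofReal_exp, Real.rpow_def_of_pos hx]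
  have hd : Differentiable ℂ φ := by fun_prop
  have hB : BddAbove ((norm ∘ φ) '' Complex.HadamardThreeLines.verticalClosedStrip 0 l) := by
    refine ⟨∑ i ∈ s, ∑ j ∈ t, Real.exp (|Real.log (w i)| * l) *
      Real.exp (|Real.log (μ j)| * l) * ‖c i j‖, ?_⟩
    rintro _ ⟨z, hz, rfl⟩
    have hz : z.re ∈ Icc 0 l := hz
    refine (norm_sum_le _ _).trans (Finset.sum_le_sum fun i _ => ?_)
    refine (norm_sum_le _ _).trans (Finset.sum_le_sum fun j _ => ?_)
    rw [norm_mul, norm_mul, Complex.norm_exp, Complex.norm_exp, Complex.re_ofReal_mul,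
      Complex.re_ofReal_mul, Complex.sub_re, Complex.ofReal_re]
    have e1 : Real.log (w i) * (l - z.re) ≤ |Real.log (w i)| * l :=
      mul_le_mul (le_abs_self _) (by linarith [hz.1]) (by linarith [hz.2]) (abs_nonneg _)
    have e2 : Real.log (μ j) * z.re ≤ |Real.log (μ j)| * l :=
      mul_le_mul (le_abs_self _) hz.2 hz.1 (abs_nonneg _)
    gcongr
  have hunit : ∀ x y : ℝ, ‖Complex.exp ((x : ℂ) * (y * Complex.I))‖ = 1 := fun x y => by
    rw [← mul_assoc, ← Complex.ofReal_mul, Complex.norm_exp_ofReal_mul_I]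
  have key := Complex.HadamardThreeLines.norm_le_interp_of_mem_verticalClosedStrip' (f := φ)
    (z := (a : ℂ)) (a := K) (b := K') hl (by
      change (a : ℂ).re ∈ Icc 0 l
      rwa [Complex.ofReal_re]) hd.diffContOnCl hB ?_ ?_
  · rw [Complex.ofReal_re, sub_zero, sub_zero] at key
    refine le_of_eq_of_le ?_ key
    rw [hφ]
    congr 1
    refine Finset.sum_congr rfl fun i _ => Finset.sum_congr rfl fun j _ => ?_
    rw [← Complex.ofReal_sub, hcast (hw i), hcast (hμ j), Complex.ofReal_mul]
  · intro z hz
    have hz : z.re = 0 := hz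
    refine le_of_eq_of_le ?_ (h0 (fun i => Complex.exp ((Real.log (w i) : ℂ) * ((-z.im : ℝ) * Complex.I)))
      (fun j => Complex.exp ((Real.log (μ j) : ℂ) * ((z.im : ℝ) * Complex.I)))
      (fun i => hunit _ _) fun j => hunit _ _)
    rw [hφ]
    congr 1
    refine Finset.sum_congr rfl fun i _ => Finset.sum_congr rfl fun j _ => ?_
    have e1 : (l : ℂ) - z = l + ((-z.im : ℝ) : ℂ) * Complex.I := by
      conv_lhs => rw [← Complex.re_add_im z, hz]
      push_cast
      ring
    have e2 : z = (z.im : ℂ) * Complex.I := by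
      conv_lhs => rw [← Complex.re_add_im z, hz]
      simp
    rw [e1, mul_add, Complex.exp_add, hcast (hw i)]
    conv_lhs => enter [1, 2, 1, 2]; rw [e2]
    ring
  · intro z hz
    have hz : z.re = l := hz
    refine le_of_eq_of_le ?_ (h1 (fun i => Complex.exp ((Real.log (w i) : ℂ) * ((-z.im : ℝ) * Complex.I)))
      (fun j => Complex.exp ((Real.log (μ j) : ℂ) * ((z.im : ℝ) * Complex.I)))
      (fun i => hunit _ _) fun j => hunit _ _)
    rw [hφ]
    congr 1
    refine Finset.sum_congr rfl fun i _ => Finset.sum_congr rfl fun j _ => ?_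
    have e1 : (l : ℂ) - z = ((-z.im : ℝ) : ℂ) * Complex.I := by
      conv_lhs => rw [← Complex.re_add_im z, hz]
      push_cast
      ring
    have e2 : z = l + (z.im : ℂ) * Complex.I := by
      conv_lhs => rw [← Complex.re_add_im z, hz]
    rw [e1]
    conv_lhs => enter [1, 2, 1, 2]; rw [e2]
    rw [mul_add, Complex.exp_add, hcast (hμ j)]
    ring

/-- Hölder's inequality: multiplication by the power `a` of a diagonal operator with
eigenvalues `μ` and trace at most `Λ`. -/
theorem SchattenBound.mul_diagonal (h : SchattenBound b K X) {ι : Type*}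
    (β : HilbertBasis ι ℂ H) {μ : ι → ℝ} (hμ : ∀ j, 0 < μ j) {Λ : ℝ} (hΛ : 0 < Λ)
    (hsum : ∀ J : Finset ι, ∑ j ∈ J, μ j ≤ Λ) {a : ℝ} (ha : 0 < a) (hab : a + b ≤ 1)
    {E : H →L[ℂ] H} (hE : ∀ j, E (β j) = ((μ j ^ a : ℝ) : ℂ) • β j) :
    SchattenBound (a + b) (K * Λ ^ a) (X * E) := by
  classical
  intro m e f he hf w hw hw1
  have hK := h.nonneg
  set l : ℝ := 1 - b with hl
  have hl0 : 0 < l := by linarith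
  have hβ : ∀ J : Finset ι, IsBessel J β := isBessel_of_orthonormal β.orthonormal
  have key : ∀ J : Finset ι, ‖∑ i, ∑ j ∈ J, ((w i ^ (l - a) * μ j ^ a : ℝ) : ℂ) *
      (⟪f i, X (β j)⟫_ℂ * ⟪β j, e i⟫_ℂ)‖ ≤ K ^ (1 - a / l) * (K * Λ ^ l) ^ (a / l) := by
    intro J
    refine norm_sum_rpow_le Finset.univ J hw hμ _ hl0 ⟨ha.le, by linarith⟩ ?_ ?_
    -- On `Re z = 0` the sum over `j` and the phases `τ` go into the right vectors, which stay
    -- Bessel.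
    · intro θ τ hθ hτ
      have h1 := h m (fun i => ∑ j ∈ J, ⟪β j, e i⟫_ℂ • τ j • β j)
        (fun i => (starRingEnd ℂ) (θ i) • f i)
        (he.comp (hβ J) ((hβ J).smul fun j => (hτ j).le))
        (hf.smul fun i => by rw [RCLike.norm_conj]; exact (hθ i).le) w hw hw1
      refine le_of_eq_of_le ?_ h1
      congr 1
      refine Finset.sum_congr rfl fun i _ => ?_
      rw [map_sum, inner_sum, Finset.mul_sum]
      refine Finset.sum_congr rfl fun j _ => ?_
      rw [map_smul, map_smul, inner_smul_left, inner_smul_right, inner_smul_right,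
        RCLike.conj_conj]
      ring
    -- On `Re z = l` the roles are exchanged: `j` indexes the families, and the weights are the
    -- normalized eigenvalues `μ j / Λ`, whence the factor `Λ ^ l`.
    · intro θ τ hθ hτ
      have h1 := h.finset J (e := fun j => τ j • β j)
        (f := fun j => ∑ i, ⟪e i, β j⟫_ℂ • (starRingEnd ℂ) (θ i) • f i)
        (w := fun j => μ j / Λ) ((hβ J).smul fun j => (hτ j).le)
        ((hβ J).comp he (hf.smul fun i => by rw [RCLike.norm_conj]; exact (hθ i).le))
        (fun j _ => div_pos (hμ j) hΛ) (by
          rw [← Finset.sum_div, div_le_one hΛ]; exact hsum J)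
      have hΛl : 0 < Λ ^ l := Real.rpow_pos_of_pos hΛ l
      have h2 : ∑ i, ∑ j ∈ J, ((μ j ^ l : ℝ) : ℂ) *
          (θ i * τ j * (⟪f i, X (β j)⟫_ℂ * ⟪β j, e i⟫_ℂ))
          = ((Λ ^ l : ℝ) : ℂ) * ∑ j ∈ J, (((μ j / Λ) ^ (1 - b) : ℝ) : ℂ) *
            ⟪∑ i, ⟪e i, β j⟫_ℂ • (starRingEnd ℂ) (θ i) • f i, X (τ j • β j)⟫_ℂ := by
        rw [Finset.sum_comm, Finset.mul_sum]
        refine Finset.sum_congr rfl fun j _ => ?_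
        rw [sum_inner, ← mul_assoc, ← Complex.ofReal_mul, Real.div_rpow (hμ j).le hΛ.le,
          mul_div_cancel₀ _ hΛl.ne', Finset.mul_sum]
        refine Finset.sum_congr rfl fun i _ => ?_
        rw [inner_smul_left, inner_smul_left, map_smul, inner_smul_right, RCLike.conj_conj,
          inner_conj_symm]
        ring
      rw [h2, norm_mul, Complex.norm_real, Real.norm_of_nonneg hΛl.le, mul_comm K]
      gcongr
  have hval : K ^ (1 - a / l) * (K * Λ ^ l) ^ (a / l) = K * Λ ^ a := by
    have hal : a / l ≤ 1 := (div_le_one hl0).2 (by linarith)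
    rw [Real.mul_rpow hK (Real.rpow_nonneg hΛ.le l), ← Real.rpow_mul hΛ.le, mul_div_cancel₀ _ hl0.ne',
      ← mul_assoc, ← Real.rpow_add_of_nonneg hK (sub_nonneg.2 hal) (by positivity), sub_add_cancel,
      Real.rpow_one]
  rw [hval] at key
  have hlim : Tendsto (fun J : Finset ι => ∑ i, ((w i ^ (l - a) : ℝ) : ℂ) *
      ⟪f i, (X * E) (∑ j ∈ J, β.repr (e i) j • β j)⟫_ℂ) atTop
      (𝓝 (∑ i, ((w i ^ (l - a) : ℝ) : ℂ) * ⟪f i, (X * E) (e i)⟫_ℂ)) := by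
    refine tendsto_finsetSum _ fun i _ => Tendsto.const_mul _ ?_
    have : Continuous fun x => ⟪f i, (X * E) x⟫_ℂ := by fun_prop
    exact (this.tendsto _).comp (β.hasSum_repr (e i))
  rw [show 1 - (a + b) = l - a by rw [hl]; ring]
  refine le_of_tendsto hlim.norm (Eventually.of_forall fun J => ?_)
  refine le_of_eq_of_le ?_ (key J)
  congr 1
  refine Finset.sum_congr rfl fun i _ => ?_
  rw [map_sum, inner_sum, Finset.mul_sum]
  refine Finset.sum_congr rfl fun j _ => ?_
  rw [map_smul, mul_apply_eq_comp, hE, map_smul, inner_smul_right, inner_smul_right,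
    HilbertBasis.repr_apply_apply, Complex.ofReal_mul]
  ring

end SchattenBound

end HeatSchatten

end

open scoped ENNReal Topology InnerProductSpace

noncomputable section

namespace HeatSchatten

open Filter Set MeasureTheory

/-! ### Compactness of operators with a Schatten bound -/

section Compact

variable {H : Type*} [NormedAddCommGroup H] [InnerProductSpace ℂ H]
  {b K : ℝ} {X : H →L[ℂ] H}

/-- The phases of the inner products are absorbed into `f`; where an inner product vanishes the
quotient is `0`. -/
theorem SchattenBound.sum_norm_le {ι : Type*} (h : SchattenBound b K X) (s : Finset ι) {e f : ι → H}
    (he : IsBessel s e) (hf : IsBessel s f) {w : ι → ℝ} (hw : ∀ i ∈ s, 0 < w i)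
    (hw1 : ∑ i ∈ s, w i ≤ 1) : ∑ i ∈ s, w i ^ (1 - b) * ‖⟪f i, X (e i)⟫_ℂ‖ ≤ K := by
  have h1 := h.finset s he (hf.smul (c := fun i => ⟪f i, X (e i)⟫_ℂ / ‖⟪f i, X (e i)⟫_ℂ‖)
    fun i => by
      rw [norm_div, Complex.norm_real, norm_norm]
      exact div_self_le_one _) hw hw1
  have h2 : ∑ i ∈ s, ((w i ^ (1 - b) : ℝ) : ℂ) *
      ⟪(⟪f i, X (e i)⟫_ℂ / (‖⟪f i, X (e i)⟫_ℂ‖ : ℂ)) • f i, X (e i)⟫_ℂ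
      = ((∑ i ∈ s, w i ^ (1 - b) * ‖⟪f i, X (e i)⟫_ℂ‖ : ℝ) : ℂ) := by
    rw [Complex.ofReal_sum]
    refine Finset.sum_congr rfl fun i _ => ?_
    set z := ⟪f i, X (e i)⟫_ℂ
    rw [Complex.ofReal_mul, inner_smul_left, map_div₀, Complex.conj_ofReal, div_mul_eq_mul_div,
      mul_comm ((starRingEnd ℂ) z), Complex.mul_conj, Complex.normSq_eq_norm_sq]
    congr 1
    rcases eq_or_ne ‖z‖ 0 with h | h
    · rw [h]; simp
    · have : (‖z‖ : ℂ) ≠ 0 := by exact_mod_cast h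
      push_cast
      field_simp
      rfl
  rw [h2, Complex.norm_real] at h1
  exact (le_abs_self _).trans h1

theorem isCompactOperator_starProjection (U : Submodule ℂ H) [FiniteDimensional ℂ U] :
    IsCompactOperator U.starProjection := by
  have : ProperSpace U := FiniteDimensional.proper ℂ U
  have h1 : IsCompactOperator U.subtypeL := isCompactOperator_of_locallyCompactSpace_rng U.subtypeL
  exact h1.comp_clm U.orthogonalProjectionOnto

/-- Operators in a Schatten ideal are compact. -/
theorem SchattenBound.isCompactOperator [CompleteSpace H] (h : SchattenBound b K X) (hb : 0 < b) :
    IsCompactOperator X := by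
  suffices hX : X ∈ closure {Y : H →L[ℂ] H | IsCompactOperator Y} by
    rwa [isClosed_setOfPred_isCompactOperator.closure_eq] at hX
  rw [Metric.mem_closure_iff]
  intro ε' hε'
  set ε := ε' / 2 with hε2
  have hε : 0 < ε := by positivity
  -- Constant weights `1/m` bound the length of orthonormal systems whose matrix coefficients all
  -- exceed `ε`. For a pair of maximal length, with spans `U` and `V`, the part of `X` from `Uᗮ` to
  -- `Vᗮ` has norm at most `ε`, and the rest of `X` has finite rank.
  set S : ℕ → Prop := fun m => ∃ e f : Fin m → H, Orthonormal ℂ e ∧ Orthonormal ℂ f ∧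
    ∀ i, ε < ‖⟪f i, X (e i)⟫_ℂ‖ with hS
  have hbound : ∀ m : ℕ, 0 < m → S m → (m : ℝ) ^ b * ε ≤ K := by
    rintro m hm ⟨e, f, he, hf, hef⟩
    have hm' : (0 : ℝ) < m := Nat.cast_pos.2 hm
    have h1 := h.sum_norm_le Finset.univ (isBessel_of_orthonormal he _)
      (isBessel_of_orthonormal hf _) (w := fun _ => (m : ℝ)⁻¹) (fun i _ => by positivity) (by
        rw [Finset.sum_const, Finset.card_univ, Fintype.card_fin, nsmul_eq_mul,
          mul_inv_cancel₀ hm'.ne'])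
    refine le_trans ?_ h1
    calc (m : ℝ) ^ b * ε = ∑ _i : Fin m, ((m : ℝ)⁻¹) ^ (1 - b) * ε := by
          rw [Finset.sum_const, Finset.card_univ, Fintype.card_fin, nsmul_eq_mul, ← mul_assoc,
            Real.inv_rpow hm'.le, ← Real.rpow_neg hm'.le, ← Real.rpow_one_add' hm'.le]
          · ring_nf
          · rw [neg_sub, add_sub_cancel]; exact hb.ne'
      _ ≤ _ := Finset.sum_le_sum fun i _ => by
          have := (hef i).le
          gcongr
  have hmax : ∃ m, S m ∧ ¬ S (m + 1) := by
    by_contra! hcon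
    have hall : ∀ m, S m := by
      intro m
      induction m with
      | zero => exact ⟨fun _ => 0, fun _ => 0, ⟨fun i => i.elim0, fun i => i.elim0⟩,
          ⟨fun i => i.elim0, fun i => i.elim0⟩, fun i => i.elim0⟩
      | succ m ih => exact hcon m ih
    have ht := ((tendsto_rpow_atTop hb).comp tendsto_natCast_atTop_atTop).atTop_mul_const hε
    obtain ⟨m, hm, hm0⟩ := ((ht.eventually_gt_atTop K).and (eventually_gt_atTop 0)).exists
    exact absurd (hbound m hm0 (hall m)) (not_le.2 hm)
  obtain ⟨m, ⟨e, f, he, hf, hef⟩, hm⟩ := hmax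
  set U := Submodule.span ℂ (range e) with hU
  set V := Submodule.span ℂ (range f) with hV
  have : FiniteDimensional ℂ U := FiniteDimensional.span_of_finite ℂ (finite_range e)
  have : FiniteDimensional ℂ V := FiniteDimensional.span_of_finite ℂ (finite_range f)
  have hsmall : ∀ y ∈ Uᗮ, ∀ z ∈ Vᗮ, ‖⟪z, X y⟫_ℂ‖ ≤ ε * (‖z‖ * ‖y‖) := by
    intro y hy z hz
    rcases eq_or_ne y 0 with rfl | hy0
    · simp
    rcases eq_or_ne z 0 with rfl | hz0
    · simp
    by_contra! hlt
    apply hm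
    have hy1 : 0 < ‖y‖ := norm_pos_iff.2 hy0
    have hz1 : 0 < ‖z‖ := norm_pos_iff.2 hz0
    refine ⟨Matrix.vecCons ((‖y‖⁻¹ : ℂ) • y) e, Matrix.vecCons ((‖z‖⁻¹ : ℂ) • z) f,
      orthonormal_vecCons_iff.2 ⟨norm_smul_inv_norm hy0, fun i => ?_, he⟩,
      orthonormal_vecCons_iff.2 ⟨norm_smul_inv_norm hz0, fun i => ?_, hf⟩, fun i => ?_⟩
    · rw [inner_smul_left, Submodule.inner_left_of_mem_orthogonal
        (Submodule.subset_span (mem_range_self i)) hy, mul_zero]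
    · rw [inner_smul_left, Submodule.inner_left_of_mem_orthogonal
        (Submodule.subset_span (mem_range_self i)) hz, mul_zero]
    · refine Fin.cases ?_ hef i
      simp only [Matrix.cons_val_zero, map_smul, inner_smul_left, inner_smul_right, norm_mul,
        RCLike.norm_conj, norm_inv, Complex.norm_real, norm_norm]
      rw [← mul_assoc, ← mul_inv, ← div_eq_inv_mul, lt_div_iff₀ (by positivity), mul_comm ‖y‖]
      exact hlt
  have hcomp : IsCompactOperator (X * U.starProjection +
      V.starProjection * (X * (1 - U.starProjection)) : H →L[ℂ] H) :=
    ((isCompactOperator_starProjection U).clm_comp X).add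
      ((isCompactOperator_starProjection V).comp_clm (X * (1 - U.starProjection)))
  refine ⟨_, hcomp, ?_⟩
  rw [dist_eq_norm]
  refine lt_of_le_of_lt (ContinuousLinearMap.opNorm_le_bound _ hε.le fun x => ?_)
    (show ε < ε' by rw [hε2]; linarith)
  set y := x - U.starProjection x with hy
  set z := X y - V.starProjection (X y) with hz
  have hyU : y ∈ Uᗮ := U.sub_starProjection_mem_orthogonal x
  have hzV : z ∈ Vᗮ := V.sub_starProjection_mem_orthogonal (X y)
  have e1 : (X - (X * U.starProjection + V.starProjection * (X * (1 - U.starProjection)))) x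
      = z := by
    simp only [sub_apply, add_apply, mul_apply_eq_comp, one_apply_eq_self, ← hy, hz]
    rw [hy, map_sub]
    abel
  have hyx : ‖y‖ ≤ ‖x‖ := by
    have := Submodule.norm_starProjection_apply_le Uᗮ x
    rwa [Submodule.starProjection_orthogonal_val] at this
  have hzz : ⟪z, X y⟫_ℂ = ⟪z, z⟫_ℂ := by
    conv_rhs => rw [hz, ← hz, inner_sub_right]
    rw [Submodule.inner_left_of_mem_orthogonal (V.starProjection_apply_mem (X y)) hzV, sub_zero]
  have h3 := hsmall y hyU z hzV
  rw [hzz, norm_inner_self_eq_norm_sq] at h3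
  rw [e1]
  rcases eq_or_ne ‖z‖ 0 with h0 | h0
  · rw [h0]; positivity
  · have h4 : 0 < ‖z‖ := lt_of_le_of_ne (norm_nonneg _) (Ne.symm h0)
    have : ‖z‖ ≤ ε * ‖y‖ := by
      refine le_of_mul_le_mul_left ?_ h4
      calc ‖z‖ * ‖z‖ = ‖z‖ ^ 2 := (pow_two _).symm
        _ ≤ _ := h3
        _ = _ := by ring
    exact this.trans (by gcongr)

end Compact

/-! ### Diagonalization of compact self-adjoint operators -/

section Eigenbasis

universe u

variable {H : Type u} [NormedAddCommGroup H] [InnerProductSpace ℂ H] [CompleteSpace H]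

/-- A compact self-adjoint operator has a Hilbert basis of eigenvectors. -/
theorem exists_eigenbasis {T : H →L[ℂ] H} (hc : IsCompactOperator T) (hs : IsSelfAdjoint T) :
    ∃ (ι : Type u) (β : HilbertBasis ι ℂ H) (μ : ι → ℝ), ∀ i, T (β i) = (μ i : ℂ) • β i := by
  have hsym : (T : H →ₗ[ℂ] H).IsSymmetric := hs.isSymmetric
  let V : ℂ → Submodule ℂ H := fun l => Module.End.eigenspace (T : H →ₗ[ℂ] H) l
  have hVmem : ∀ l x, x ∈ V l ↔ T x = l • x := fun l x => Module.End.mem_eigenspace_iff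
  have hcl : ∀ l, IsClosed (V l : Set H) := fun l => by
    have : (V l : Set H) = {x | T x = l • x} := Set.ext fun x => hVmem l x
    rw [this]
    exact isClosed_eq (by fun_prop) (by fun_prop)
  have hcomp : ∀ l, CompleteSpace (V l) := fun l => (hcl l).completeSpace_coe
  -- Bases of all the eigenspaces are combined, including the kernel, which may be
  -- infinite-dimensional.
  choose w β hβ using fun l => exists_hilbertBasis ℂ (V l)
  let v : (Σ l, w l) → H := fun p => (β p.1 p.2 : V p.1)
  have hv : Orthonormal ℂ v :=
    hsym.orthogonalFamily_eigenspaces.orthonormal_sigma_orthonormal fun l => (β l).orthonormal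
  have htop : (Submodule.span ℂ (range v))ᗮ = ⊥ := by
    rw [Submodule.eq_bot_iff]
    intro x hx
    have hx' : x ∈ (⨆ l, V l)ᗮ := by
      rw [← Submodule.iInf_orthogonal, Submodule.mem_iInf]
      intro l
      rw [Submodule.mem_orthogonal]
      intro y hy
      have h1 := ((β l).hasSum_repr ⟨y, hy⟩).mapL ((innerSL ℂ x) ∘L (V l).subtypeL)
      have h2 : ∀ i, ((innerSL ℂ x) ∘L (V l).subtypeL) ((β l).repr ⟨y, hy⟩ i • β l i) = 0 := by
        intro i
        rw [map_smul, ContinuousLinearMap.comp_apply, innerSL_apply_apply]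
        have : ⟪x, v ⟨l, i⟩⟫_ℂ = 0 :=
          Submodule.inner_left_of_mem_orthogonal (Submodule.subset_span (mem_range_self _)) hx
        exact (congrArg _ this).trans (smul_zero _)
      simp only [h2] at h1
      have h3 : ⟪x, y⟫_ℂ = 0 := (hasSum_zero.unique h1).symm
      rw [inner_eq_zero_symm]
      exact h3
    rw [ContinuousLinearMap.orthogonalComplement_iSup_eigenspaces_eq_bot hc hsym] at hx'
    exact (Submodule.mem_bot ℂ).1 hx'
  refine ⟨_, HilbertBasis.mkOfOrthogonalEqBot hv htop, fun p => p.1.re, fun p => ?_⟩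
  rw [HilbertBasis.coe_mkOfOrthogonalEqBot]
  have hp : T (v p) = p.1 • v p := (hVmem _ _).1 (β p.1 p.2).2
  have hne : v p ≠ 0 := hv.ne_zero p
  have hev : Module.End.HasEigenvalue (T : H →ₗ[ℂ] H) p.1 :=
    Module.End.hasEigenvalue_of_hasEigenvector ⟨(β p.1 p.2).2, hne⟩
  have hconj := hsym.conj_eigenvalue_eq_self hev
  rw [Complex.conj_eq_iff_re.1 hconj]
  exact hp

/-- True for constants and the identity, stable under sums, products and limits; Stone–Weierstrass
does the rest. -/
theorem cfc_apply_of_eigenvector {T : H →L[ℂ] H} (hs : IsSelfAdjoint T) {x : H} {l : ℝ}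
    (hx : T x = (l : ℂ) • x) (hx0 : x ≠ 0) {f : ℝ → ℝ} (hf : ContinuousOn f (spectrum ℝ T)) :
    cfc f T x = ((f l : ℝ) : ℂ) • x := by
  have hl : l ∈ spectrum ℝ T := by
    rw [spectrum.mem_iff]
    rintro hu
    obtain ⟨N, hN⟩ := hu.exists_left_inv
    have h1 := congrArg (fun A : H →L[ℂ] H => A x) hN
    simp only [mul_apply_eq_comp, one_apply_eq_self, sub_apply, hx] at h1
    rw [Algebra.algebraMap_eq_smul_one, smul_apply, one_apply_eq_self, ← Complex.coe_smul, sub_self,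
      map_zero] at h1
    exact hx0 h1.symm
  have key : ∀ g : C(spectrum ℝ T, ℝ), cfcHom hs g x = ((g ⟨l, hl⟩ : ℝ) : ℂ) • x := by
    intro g
    induction g using ContinuousMap.induction_on_of_compact with
    | const r =>
      have : ContinuousMap.const (spectrum ℝ T) r = algebraMap ℝ C(spectrum ℝ T, ℝ) r := rfl
      rw [this, AlgHomClass.commutes, Algebra.algebraMap_eq_smul_one, smul_apply, one_apply_eq_self,
        ← Complex.coe_smul]
      rfl
    | id => rw [cfcHom_id hs, hx]; rfl
    | star_id => rw [map_star, cfcHom_id hs, hs.star_eq, hx]; rfl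
    | add f g hf hg =>
      rw [map_add, add_apply, hf, hg, ← add_smul, ← Complex.ofReal_add]; rfl
    | mul f g hf hg =>
      rw [map_mul, mul_apply_eq_comp, hg, map_smul, hf, smul_smul, ← Complex.ofReal_mul, mul_comm]
      rfl
    | frequently f h =>
      refine h.mem_of_closed (isClosed_eq ?_ ?_)
      · exact (ContinuousLinearMap.apply ℂ H x).continuous.comp (cfcHom_continuous hs)
      · have : Continuous fun g : C(spectrum ℝ T, ℝ) => g ⟨l, hl⟩ :=
          continuous_eval_const _
        fun_prop
  rw [cfc_apply f T hs hf, key]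
  rfl

end Eigenbasis

/-! ### The trace and the Schatten norm in terms of dual bounds -/

section Trace

universe u

variable {H : Type u} [NormedAddCommGroup H] [InnerProductSpace ℂ H] [CompleteSpace H]

set_option linter.unusedSectionVars false in
theorem tsum_ofReal_norm_inner_sq {ι : Type*} (β : HilbertBasis ι ℂ H) (x : H) :
    ∑' i, ENNReal.ofReal (‖⟪β i, x⟫_ℂ‖ ^ 2) = ENNReal.ofReal (‖x‖ ^ 2) := by
  have h1 : HasSum (fun i => ‖⟪β i, x⟫_ℂ‖ ^ 2) (‖x‖ ^ 2) := by
    have h2 := (β.hasSum_inner_mul_inner x x).mapL Complex.reCLM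
    have h3 : ∀ i, Complex.reCLM (⟪x, β i⟫_ℂ * ⟪β i, x⟫_ℂ) = ‖⟪β i, x⟫_ℂ‖ ^ 2 := fun i => by
      rw [← inner_conj_symm x, mul_comm, Complex.mul_conj, Complex.normSq_eq_norm_sq,
        Complex.reCLM_apply, Complex.ofReal_re]
    have h4 : Complex.reCLM ⟪x, x⟫_ℂ = ‖x‖ ^ 2 := by
      rw [inner_self_eq_norm_sq_to_K, Complex.reCLM_apply]
      norm_cast
    simpa only [h3, h4] using h2
  rw [← ENNReal.ofReal_tsum_of_nonneg (fun i => sq_nonneg _) h1.summable, h1.tsum_eq]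

/-- Parseval on both sides gives the same double sum of squared matrix coefficients. With `C = √A`
this is basis independence of the trace. -/
theorem tsum_ofReal_norm_apply_sq_comm {ι κ : Type*} (β : HilbertBasis ι ℂ H)
    (β' : HilbertBasis κ ℂ H) {C : H →L[ℂ] H} (hC : IsSelfAdjoint C) :
    ∑' i, ENNReal.ofReal (‖C (β i)‖ ^ 2) = ∑' j, ENNReal.ofReal (‖C (β' j)‖ ^ 2) := by
  rw [tsum_congr fun i => (tsum_ofReal_norm_inner_sq β' (C (β i))).symm, ENNReal.tsum_comm]
  refine tsum_congr fun j => ?_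
  rw [← tsum_ofReal_norm_inner_sq β (C (β' j))]
  refine tsum_congr fun i => ?_
  rw [← ContinuousLinearMap.adjoint_inner_left, hC.adjoint_eq, norm_inner_symm]

theorem re_inner_apply_self {A : H →L[ℂ] H} (hA : 0 ≤ A) (x : H) :
    RCLike.re ⟪x, A x⟫_ℂ = ‖CFC.sqrt A x‖ ^ 2 := by
  rw [← inner_conj_symm, norm_sqrt_apply_sq hA, Complex.conj_ofReal, RCLike.re_to_complex,
    Complex.ofReal_re]

theorem isSelfAdjoint_sqrt (A : H →L[ℂ] H) : IsSelfAdjoint (CFC.sqrt A) :=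
  IsSelfAdjoint.of_nonneg (CFC.sqrt_nonneg A)

/-- The trace of a positive operator does not depend on the Hilbert basis. -/
theorem trace_eq_tsum {A : H →L[ℂ] H} (hA : 0 ≤ A) {ι : Type*} (β : HilbertBasis ι ℂ H) :
    trace A = ∑' i, ENNReal.ofReal (RCLike.re ⟪β i, A (β i)⟫_ℂ) := by
  obtain ⟨β', hβ'⟩ := (exists_hilbertBasis ℂ H).choose_spec
  rw [trace]
  simp only [re_inner_apply_self hA]
  rw [← tsum_ofReal_norm_apply_sq_comm β' β (isSelfAdjoint_sqrt A), hβ']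

theorem IsBessel.sum_norm_apply_sq_le {ι κ : Type*} {s : Finset ι} {e : ι → H} (he : IsBessel s e)
    (β : HilbertBasis κ ℂ H) {C : H →L[ℂ] H} (hC : IsSelfAdjoint C) :
    ENNReal.ofReal (∑ i ∈ s, ‖C (e i)‖ ^ 2) ≤ ∑' j, ENNReal.ofReal (‖C (β j)‖ ^ 2) := by
  rw [ENNReal.ofReal_sum_of_nonneg fun i _ => sq_nonneg _]
  rw [Finset.sum_congr rfl fun i _ => (tsum_ofReal_norm_inner_sq β (C (e i))).symm,
    ← Summable.tsum_finsetSum fun i _ => ENNReal.summable]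
  refine ENNReal.tsum_le_tsum fun j => ?_
  rw [← ENNReal.ofReal_sum_of_nonneg fun i _ => sq_nonneg _]
  refine ENNReal.ofReal_le_ofReal (le_trans (le_of_eq ?_) (he (C (β j))))
  refine Finset.sum_congr rfl fun i _ => ?_
  rw [← ContinuousLinearMap.adjoint_inner_left, hC.adjoint_eq, norm_inner_symm]

/-- For `b = 1` the weights disappear. Writing `⟨f, A e⟩ = ⟨√A f, √A e⟩`, the arithmetic–geometric
mean inequality reduces the claim to `∑ ‖√A e_i‖² ≤ tr A` for Bessel families. -/
theorem schattenBound_one_of_trace_le {A : H →L[ℂ] H} (hA : 0 ≤ A) {Λ : ℝ} (hΛ : 0 ≤ Λ)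
    (h : trace A ≤ ENNReal.ofReal Λ) : SchattenBound 1 Λ A := by
  obtain ⟨w, β, -⟩ := exists_hilbertBasis ℂ H
  have hC := isSelfAdjoint_sqrt A
  have key : ∀ {m : ℕ} {e : Fin m → H}, IsBessel Finset.univ e →
      ∑ i, ‖CFC.sqrt A (e i)‖ ^ 2 ≤ Λ := by
    intro m e he
    have h1 := he.sum_norm_apply_sq_le β hC
    simp only [← re_inner_apply_self hA (β _)] at h1
    rw [← trace_eq_tsum hA β] at h1
    exact (ENNReal.ofReal_le_ofReal_iff hΛ).1 (h1.trans h)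
  intro m e f he hf w hw hw1
  refine (norm_sum_le _ _).trans ?_
  calc _ ≤ ∑ i, (‖CFC.sqrt A (e i)‖ ^ 2 + ‖CFC.sqrt A (f i)‖ ^ 2) / 2 := by
        refine Finset.sum_le_sum fun i _ => ?_
        rw [sub_self, Real.rpow_zero, Complex.ofReal_one, one_mul, ← sqrt_mul_sqrt_apply hA,
          ← ContinuousLinearMap.adjoint_inner_left, hC.adjoint_eq]
        have := norm_inner_le_norm (𝕜 := ℂ) (CFC.sqrt A (f i)) (CFC.sqrt A (e i))
        nlinarith [sq_nonneg (‖CFC.sqrt A (f i)‖ - ‖CFC.sqrt A (e i)‖)]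
    _ ≤ Λ := by
        rw [← Finset.sum_div, Finset.sum_add_distrib]
        linarith [key he, key hf]

/-- The extremal test for duality: with an eigenbasis `β` of `A* A` and singular values `s_j = √(μ
j)`, take `e_j = β j`, `f_j = s_j⁻¹ A β_j` and `w_j = s_j^{1/u} / Z`, where `Z` is a finite sum of
the `s_j^{1/u}`. The tested sum is `Z^u`. -/
theorem SchattenBound.schattenNorm_le {u K : ℝ} {A : H →L[ℂ] H} (h : SchattenBound u K A)
    (hu : 0 < u) : schattenNorm u⁻¹ A ≤ ENNReal.ofReal K := by
  have hK := h.nonneg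
  set B : H →L[ℂ] H := star A * A with hB
  have hB0 : 0 ≤ B := star_mul_self_nonneg A
  have hBs : IsSelfAdjoint B := IsSelfAdjoint.of_nonneg hB0
  have hBc : IsCompactOperator B := (h.isCompactOperator hu).clm_comp (star A)
  obtain ⟨ι, β, μ, hμ⟩ := exists_eigenbasis hBc hBs
  have hnorm : ∀ i j, ⟪A (β i), A (β j)⟫_ℂ = (μ j : ℂ) * ⟪β i, β j⟫_ℂ := by
    intro i j
    rw [← ContinuousLinearMap.adjoint_inner_right, ← inner_smul_right, ← hμ j]
    rfl
  have hββ : ∀ i, ⟪β i, β i⟫_ℂ = 1 := fun i => by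
    rw [inner_self_eq_norm_sq_to_K, β.orthonormal.1 i]
    simp
  have hAsq : ∀ j, ‖A (β j)‖ ^ 2 = μ j := by
    intro j
    have h1 := hnorm j j
    rw [hββ, mul_one, inner_self_eq_norm_sq_to_K] at h1
    exact Complex.ofReal_injective ((Complex.ofReal_pow _ _).trans h1)
  have hμ0 : ∀ j, 0 ≤ μ j := fun j => hAsq j ▸ sq_nonneg _
  have hne : ∀ j, β j ≠ 0 := fun j => β.orthonormal.ne_zero j
  have habs : ∀ j, CFC.abs A (β j) = ((√(μ j) : ℝ) : ℂ) • β j := by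
    intro j
    rw [CFC.abs, ← hB, sqrt_eq_cfc_real hB0]
    exact cfc_apply_of_eigenvector hBs (hμ j) (hne j) Real.continuous_sqrt.continuousOn
  have hup : 0 < u⁻¹ := inv_pos.2 hu
  have hpow : ∀ j, (CFC.abs A ^ u⁻¹) (β j) = ((√(μ j) ^ u⁻¹ : ℝ) : ℂ) • β j := by
    intro j
    rw [CFC.rpow_eq_cfc_real (CFC.abs_nonneg A)]
    exact cfc_apply_of_eigenvector (IsSelfAdjoint.of_nonneg (CFC.abs_nonneg A)) (habs j) (hne j)
      (Real.continuous_rpow_const hup.le).continuousOn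
  have htr : trace (CFC.abs A ^ u⁻¹) = ∑' j, ENNReal.ofReal (√(μ j) ^ u⁻¹) := by
    rw [trace_eq_tsum (A := CFC.abs A ^ u⁻¹) CFC.rpow_nonneg β]
    refine tsum_congr fun j => ?_
    rw [hpow, inner_smul_right, hββ, mul_one, RCLike.re_to_complex, Complex.ofReal_re]
  -- Zero singular values are dropped, since the test vectors and weights require `s_j > 0`.
  have hsub : ∑' j, ENNReal.ofReal (√(μ j) ^ u⁻¹)
      = ∑' j : {j | 0 < μ j}, ENNReal.ofReal (√(μ j) ^ u⁻¹) := by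
    refine (tsum_subtype_eq_of_support_subset (f := fun j => ENNReal.ofReal (√(μ j) ^ u⁻¹))
      fun j hj => ?_).symm
    by_contra hj'
    apply hj
    have : μ j = 0 := le_antisymm (not_lt.1 hj') (hμ0 j)
    simp only
    rw [this, Real.sqrt_zero, Real.zero_rpow hup.ne', ENNReal.ofReal_zero]
  have hle : trace (CFC.abs A ^ u⁻¹) ≤ ENNReal.ofReal (K ^ u⁻¹) := by
    rw [htr, hsub, ENNReal.tsum_eq_iSup_sum]
    refine iSup_le fun J => ?_
    rw [← ENNReal.ofReal_sum_of_nonneg fun j _ => Real.rpow_nonneg (Real.sqrt_nonneg _) _]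
    refine ENNReal.ofReal_le_ofReal ?_
    set Z := ∑ j ∈ J, √(μ j) ^ u⁻¹ with hZ
    have hs : ∀ j : {j | 0 < μ j}, 0 < √(μ j) := fun j => Real.sqrt_pos.2 j.2
    have hsp : ∀ j : {j | 0 < μ j}, 0 < √(μ j) ^ u⁻¹ := fun j => Real.rpow_pos_of_pos (hs j) _
    have hZ0 : 0 ≤ Z := Finset.sum_nonneg fun j _ => (hsp j).le
    rcases hZ0.eq_or_lt with h0 | hZpos
    · rw [← h0]; exact Real.rpow_nonneg hK _
    have he : Orthonormal ℂ fun j : {j | 0 < μ j} => β j :=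
      β.orthonormal.comp _ Subtype.coe_injective
    have hf : Orthonormal ℂ fun j : {j | 0 < μ j} => (((√(μ j))⁻¹ : ℝ) : ℂ) • A (β j) := by
      classical
      rw [orthonormal_iff_ite]
      intro i j
      rw [inner_smul_left, inner_smul_right, hnorm, orthonormal_iff_ite.1 he i j, Complex.conj_ofReal]
      split_ifs with hij
      · subst hij
        have h1 := Real.mul_self_sqrt (hμ0 i)
        have h2 := (hs i).ne'
        rw [mul_one, ← Complex.ofReal_mul, ← Complex.ofReal_mul]
        conv_lhs => rw [← h1]
        norm_cast
        rw [Real.mul_self_sqrt (hμ0 i)]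
        field_simp
        rw [Real.sq_sqrt (hμ0 i)]
      · simp
    have h1 := h.sum_norm_le J (isBessel_of_orthonormal he J) (isBessel_of_orthonormal hf J)
      (w := fun j => √(μ j) ^ u⁻¹ / Z) (fun j _ => div_pos (hsp j) hZpos) (by
        rw [← Finset.sum_div, div_self hZpos.ne'])
    have h2 : ∀ j : {j | 0 < μ j}, (√(μ j) ^ u⁻¹ / Z) ^ (1 - u) *
        ‖⟪(((√(μ j))⁻¹ : ℝ) : ℂ) • A (β j), A (β j)⟫_ℂ‖ = √(μ j) ^ u⁻¹ * Z ^ (u - 1) := by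
      intro j
      have e1 : ‖⟪(((√(μ j))⁻¹ : ℝ) : ℂ) • A (β j), A (β j)⟫_ℂ‖ = √(μ j) := by
        rw [inner_smul_left, norm_mul, RCLike.norm_conj, Complex.norm_real,
          norm_inner_self_eq_norm_sq, hAsq, Real.norm_of_nonneg (inv_nonneg.2 (hs j).le)]
        rw [inv_mul_eq_div, Real.div_sqrt]
      rw [e1, Real.div_rpow (hsp j).le hZ0, ← Real.rpow_mul (hs j).le,
        show u⁻¹ * (1 - u) = u⁻¹ - 1 by field_simp, show u - 1 = -(1 - u) by ring,
        Real.rpow_neg hZ0, Real.rpow_sub_one (hs j).ne', div_mul_eq_mul_div,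
        div_mul_cancel₀ _ (hs j).ne', div_eq_mul_inv]
    simp only [h2] at h1
    rw [← Finset.sum_mul, ← hZ, ← Real.rpow_one_add' hZ0 (by rw [add_sub_cancel]; exact hu.ne'),
      add_sub_cancel] at h1
    calc Z = (Z ^ u) ^ u⁻¹ := by rw [← Real.rpow_mul hZ0, mul_inv_cancel₀ hu.ne', Real.rpow_one]
      _ ≤ K ^ u⁻¹ := by gcongr
  calc schattenNorm u⁻¹ A ≤ ENNReal.ofReal (K ^ u⁻¹) ^ (u⁻¹)⁻¹ := by
        rw [schattenNorm]
        gcongr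
    _ = ENNReal.ofReal K := by
        rw [ENNReal.ofReal_rpow_of_nonneg (Real.rpow_nonneg hK _) (inv_nonneg.2 hup.le),
          ← Real.rpow_mul hK, mul_inv_cancel₀ hup.ne', Real.rpow_one]

end Trace

end HeatSchatten

end

open scoped ENNReal Topology InnerProductSpace

noncomputable section

namespace HeatSchatten

open Filter Set MeasureTheory


/-! ### Beta integrals and the sum of `xⁿ / Γ(n/2 + 1)` -/

section Scalar

theorem setIntegral_beta {a b τ : ℝ} (ha : 0 < a) (hb : 0 < b) (hτ : 0 < τ) :
    ∫ s in Ioo 0 τ, (τ - s) ^ (a - 1) * s ^ (b - 1) =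
      τ ^ (a + b - 1) * (Real.Gamma a * Real.Gamma b / Real.Gamma (a + b)) := by
  have h := Complex.betaIntegral_scaled b a hτ
  rw [Complex.betaIntegral_eq_Gamma_mul_div _ _ (by simpa using hb) (by simpa using ha),
    intervalIntegral.integral_of_le hτ.le, integral_Ioc_eq_integral_Ioo] at h
  have h2 : ((∫ s in Ioo 0 τ, (τ - s) ^ (a - 1) * s ^ (b - 1) : ℝ) : ℂ) =
      ∫ s in Ioo 0 τ, (s : ℂ) ^ ((b : ℂ) - 1) * ((τ : ℂ) - s) ^ ((a : ℂ) - 1) := by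
    rw [← integral_complex_ofReal]
    refine setIntegral_congr_fun measurableSet_Ioo fun s hs => ?_
    rw [Complex.ofReal_mul, Complex.ofReal_cpow hs.1.le, Complex.ofReal_cpow (sub_nonneg.2 hs.2.le),
      mul_comm]
    push_cast
    rfl
  apply Complex.ofReal_injective
  rw [h2, h]
  push_cast
  rw [Complex.ofReal_cpow hτ.le]
  simp only [← Complex.Gamma_ofReal]
  push_cast
  rw [add_comm (b : ℂ), mul_comm (Complex.Gamma b)]

/-- A nonintegrable function would have integral `0` by convention, but the beta integral is
positive. -/
theorem integrableOn_beta {a b τ : ℝ} (ha : 0 < a) (hb : 0 < b) (hτ : 0 < τ) :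
    IntegrableOn (fun s => (τ - s) ^ (a - 1) * s ^ (b - 1)) (Ioo 0 τ) := by
  by_contra h
  have h1 := setIntegral_beta ha hb hτ
  rw [integral_undef h] at h1
  have := Real.Gamma_pos_of_pos ha
  have := Real.Gamma_pos_of_pos hb
  have := Real.Gamma_pos_of_pos (add_pos ha hb)
  have := Real.rpow_pos_of_pos hτ (a + b - 1)
  exact (by positivity : τ ^ (a + b - 1) * (Real.Gamma a * Real.Gamma b / Real.Gamma (a + b)) ≠ 0)
    h1.symm

/-- Needed for the odd terms. The base case is `√π ≥ 1`, and the functional equations multiply the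
sides by `k + 1` and by `k + 3/2`. -/
theorem factorial_le_two_mul_Gamma (k : ℕ) : (k.factorial : ℝ) ≤ 2 * Real.Gamma (k + 3 / 2) := by
  induction k with
  | zero =>
    have h1 : Real.Gamma (3 / 2) = 1 / 2 * √Real.pi := by
      rw [← Real.Gamma_one_half_eq, ← Real.Gamma_add_one (by norm_num)]
      norm_num
    have h2 : 1 ≤ √Real.pi := Real.one_le_sqrt.2 (by linarith [Real.pi_gt_three])
    rw [Nat.factorial_zero, Nat.cast_zero, zero_add, h1, Nat.cast_one]
    linarith
  | succ k ih =>
    have h1 : ((k + 1 : ℕ) : ℝ) + 3 / 2 = (k + 3 / 2) + 1 := by push_cast; ring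
    have h0 : (0 : ℝ) < k + 3 / 2 := by positivity
    rw [h1, Real.Gamma_add_one h0.ne', Nat.factorial_succ]
    push_cast
    have := Real.Gamma_pos_of_pos h0
    calc ((k : ℝ) + 1) * k.factorial ≤ (k + 3 / 2) * (2 * Real.Gamma (k + 3 / 2)) := by
          gcongr; norm_num
      _ = _ := by ring

/-- A summable majorant of `x ^ n / Γ (n / 2 + 1)`. -/
def gammaMajorant (x : ℝ) (n : ℕ) : ℝ := (if Even n then 1 else 2 * x) * ((x ^ 2) ^ (n / 2) / (n / 2).factorial)

theorem pow_div_Gamma_le {x : ℝ} (hx : 0 ≤ x) (n : ℕ) :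
    x ^ n / Real.Gamma (n / 2 + 1) ≤ gammaMajorant x n := by
  rcases Nat.even_or_odd' n with ⟨k, rfl | rfl⟩
  · rw [gammaMajorant, if_pos (even_two_mul k), Nat.mul_div_cancel_left k two_pos, one_mul, ← pow_mul,
      Nat.cast_mul, Nat.cast_two, mul_div_cancel_left₀ _ two_ne_zero, Real.Gamma_nat_eq_factorial]
  · have h1 : ((2 * k + 1 : ℕ) : ℝ) / 2 + 1 = k + 3 / 2 := by push_cast; ring
    have h2 : (2 * k + 1) / 2 = k := by omega
    have h3 := factorial_le_two_mul_Gamma k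
    have h4 : (0 : ℝ) < k.factorial := Nat.cast_pos.2 k.factorial_pos
    rw [gammaMajorant, if_neg (Nat.not_even_two_mul_add_one k), h1, h2, pow_succ, pow_mul]
    calc (x ^ 2) ^ k * x / Real.Gamma (k + 3 / 2) ≤ (x ^ 2) ^ k * x / (k.factorial / 2) := by
          gcongr; linarith
      _ = _ := by field_simp

theorem hasSum_gammaMajorant (x : ℝ) :
    HasSum (gammaMajorant x) ((1 + 2 * x) * Real.exp (x ^ 2)) := by
  have h := NormedSpace.expSeries_div_hasSum_exp (x ^ 2)
  rw [← Real.exp_eq_exp_ℝ] at h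
  rw [add_mul, one_mul]
  refine HasSum.even_add_odd ?_ ?_
  · refine h.congr_fun fun k => ?_
    rw [gammaMajorant, if_pos (even_two_mul k), Nat.mul_div_cancel_left k two_pos, one_mul]
  · refine (h.mul_left (2 * x)).congr_fun fun k => ?_
    rw [gammaMajorant, if_neg (Nat.not_even_two_mul_add_one k), show (2 * k + 1) / 2 = k by omega]

end Scalar

end HeatSchatten

end

open scoped ENNReal Topology InnerProductSpace

noncomputable section

namespace HeatSchatten

open Filter Set MeasureTheory


/-! ### Schatten bounds for convolutions with power singularities -/

section WeightedVolterra

variable {H : Type*} [NormedAddCommGroup H] [InnerProductSpace ℂ H] {b K : ℝ} {X : H →L[ℂ] H}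

theorem isBessel_unit {x : H} (hx : ‖x‖ = 1) : IsBessel Finset.univ fun _ : Fin 1 => x := by
  intro y
  rw [Fin.sum_univ_one]
  gcongr
  exact (norm_inner_le_norm x y).trans_eq (by rw [hx, one_mul])

/-- Testing with a single pair of unit vectors and weight `1` makes the exponent irrelevant. -/
theorem SchattenBound.norm_le (h : SchattenBound b K X) : ‖X‖ ≤ K := by
  refine ContinuousLinearMap.opNorm_le_of_unit_norm h.nonneg fun x hx => ?_
  rcases eq_or_ne (X x) 0 with h0 | h0
  · rw [h0, norm_zero]
    exact h.nonneg
  have h1 := h 1 _ _ (isBessel_unit hx) (isBessel_unit (norm_smul_inv_norm (𝕜 := ℂ) h0))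
    (fun _ => 1) (fun _ => one_pos) (by simp)
  rw [Fin.sum_univ_one, Real.one_rpow, Complex.ofReal_one, one_mul, inner_smul_left, norm_mul,
    norm_inner_self_eq_norm_sq, RCLike.norm_conj, norm_inv, RCLike.norm_ofReal, abs_norm] at h1
  rwa [pow_two, inv_mul_cancel_left₀ (norm_ne_zero_iff.2 h0)] at h1

variable [CompleteSpace H] {f g : ℝ → H →L[ℂ] H} {a c k τ : ℝ}

theorem SchattenBound.integrableOn_mul (hf : MeasPos f) (hg : MeasPos g) (ha : 0 < a) (hc : 0 < c)
    (hτ : 0 < τ)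
    (h : ∀ s ∈ Ioo 0 τ, SchattenBound b (k * ((τ - s) ^ (a - 1) * s ^ (c - 1))) (f (τ - s) * g s)) :
    IntegrableOn (fun s => f (τ - s) * g s) (Ioo 0 τ) :=
  hf.integrableOn_mul hg ((integrableOn_beta ha hc hτ).const_mul k) fun s hs => (h s hs).norm_le

theorem SchattenBound.volterra (hf : MeasPos f) (hg : MeasPos g) (ha : 0 < a) (hc : 0 < c)
    (hτ : 0 < τ)
    (h : ∀ s ∈ Ioo 0 τ, SchattenBound b (k * ((τ - s) ^ (a - 1) * s ^ (c - 1))) (f (τ - s) * g s)) :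
    SchattenBound b (k * (τ ^ (a + c - 1) * (Real.Gamma a * Real.Gamma c / Real.Gamma (a + c))))
      (volterra f g τ) := by
  rw [← setIntegral_beta ha hc hτ, ← integral_const_mul]
  exact SchattenBound.integral measurableSet_Ioo (SchattenBound.integrableOn_mul hf hg ha hc hτ h)
    ((integrableOn_beta ha hc hτ).const_mul k) h

end WeightedVolterra

/-! ### Schatten estimate of the Dyson series -/

section HeatDyson

variable {H : Type*} [NormedAddCommGroup H] [InnerProductSpace ℂ H] [CompleteSpace H]
  {P B C : H →L[ℂ] H} {t Λ N : ℝ}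

/-- The kernel `e^{-sD²} (1 + D²)^{1/2} C`, where `P = (1 + D²)⁻¹`. -/
def leftKernel (P C : H →L[ℂ] H) (s : ℝ) : H →L[ℂ] H :=
  heatOp P (s / 2) * (rootHeatOp P (s / 2) * C)

theorem measPos_heatOp : MeasPos (heatOp P) := measPos_of_continuousOn continuousOn_heatOp

theorem measPos_leftKernel : MeasPos (leftKernel P C) := by
  have h : MapsTo (fun s : ℝ => s / 2) (Ioi 0) (Ioi 0) := fun s hs => half_pos (mem_Ioi.1 hs)
  have hc : ContinuousOn (fun s : ℝ => s / 2) (Ioi 0) := by fun_prop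
  exact measPos_of_continuousOn ((continuousOn_heatOp.comp hc h).mul
    ((continuousOn_rootHeatOp.comp hc h).mul continuousOn_const))

theorem leftKernel_mul_sqrt (h0 : 0 ≤ P) (hC : C * CFC.sqrt P = CFC.sqrt P * B) {s : ℝ}
    (hs : 0 < s) : leftKernel P C s * CFC.sqrt P = heatOp P s * B := by
  rw [leftKernel, mul_assoc, mul_assoc, hC, ← mul_assoc (rootHeatOp P _),
    rootHeatOp_mul_sqrt h0 (half_pos hs), ← mul_assoc, ← heatOp_add (half_pos hs).le (half_pos hs).le,
    add_halves]

/-- Right multiplication by `e^{-sD²/2}` gains `s / t` in the Schatten exponent. -/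
def GainsSchatten (P : H →L[ℂ] H) (t Λ : ℝ) : Prop :=
  ∀ {b K : ℝ} {X : H →L[ℂ] H} {s : ℝ}, 0 < s → s / t + b ≤ 1 → SchattenBound b K X →
    SchattenBound (s / t + b) (K * Λ ^ (s / t)) (X * heatOp P (s / 2))

/-- One half of the heat pays for the gain, the other for the singular factor, whose norm is at most
`e^{s/2} (es)^{-1/2}`. This is the origin of `e⁻¹` in the final bound. -/
theorem GainsSchatten.mul_leftKernel (hG : GainsSchatten P t Λ) (h0 : 0 ≤ P)
    (hN : ‖C‖ ≤ N) {b K : ℝ} {X : H →L[ℂ] H} {s : ℝ} (hs : 0 < s) (hsb : s / t + b ≤ 1)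
    (h : SchattenBound b K X) :
    SchattenBound (s / t + b)
      (K * Λ ^ (s / t) * (Real.exp (s / 2) * (N / √(Real.exp 1)) * s ^ ((1 / 2 : ℝ) - 1)))
      (X * leftKernel P C s) := by
  rw [leftKernel, ← mul_assoc X]
  refine (hG hs hsb h).mul_right (C := rootHeatOp P (s / 2) * C) ?_
  have e : (√(2 * Real.exp 1 * (s / 2)))⁻¹ = (√(Real.exp 1))⁻¹ * s ^ ((1 / 2 : ℝ) - 1) := by
    rw [show 2 * Real.exp 1 * (s / 2) = Real.exp 1 * s by ring, Real.sqrt_mul (Real.exp_pos 1).le,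
      mul_inv, Real.sqrt_eq_rpow s, ← Real.rpow_neg hs.le]
    norm_num
  have h1 := norm_rootHeatOp_le h0 (half_pos hs)
  rw [e] at h1
  calc ‖rootHeatOp P (s / 2) * C‖ ≤ ‖rootHeatOp P (s / 2)‖ * ‖C‖ := norm_mul_le _ _
    _ ≤ Real.exp (s / 2) * ((√(Real.exp 1))⁻¹ * s ^ ((1 / 2 : ℝ) - 1)) * N := by gcongr
    _ = _ := by ring

/-- The bound for the `n`-th iterated Volterra convolution of `leftKernel`. -/
def leftWeight (t Λ N : ℝ) (n : ℕ) (τ : ℝ) : ℝ :=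
  Λ ^ (τ / t) * Real.exp (τ / 2) * ((N / √(Real.exp 1) * √Real.pi) ^ (n + 1) /
    Real.Gamma ((n + 1) / 2)) * τ ^ (((n : ℝ) + 1) / 2 - 1)

theorem GainsSchatten.dysonTerm_mul_leftKernel (hG : GainsSchatten P t Λ) (h0 : 0 ≤ P) (hΛ : 0 < Λ)
    (ht : 0 < t) (hN : ‖C‖ ≤ N) {n : ℕ} {τ : ℝ} (hτ : τ ≤ t)
    (ih : ∀ r, 0 < r → r ≤ t →
      SchattenBound (r / t) (leftWeight t Λ N n r) (dysonTerm (leftKernel P C) (leftKernel P C) n r))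
    {s : ℝ} (hs : s ∈ Ioo 0 τ) :
    SchattenBound (τ / t) (Λ ^ (τ / t) * Real.exp (τ / 2) *
        ((N / √(Real.exp 1) * √Real.pi) ^ (n + 1) / Real.Gamma ((n + 1) / 2)) *
        (N / √(Real.exp 1)) * ((τ - s) ^ (((n : ℝ) + 1) / 2 - 1) * s ^ ((1 / 2 : ℝ) - 1)))
      (dysonTerm (leftKernel P C) (leftKernel P C) n (τ - s) * leftKernel P C s) := by
  have e : s / t + (τ - s) / t = τ / t := by ring
  have h := hG.mul_leftKernel h0 hN hs.1 (by rw [e]; exact (div_le_one ht).2 hτ)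
    (ih (τ - s) (sub_pos.2 hs.2) (by linarith [hs.1]))
  rw [e] at h
  refine h.mono (le_of_eq ?_)
  rw [leftWeight, ← e, Real.rpow_add hΛ, show τ / 2 = (τ - s) / 2 + s / 2 by ring, Real.exp_add]
  ring

/-- Powers of `Λ` and exponentials at times `s` and `τ - s` multiply to those at time `τ`. Only the
`(n + 1)`-fold convolution of `s^{-1/2}` is left, evaluated by beta integrals with `Γ(1/2) = √π`. -/
theorem GainsSchatten.dysonTerm_leftKernel (hG : GainsSchatten P t Λ) (h0 : 0 ≤ P) (hΛ : 0 < Λ)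
    (ht : 0 < t) (hN : ‖C‖ ≤ N) (n : ℕ) {τ : ℝ} (hτ0 : 0 < τ) (hτ : τ ≤ t) :
    SchattenBound (τ / t) (leftWeight t Λ N n τ)
      (dysonTerm (leftKernel P C) (leftKernel P C) n τ) := by
  induction n generalizing τ with
  | zero =>
    have h := hG.mul_leftKernel h0 hN hτ0 (by rw [add_zero]; exact (div_le_one ht).2 hτ)
      SchattenBound.one
    rw [add_zero, one_mul, one_mul] at h
    refine h.mono (le_of_eq ?_)
    have : √Real.pi ≠ 0 := by positivity
    rw [leftWeight, Nat.cast_zero, zero_add, zero_add, pow_one, Real.Gamma_one_half_eq,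
      mul_div_cancel_right₀ _ this]
    ring
  | succ n ih =>
    have hn : (0 : ℝ) < (n + 1) / 2 := by positivity
    have h := SchattenBound.volterra (measPos_dysonTerm measPos_leftKernel measPos_leftKernel n)
      measPos_leftKernel hn one_half_pos hτ0
      fun s hs => hG.dysonTerm_mul_leftKernel h0 hΛ ht hN hτ (fun r h1 h2 => ih h1 h2) hs
    refine h.neg.mono (le_of_eq ?_)
    have h1 := (Real.Gamma_pos_of_pos hn).ne'
    have e : ((n : ℝ) + 1) / 2 + 1 / 2 = (((n + 1 : ℕ) : ℝ) + 1) / 2 := by push_cast; ring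
    rw [leftWeight, Real.Gamma_one_half_eq, e, pow_succ _ (n + 1)]
    field_simp

/-- Half of the heat operator gives the gain, the other half is used only as a contraction. The
factor `s ^ (1 - 1)` is `1`, kept to match the beta integral. -/
theorem GainsSchatten.dysonTerm_mul_heatOp (hG : GainsSchatten P t Λ) (h0 : 0 ≤ P) (h1 : P ≤ 1)
    (hΛ : 0 < Λ) (ht : 0 < t) (hN : ‖C‖ ≤ N) {n : ℕ} {τ : ℝ} (hτ : τ ≤ t) {s : ℝ}
    (hs : s ∈ Ioo 0 τ) :
    SchattenBound (τ / t) (Λ ^ (τ / t) * Real.exp (τ / 2) *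
        ((N / √(Real.exp 1) * √Real.pi) ^ (n + 1) / Real.Gamma ((n + 1) / 2)) *
        ((τ - s) ^ (((n : ℝ) + 1) / 2 - 1) * s ^ ((1 : ℝ) - 1)))
      (dysonTerm (leftKernel P C) (leftKernel P C) n (τ - s) * heatOp P s) := by
  have hN0 : 0 ≤ N := (norm_nonneg C).trans hN
  have e : s / t + (τ - s) / t = τ / t := by ring
  have h := (hG hs.1 (by rw [e]; exact (div_le_one ht).2 hτ)
    (hG.dysonTerm_leftKernel h0 hΛ ht hN n (sub_pos.2 hs.2) (by linarith [hs.1]))).mul_right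
      (norm_heatOp_le h0 h1 (s / 2))
  rw [e, mul_assoc, mul_assoc (dysonTerm _ _ _ _), ← heatOp_add (half_pos hs.1).le (half_pos hs.1).le, add_halves] at h
  refine h.mono ?_
  have hΓ := Real.Gamma_pos_of_pos (by positivity : (0 : ℝ) < (n + 1) / 2)
  have hsub := sub_pos.2 hs.2
  have hexp : Real.exp ((τ - s) / 2) ≤ Real.exp (τ / 2) := Real.exp_le_exp.2 (by linarith [hs.1])
  rw [leftWeight, sub_self, Real.rpow_zero, mul_one, mul_one, ← e, Real.rpow_add hΛ]
  calc _ = Λ ^ (s / t) * Λ ^ ((τ - s) / t) * Real.exp ((τ - s) / 2) *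
        ((N / √(Real.exp 1) * √Real.pi) ^ (n + 1) / Real.Gamma ((n + 1) / 2)) *
        ((τ - s) ^ (((n : ℝ) + 1) / 2 - 1)) := by ring
    _ ≤ _ := by gcongr

theorem GainsSchatten.integrableOn_mul_leftKernel (hG : GainsSchatten P t Λ) (h0 : 0 ≤ P)
    (hΛ : 0 < Λ) (ht : 0 < t) (n : ℕ) {τ : ℝ} (hτ0 : 0 < τ) (hτ : τ ≤ t) :
    IntegrableOn (fun s => dysonTerm (leftKernel P C) (leftKernel P C) n (τ - s) * leftKernel P C s)
      (Ioo 0 τ) :=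
  SchattenBound.integrableOn_mul (measPos_dysonTerm measPos_leftKernel measPos_leftKernel n)
    measPos_leftKernel (by positivity : (0 : ℝ) < (n + 1) / 2) one_half_pos hτ0
    fun _ hs => hG.dysonTerm_mul_leftKernel h0 hΛ ht le_rfl hτ
      (fun _ h1 h2 => hG.dysonTerm_leftKernel h0 hΛ ht le_rfl n h1 h2) hs

theorem GainsSchatten.integrableOn_mul_heatOp (hG : GainsSchatten P t Λ) (h0 : 0 ≤ P) (h1 : P ≤ 1)
    (hΛ : 0 < Λ) (ht : 0 < t) (n : ℕ) {τ : ℝ} (hτ0 : 0 < τ) (hτ : τ ≤ t) :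
    IntegrableOn (fun s => dysonTerm (leftKernel P C) (leftKernel P C) n (τ - s) * heatOp P s)
      (Ioo 0 τ) :=
  SchattenBound.integrableOn_mul (measPos_dysonTerm measPos_leftKernel measPos_leftKernel n)
    measPos_heatOp (by positivity : (0 : ℝ) < (n + 1) / 2) one_pos hτ0
    fun _ hs => hG.dysonTerm_mul_heatOp h0 h1 hΛ ht le_rfl hτ hs

/-- The Dyson terms of `e^{-s(D² + F)}`, with the factors `(1 + D²)^{1/2}` moved to the left of the
perturbation. -/
theorem GainsSchatten.dysonTerm_succ_eq (hG : GainsSchatten P t Λ) (h0 : 0 ≤ P) (h1 : P ≤ 1)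
    (hΛ : 0 < Λ) (ht : 0 < t) (hC : C * CFC.sqrt P = CFC.sqrt P * B) (n : ℕ) {τ : ℝ} (hτ0 : 0 < τ)
    (hτ : τ ≤ t) :
    dysonTerm (heatOp P) (fun s => B * rootHeatOp P s) (n + 1) τ =
      -volterra (dysonTerm (leftKernel P C) (leftKernel P C) n) (heatOp P) τ := by
  -- The induction alternates: `T_m B = K_m R` gives `T_{m+1} = -K_m * e^{-sD²}`, because `R R⁻¹
  -- e^{-sD²} = e^{-sD²}`; multiplying this by `B` gives `T_{m+1} B = K_{m+1} R`.
  have hstep : ∀ m, (∀ r, 0 < r → r ≤ t → dysonTerm (heatOp P) (fun s => B * rootHeatOp P s) m r * B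
        = dysonTerm (leftKernel P C) (leftKernel P C) m r * CFC.sqrt P) →
      ∀ r, 0 < r → r ≤ t → dysonTerm (heatOp P) (fun s => B * rootHeatOp P s) (m + 1) r =
        -volterra (dysonTerm (leftKernel P C) (leftKernel P C) m) (heatOp P) r := by
    intro m ih r hr0 hr
    refine congrArg Neg.neg (setIntegral_congr_fun measurableSet_Ioo fun s hs => ?_)
    simp only
    rw [← mul_assoc, ih (r - s) (sub_pos.2 hs.2) (by linarith [hs.1]), mul_assoc,
      sqrt_mul_rootHeatOp h0 hs.1]
  have key : ∀ m, ∀ r, 0 < r → r ≤ t → dysonTerm (heatOp P) (fun s => B * rootHeatOp P s) m r * B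
        = dysonTerm (leftKernel P C) (leftKernel P C) m r * CFC.sqrt P := by
    intro m
    induction m with
    | zero => exact fun r hr0 _ => (leftKernel_mul_sqrt h0 hC hr0).symm
    | succ m ih =>
      intro r hr0 hr
      rw [hstep m ih r hr0 hr]
      change -volterra _ _ r * B = -volterra _ _ r * CFC.sqrt P
      rw [neg_mul, neg_mul, volterra, volterra,
        ← integral_mul_const_of_integrable (hG.integrableOn_mul_heatOp h0 h1 hΛ ht m hr0 hr),
        ← integral_mul_const_of_integrable (hG.integrableOn_mul_leftKernel h0 hΛ ht m hr0 hr)]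
      refine congrArg Neg.neg (setIntegral_congr_fun measurableSet_Ioo fun s hs => ?_)
      rw [mul_assoc, mul_assoc, leftKernel_mul_sqrt h0 hC hs.1]
  exact hstep n (key n) τ hτ0 hτ

/-- For `n ≥ 1` the last convolution, with the constant `1`, turns `Γ(n/2)` into `Γ(n/2 + 1)`. -/
theorem GainsSchatten.schattenBound_dysonTerm (hG : GainsSchatten P t Λ) (h0 : 0 ≤ P) (h1 : P ≤ 1)
    (hΛ : 0 < Λ) (ht : 0 < t) (hN : ‖C‖ ≤ N) (hC : C * CFC.sqrt P = CFC.sqrt P * B) (n : ℕ) {τ : ℝ}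
    (hτ0 : 0 < τ) (hτ : τ ≤ t) :
    SchattenBound (τ / t) (Λ ^ (τ / t) * Real.exp (τ / 2) *
        ((N / √(Real.exp 1) * √Real.pi * √τ) ^ n / Real.Gamma (n / 2 + 1)))
      (dysonTerm (heatOp P) (fun s => B * rootHeatOp P s) n τ) := by
  cases n with
  | zero =>
    have h := (hG hτ0 (by rw [add_zero]; exact (div_le_one ht).2 hτ) SchattenBound.one).mul_right
      (norm_heatOp_le h0 h1 (τ / 2))
    rw [add_zero, one_mul, one_mul, mul_one, ← heatOp_add (half_pos hτ0).le (half_pos hτ0).le,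
      add_halves] at h
    refine h.mono ?_
    rw [pow_zero, Nat.cast_zero, zero_div, zero_add, Real.Gamma_one, div_one, mul_one]
    exact le_mul_of_one_le_right (by positivity) (Real.one_le_exp (by positivity))
  | succ n =>
    have hn : (0 : ℝ) < (n + 1) / 2 := by positivity
    rw [hG.dysonTerm_succ_eq h0 h1 hΛ ht hC n hτ0 hτ]
    have h := SchattenBound.volterra (measPos_dysonTerm measPos_leftKernel measPos_leftKernel n)
      measPos_heatOp hn one_pos hτ0
      fun s hs => hG.dysonTerm_mul_heatOp h0 h1 hΛ ht hN hτ hs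
    refine h.neg.mono (le_of_eq ?_)
    have hΓ := (Real.Gamma_pos_of_pos hn).ne'
    have e : (√τ) ^ (n + 1) = τ ^ (((n : ℝ) + 1) / 2) := by
      rw [Real.sqrt_eq_rpow, ← Real.rpow_natCast, ← Real.rpow_mul hτ0.le]
      push_cast
      ring_nf
    rw [Real.Gamma_one, add_sub_cancel_right, mul_pow _ (√τ), e]
    push_cast
    field_simp

theorem GainsSchatten.schattenBound_dyson (hG : GainsSchatten P t Λ) (h0 : 0 ≤ P) (h1 : P ≤ 1)
    (hΛ : 0 < Λ) (ht : 0 < t) (hN : ‖C‖ ≤ N) (hC : C * CFC.sqrt P = CFC.sqrt P * B) {ω : ℝ}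
    (hω : 0 ≤ ω) (hq : IsVolterraKernel (fun s => B * rootHeatOp P s) ω) {u : ℝ} (hu0 : 0 < u)
    (hu : u ≤ 1) {c : ℝ} (hc : c = N ^ 2 * ((Real.exp 1)⁻¹ * Real.pi * u * t)) :
    SchattenBound u (2 * Real.exp (t / 2) * (1 + √c) * Real.exp c * Λ ^ u)
      (dyson (heatOp P) (fun s => B * rootHeatOp P s) (u * t)) := by
  have hN0 : 0 ≤ N := (norm_nonneg C).trans hN
  have hτ0 : 0 < u * t := mul_pos hu0 ht
  have hτ : u * t ≤ t := mul_le_of_le_one_left ht.le hu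
  set x : ℝ := N / √(Real.exp 1) * √Real.pi * √(u * t) with hx
  have hx0 : 0 ≤ x := by positivity
  have hxc : x ^ 2 = c := by
    rw [hx, hc, mul_pow, mul_pow, div_pow, Real.sq_sqrt (Real.exp_pos 1).le,
      Real.sq_sqrt Real.pi_pos.le, Real.sq_sqrt hτ0.le]
    ring
  have hxs : √c = x := by rw [← hxc, Real.sqrt_sq hx0]
  have hut : u * t / t = u := mul_div_cancel_right₀ u ht.ne'
  have h := SchattenBound.hasSum (b := u) (hasSum_dyson hq hω (norm_heatOp_le h0 h1) hτ0.le)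
    ((hasSum_gammaMajorant x).mul_left (Λ ^ u * Real.exp (u * t / 2))) fun n => by
      have h2 := hG.schattenBound_dysonTerm h0 h1 hΛ ht hN hC n hτ0 hτ
      rw [hut] at h2
      refine h2.mono ?_
      have := pow_div_Gamma_le hx0 n
      gcongr
  refine h.mono ?_
  rw [hxs, hxc]
  -- Rounding `e^{ut/2}` and `1 + 2x` up produces the prefactor `2 e^{t/2} (1 + x)`.
  have hexp : Real.exp (u * t / 2) ≤ Real.exp (t / 2) := Real.exp_le_exp.2 (by linarith)
  have hle : 1 + 2 * x ≤ 2 * (1 + x) := by linarith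
  calc Λ ^ u * Real.exp (u * t / 2) * ((1 + 2 * x) * Real.exp c)
      ≤ Λ ^ u * Real.exp (t / 2) * ((2 * (1 + x)) * Real.exp c) := by gcongr
    _ = _ := by ring

end HeatDyson

end HeatSchatten

end

open scoped ENNReal Topology InnerProductSpace

noncomputable section

namespace HeatSchatten

open Filter Set MeasureTheory


/-! ### The bounded operator induced by `(1 + D²)^{-1/2} F` -/

section OperatorNorm

variable {H : Type*} [NormedAddCommGroup H] [InnerProductSpace ℂ H]

theorem norm_apply_le_of_opENorm_le {A : H →ₗ.[ℂ] H} {N : ℝ} (hN : 0 ≤ N)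
    (h : opENorm A ≤ ENNReal.ofReal N) (x : A.domain) : ‖A x‖ ≤ N * ‖(x : H)‖ := by
  rcases eq_or_ne x 0 with rfl | hx
  · rw [LinearPMap.map_zero, norm_zero]
    positivity
  have hx0 : (x : H) ≠ 0 := fun h => hx (Subtype.ext h)
  have h1 : ‖(((‖(x : H)‖⁻¹ : ℂ) • x : A.domain) : H)‖ ≤ 1 := by
    rw [Submodule.coe_smul]
    exact (norm_smul_inv_norm hx0).le
  have h2 := (le_iSup₂ (f := fun (y : A.domain) (_ : ‖(y : H)‖ ≤ 1) => ‖A y‖ₑ) _ h1).trans h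
  rw [← ofReal_norm, ENNReal.ofReal_le_ofReal_iff hN, LinearPMap.map_smul, norm_smul,
    norm_inv, Complex.norm_real, norm_norm, inv_mul_le_iff₀ (norm_pos_iff.2 hx0), mul_comm] at h2
  exact h2

variable [CompleteSpace H] {D F : H →ₗ.[ℂ] H} {B : H →L[ℂ] H}

/-- On the dense range of `R` the operator `R F` is the map `R x ↦ R B x`, bounded by `N`; `C` is
its continuous extension. -/
theorem exists_mul_invSqrtOneAddSq_eq (hD : IsSelfAdjoint D)
    (hB : ∀ x, ∃ h : invSqrtOneAddSq D x ∈ F.domain, F ⟨invSqrtOneAddSq D x, h⟩ = B x) {N : ℝ}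
    (hN : 0 ≤ N)
    (h : opENorm ((invSqrtOneAddSq D).toLinearMap.compPMap F) ≤ ENNReal.ofReal N) :
    ∃ C : H →L[ℂ] H, ‖C‖ ≤ N ∧ C * invSqrtOneAddSq D = invSqrtOneAddSq D * B := by
  have hdense : DenseRange (invSqrtOneAddSq D) :=
    denseRange_sqrt (invOneAddSq_nonneg hD) (dense_range_invOneAddSq hD)
  have hnorm : ∀ x, ‖(invSqrtOneAddSq D * B).toLinearMap x‖ ≤
      N * ‖(invSqrtOneAddSq D).toLinearMap x‖ := by
    intro x
    obtain ⟨hx, hx'⟩ := hB x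
    have h1 : ‖invSqrtOneAddSq D (F ⟨_, hx⟩)‖ ≤ N * ‖invSqrtOneAddSq D x‖ :=
      norm_apply_le_of_opENorm_le hN h ⟨_, hx⟩
    rwa [hx'] at h1
  refine ⟨(invSqrtOneAddSq D * B).toLinearMap.extendOfNorm (invSqrtOneAddSq D).toLinearMap,
    LinearMap.opNorm_extendOfNorm_le hdense hN hnorm, ?_⟩
  ext x
  exact LinearMap.extendOfNorm_eq hdense ⟨N, hnorm⟩ x

end OperatorNorm

/-! ### Spectral properties of `e^{-tD²/2}` -/

section Spectral

universe v

variable {H : Type v} [NormedAddCommGroup H] [InnerProductSpace ℂ H] [CompleteSpace H]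
  {P : H →L[ℂ] H} {t : ℝ}

theorem heat_eq_rpow {s x : ℝ} (hs : 0 < s) (ht : 0 < t) :
    heat (s / 2) x = heat (t / 2) x ^ (s / t) := by
  rcases le_or_gt x 0 with hx | hx
  · rw [heat_of_nonpos (half_pos hs) hx, heat_of_nonpos (half_pos ht) hx,
      Real.zero_rpow (div_pos hs ht).ne']
  · rw [heat_of_pos (half_pos hs) hx, heat_of_pos (half_pos ht) hx, ← Real.exp_mul]
    congr 1
    field_simp

theorem heatOp_apply_of_eigenvector (h0 : 0 ≤ P) (ht : 0 < t) {x : H} {l : ℝ}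
    (hx : heatOp P (t / 2) x = (l : ℂ) • x) (hx0 : x ≠ 0) {s : ℝ} (hs : 0 < s) :
    heatOp P (s / 2) x = ((l ^ (s / t) : ℝ) : ℂ) • x := by
  have hc := Real.continuous_rpow_const (div_pos hs ht).le
  have h1 : heatOp P (s / 2) = cfc (fun y : ℝ => y ^ (s / t)) (heatOp P (t / 2)) := by
    rw [heatOp_of_pos (half_pos hs), heatOp_of_pos (half_pos ht),
      ← cfc_comp' _ _ P hc.continuousOn (continuous_heat (half_pos ht)).continuousOn
        (IsSelfAdjoint.of_nonneg h0)]
    exact cfc_congr fun x _ => heat_eq_rpow hs ht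
  have hs : IsSelfAdjoint (heatOp P (t / 2)) := IsSelfAdjoint.of_nonneg (heatOp_nonneg (t / 2))
  rw [h1]
  exact cfc_apply_of_eigenvector hs hx hx0 hc.continuousOn

/-- A vector killed by `e^{-tD²/2}` is killed by all its positive powers, hence by `e^{-sD²}` for
every `s > 0`, which tends strongly to the identity. -/
theorem eigenvalue_heatOp_pos (h0 : 0 ≤ P) (h1 : P ≤ 1) (hd : DenseRange P) (ht : 0 < t) {x : H}
    {l : ℝ} (hx : heatOp P (t / 2) x = (l : ℂ) • x) (hx0 : x ≠ 0) : 0 < l := by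
  have hn : 0 ≤ l := by
    have h2 := re_inner_apply_self (heatOp_nonneg (P := P) (t / 2)) x
    rw [hx, inner_smul_right, inner_self_eq_norm_sq_to_K, RCLike.re_to_complex] at h2
    have h3 : l * ‖x‖ ^ 2 = ‖CFC.sqrt (heatOp P (t / 2)) x‖ ^ 2 := by
      rw [← h2, Complex.re_ofReal_mul]
      norm_cast
    exact nonneg_of_mul_nonneg_left (h3 ▸ sq_nonneg _) (by positivity)
  refine hn.lt_of_ne' fun hl => hx0 ?_
  refine tendsto_nhds_unique (tendsto_heatOp_apply h0 h1 hd x)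
    (tendsto_const_nhds.congr' (eventually_mem_nhdsWithin.mono fun s hs => ?_))
  have hs' : (0 : ℝ) < 2 * s := by have := mem_Ioi.1 hs; linarith
  have h2 := heatOp_apply_of_eigenvector h0 ht hx hx0 hs'
  rw [hl, Real.zero_rpow (div_pos hs' ht).ne', Complex.ofReal_zero, zero_smul,
    mul_div_cancel_left₀ _ two_ne_zero] at h2
  exact h2.symm

theorem trace_heatOp_ne_zero [Nontrivial H] (h0 : 0 ≤ P) (h1 : P ≤ 1) (hd : DenseRange P)
    (ht : 0 < t) : trace (heatOp P (t / 2)) ≠ 0 := by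
  intro h
  have h2 := (schattenBound_one_of_trace_le (heatOp_nonneg (P := P) (t / 2)) le_rfl
    (by rw [h]; exact zero_le)).norm_le
  obtain ⟨x, hx⟩ := exists_ne (0 : H)
  refine (eigenvalue_heatOp_pos (l := 0) h0 h1 hd ht ?_ hx).false
  rw [norm_le_zero_iff.1 h2, Complex.ofReal_zero, zero_smul, zero_apply]

/-- A finite trace makes `ρ = e^{-tD²/2}` compact. In its eigenbasis `e^{-sD²/2} = ρ^{s/t}` is
diagonal, and Hölder's inequality applies with `a = s/t`. -/
theorem gainsSchatten_of_trace_le (h0 : 0 ≤ P) (h1 : P ≤ 1) (hd : DenseRange P) (ht : 0 < t) {Λ : ℝ}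
    (hΛ : 0 < Λ) (htr : trace (heatOp P (t / 2)) ≤ ENNReal.ofReal Λ) : GainsSchatten P t Λ := by
  have hρ := heatOp_nonneg (P := P) (t / 2)
  obtain ⟨ι, β, μ, hμ⟩ := exists_eigenbasis
    ((schattenBound_one_of_trace_le hρ hΛ.le htr).isCompactOperator one_pos)
    (IsSelfAdjoint.of_nonneg hρ)
  have hne : ∀ j, β j ≠ 0 := fun j => β.orthonormal.ne_zero j
  have hpos : ∀ j, 0 < μ j := fun j => eigenvalue_heatOp_pos h0 h1 hd ht (hμ j) (hne j)
  have hre : ∀ j, RCLike.re ⟪β j, heatOp P (t / 2) (β j)⟫_ℂ = μ j := fun j => by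
    rw [hμ, inner_smul_right, inner_self_eq_norm_sq_to_K, β.orthonormal.1 j]
    simp
  have hsum : ∀ J : Finset ι, ∑ j ∈ J, μ j ≤ Λ := fun J => by
    rw [trace_eq_tsum hρ β] at htr
    simp only [hre] at htr
    have h2 := (ENNReal.sum_le_tsum J).trans htr
    rw [← ENNReal.ofReal_sum_of_nonneg fun j _ => (hpos j).le] at h2
    exact (ENNReal.ofReal_le_ofReal_iff hΛ.le).1 h2
  intro b K X s hs hsb h
  exact h.mul_diagonal β hpos hΛ hsum (div_pos hs ht) hsb
    fun j => heatOp_apply_of_eigenvector h0 ht (hμ j) (hne j) hs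

theorem schattenNorm_eq_zero_of_subsingleton [Subsingleton H] {p : ℝ} (hp : 0 < p) (A : H →L[ℂ] H) :
    schattenNorm p A = 0 := by
  have h : trace (CFC.abs A ^ p) = 0 := by
    rw [trace]
    simp [Subsingleton.elim ((CFC.abs A ^ p : H →L[ℂ] H) _) 0]
  rw [schattenNorm, h, ENNReal.zero_rpow_of_pos (inv_pos.2 hp)]

end Spectral

/-! ### The estimate in `[0, ∞]` -/

section Main

variable {H : Type*} [NormedAddCommGroup H] [InnerProductSpace ℂ H] [CompleteSpace H]
  {D F : H →ₗ.[ℂ] H}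

theorem schattenNorm_expNeg_le (hD : IsSelfAdjoint D) (hF : IsFirstOrder D F) {B : H →L[ℂ] H}
    (hB : ∀ x, ∃ h : invSqrtOneAddSq D x ∈ F.domain, F ⟨invSqrtOneAddSq D x, h⟩ = B x) {ω : ℝ}
    (hω : 0 ≤ ω) (hq : IsVolterraKernel (fun s => B * rootHeatOp (invOneAddSq D) s) ω)
    {u t : ℝ} (hu0 : 0 < u) (hu : u ≤ 1) (ht : 0 < t) {c : ℝ≥0∞}
    (hc : c = opENorm ((invSqrtOneAddSq D).toLinearMap.compPMap F) ^ 2 *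
      ENNReal.ofReal ((Real.exp 1)⁻¹ * Real.pi * u * t)) :
    schattenNorm u⁻¹ (expNeg (sq D + F) (u * t)) ≤
      2 * ENNReal.ofReal (Real.exp (t / 2)) * (1 + c ^ (1 / 2 : ℝ)) * EReal.exp (c : EReal) *
        trace (expNeg (sq D) (t / 2)) ^ u := by
  set P := invOneAddSq D with hP
  have h0 : 0 ≤ P := invOneAddSq_nonneg hD
  have h1 : P ≤ 1 := invOneAddSq_le_one hD
  have hd : DenseRange P := dense_range_invOneAddSq hD
  have hdom : Dense ((sq D + F).domain : Set H) := by
    refine (dense_sq_domain hD).mono fun x hx => ⟨hx, ?_⟩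
    exact hF.domain_le (mem_sq_domain.1 hx).1
  rw [(isExpNeg_sq_add hD hB hω hq).expNeg_eq hdom (by positivity),
    (isExpNeg_sq hD).expNeg_eq (dense_sq_domain hD) (by positivity)]
  -- On a nontrivial space no factor on the right vanishes, so an infinite trace or operator norm
  -- makes the right side infinite. On the zero space the trace is zero, and the left side is too.
  rcases subsingleton_or_nontrivial H with hH | hH
  · rw [schattenNorm_eq_zero_of_subsingleton (inv_pos.2 hu0)]
    exact zero_le
  set N := opENorm ((invSqrtOneAddSq D).toLinearMap.compPMap F) with hN
  have htr0 := trace_heatOp_ne_zero h0 h1 hd ht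
  have e1 : (2 * ENNReal.ofReal (Real.exp (t / 2)) : ℝ≥0∞) ≠ 0 :=
    mul_ne_zero two_ne_zero (ENNReal.ofReal_pos.2 (Real.exp_pos _)).ne'
  have e2 : (1 + c ^ (1 / 2 : ℝ) : ℝ≥0∞) ≠ 0 := fun h => one_ne_zero (add_eq_zero.1 h).1
  have e3 : EReal.exp (c : EReal) ≠ 0 := by
    rw [Ne, EReal.exp_eq_zero_iff]
    exact EReal.coe_ennreal_ne_bot c
  have e4 : trace (heatOp P (t / 2)) ^ u ≠ 0 := fun h =>
    htr0 ((ENNReal.rpow_eq_zero_iff_of_pos hu0).1 h)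
  have hpos : 0 < (Real.exp 1)⁻¹ * Real.pi * u * t := by positivity
  rcases eq_or_ne (trace (heatOp P (t / 2))) ⊤ with htr | htr
  · rw [htr, ENNReal.top_rpow_of_pos hu0, ENNReal.mul_top (mul_ne_zero (mul_ne_zero e1 e2) e3)]
    exact le_top
  rcases eq_or_ne N ⊤ with hNt | hNt
  · have hct : c = ⊤ := by
      rw [hc, hNt, ENNReal.top_pow two_ne_zero, ENNReal.top_mul (ENNReal.ofReal_pos.2 hpos).ne']
    have e5 : (1 + c ^ (1 / 2 : ℝ) : ℝ≥0∞) = ⊤ := by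
      rw [hct, ENNReal.top_rpow_of_pos one_half_pos, add_top]
    rw [e5, ENNReal.mul_top e1, ENNReal.top_mul e3, ENNReal.top_mul e4]
    exact le_top
  have hN' : N = ENNReal.ofReal N.toReal := (ENNReal.ofReal_toReal hNt).symm
  have hΛ' := (ENNReal.ofReal_toReal htr).symm
  have hΛ : 0 < (trace (heatOp P (t / 2))).toReal := ENNReal.toReal_pos htr0 htr
  set Λ := (trace (heatOp P (t / 2))).toReal
  obtain ⟨C, hCN, hC⟩ := exists_mul_invSqrtOneAddSq_eq hD hB ENNReal.toReal_nonneg hN'.le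
  have hc' : c = ENNReal.ofReal (N.toReal ^ 2 * ((Real.exp 1)⁻¹ * Real.pi * u * t)) := by
    rw [hc, ENNReal.ofReal_mul (sq_nonneg _), ENNReal.ofReal_pow ENNReal.toReal_nonneg, ← hN']
  have hG : GainsSchatten P t Λ := gainsSchatten_of_trace_le h0 h1 hd ht hΛ hΛ'.le
  have hmain := (hG.schattenBound_dyson h0 h1 hΛ ht hCN hC hω hq hu0 hu rfl).schattenNorm_le hu0
  refine hmain.trans (le_of_eq ?_)
  set r := N.toReal ^ 2 * ((Real.exp 1)⁻¹ * Real.pi * u * t) with hr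
  have hr0 : 0 ≤ r := by positivity
  rw [hc', hΛ', EReal.coe_ennreal_ofReal, max_eq_left hr0, EReal.exp_coe,
    ENNReal.ofReal_rpow_of_pos hΛ, ENNReal.ofReal_rpow_of_nonneg hr0 one_half_pos.le,
    ← Real.sqrt_eq_rpow, ENNReal.ofReal_mul (by positivity), ENNReal.ofReal_mul (by positivity),
    ENNReal.ofReal_mul (by positivity), ENNReal.ofReal_mul (by positivity),
    ENNReal.ofReal_add (by positivity) (by positivity), ENNReal.ofReal_one, ENNReal.ofReal_ofNat]

end Main

end HeatSchatten

end

theorem lemma2p2 {H : Type*} [NormedAddCommGroup H] [InnerProductSpace ℂ H] [CompleteSpace H]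
    (D F : H →ₗ.[ℂ] H) (hD : IsSelfAdjoint D) (hF : HeatSchatten.IsFirstOrder D F) :
    HeatSchatten.GeneratesExpNeg (HeatSchatten.sq D) ∧
    HeatSchatten.GeneratesExpNeg (HeatSchatten.sq D + F) ∧
    ∀ u t : ℝ, 0 < u → u ≤ 1 → 0 < t → ∀ c : ENNReal,
      c = HeatSchatten.opENorm ((HeatSchatten.invSqrtOneAddSq D).toLinearMap.compPMap F) ^ 2 *
        ENNReal.ofReal ((Real.exp 1)⁻¹ * Real.pi * u * t) →
      HeatSchatten.schattenNorm u⁻¹ (HeatSchatten.expNeg (HeatSchatten.sq D + F) (u * t)) ≤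
        2 * ENNReal.ofReal (Real.exp (t / 2)) * (1 + c ^ (1 / 2 : ℝ)) * EReal.exp (c : EReal) *
          HeatSchatten.trace (HeatSchatten.expNeg (HeatSchatten.sq D) (t / 2)) ^ u := by
  obtain ⟨B, hB⟩ := hF.exists_bounded hD
  obtain ⟨ω, hω, hq⟩ := HeatSchatten.exists_isVolterraKernel (HeatSchatten.invOneAddSq_nonneg hD) B
  exact ⟨⟨_, HeatSchatten.isExpNeg_sq hD⟩, ⟨_, HeatSchatten.isExpNeg_sq_add hD hB hω hq⟩,
    fun _ _ hu0 hu ht _ hc => HeatSchatten.schattenNorm_expNeg_le hD hF hB hω hq hu0 hu ht hc⟩
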